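/- **Setting.** Let $\mathcal S,\mathcal A$ be finite nonempty sets, $r:\mathcal S\times\mathcal A\times\mathcal S\to\mathbb R$ a reward, $\gamma\in[0,1)$ a discount factor, $\alpha\in(0,1)$, and let $p^c_{s,a}$ be (true, unknown) transition probability vectors on $\mathcal S$. Let $\rho\in\{\mathrm{VaR}_\alpha,\mathrm{CVaR}_\alpha\}$, where $\mathrm{VaR}_\alpha(X)=\inf\{z:\mathbb P(X\le z)\ge\alpha\}$ and $\mathrm{CVaR}_\alpha(X)=\mathrm{VaR}_\alpha(X)-\frac1\alpha\mathbb E[(\mathrm{VaR}_\alpha(X)-X)^+]$ is the mean of the lower $\alpha$-tail of $X$ (equal to $\frac1\alpha\mathbb E[X\mathbf 1_{X\le \mathrm{VaR}_\alpha(X)}]$ when $\mathbb P(X\le\mathrm{VaR}_\alpha(X))=\alpha$). For $p\in\mathbb R^{\mathcal S}$ and $V:\mathcal S\to\mathbb R$ put $f(p|s,a,V)=\sum_{s'}p(s')[r(s,a,s')+\gamma V(s')]$. For a family $\Phi=(\Phi_{s,a})$ of laws on the probability simplex, put $\mathcal T^\Phi Q(s,a)=\rho_{p\sim\Phi_{s,a}}\big(f(p|s,a,\max_bQ(\cdot,b))\big)$.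 For a randomized policy $\pi$ let $V^{\Phi,\pi}=\lim_k(\mathcal L_\pi^\Phi)^k0$ with $\mathcal L^\Phi_\pi V(s)=\sum_a\pi(a|s)\,\rho_{p\sim\Phi_{s,a}}(f(p|s,a,V))$ be its nested infinite-horizon value, let $V^{\Phi,*}=\sup_\pi V^{\Phi,\pi}$, and let $Q^{\Phi,*}(s,a)=\rho_{p\sim\Phi_{s,a}}(f(p|s,a,V^{\Phi,*}))$ be the optimal Q-function. **Data.** In each stage $t=1,2,\dots$, $n(t)$ observations $(s_{t,i},a_{t,i},s'_{t,i})$, $1\le i\le n(t)$, arrive, where $n(t)\ge1$ for infinitely many $t$. The pairs $(s_{t,i},a_{t,i})$ are chosen in an arbitrary way, and conditionally on all earlier observations and on $(s_{t,i},a_{t,i})=(s,a)$ the state $s'_{t,i}$ has law $p^c_{s,a}$. Let $\omega$ be the whole observation process and $O^\infty_{s,a,s'}(\omega)\in\mathbb N\cup\{\infty\}$ the total number of observations equal to $(s,a,s')$. Given prior parameters $\phi^0_{s,a}(s')\ge1$, let $\phi^t_{s,a}(s')$ be $\phi^0_{s,a}(s')$ plus the number of observations $(s,a,s')$ in stages $1,\dots,t$.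 The limiting posterior $\phi^\omega_{s,a}$ is the Dirac measure at $p^c_{s,a}$ if $O^\infty_{s,a,s'}(\omega)=\infty$ for some $s'$, and $\mathrm{Dirichlet}(\phi^0_{s,a}+O^\infty_{s,a}(\omega))$ otherwise. The data-conditional optimal Q-function is $Q^{\omega,*}=Q^{\phi^\omega,*}$. **Algorithm.** Start with $Q=0$ and $N_{s,a}=N$ for all $(s,a)$, where $N\ge1$ is given. In stage $t=1,2,\dots$ first process the $n(t)$ new observations one by one: an observation of the pair $(s,a)$ replaces $N_{s,a}$ by $\max\{N_{s,a}-1,N\}$ and $N_{\bar s,\bar a}$ by $N_{\bar s,\bar a}+1$ for every other pair $(\bar s,\bar a)$. Then perform $m(t)$ updates, where $m(t)\ge1$ for infinitely many $t$. The $\ell$-th update of stage $t$ uses the learning rate $\lambda=\lambda_{m(1)+\dots+m(t-1)+\ell}$; for all $(s,a)$ it draws $p_1,\dots,p_{N_{s,a}}$ i.i.d. from $\mathrm{Dirichlet}(\phi^t_{s,a})$, sets $X_i=f(p_i|s,a,\max_bQ(\cdot,b))$ with order statistics $X_{1:N_{s,a}}\le\dots\le X_{N_{s,a}:N_{s,a}}$,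 and replaces all entries of $Q$ simultaneously by $$Q'(s,a)=(1-\lambda)Q(s,a)+\lambda\,\widehat{\mathcal T}Q(s,a),$$ where $\widehat{\mathcal T}Q(s,a)=X_{\lceil N_{s,a}\alpha\rceil:N_{s,a}}$ if $\rho=\mathrm{VaR}_\alpha$, and $\widehat{\mathcal T}Q(s,a)=\frac1{\lceil N_{s,a}\alpha\rceil}\sum_{k=1}^{\lceil N_{s,a}\alpha\rceil}X_{k:N_{s,a}}$ if $\rho=\mathrm{CVaR}_\alpha$. Conditionally on $\omega$, all draws (over stages, updates, pairs and sample indices) are independent. Let $Q_t$ be the Q-function at the end of stage $t$. **Theorem.** Assume that the learning rates $\lambda_\ell\ge0$ satisfy $\sum_{\ell\ge1}\lambda_\ell=\infty$ and $\sum_{\ell\ge1}\lambda_\ell^2<\infty$. Then, almost surely, $Q^{\omega,*}$ is the unique solution of $Q=\mathcal T^{\phi^\omega}Q$, and $$\lim_{t\to\infty}\|Q_t-Q^{\omega,*}\|_\infty=0 .$$ -/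

import Mathlib

open MeasureTheory Filter Topology

noncomputable section

namespace BRQL

/-! ### Dirichlet distributions -/

/-- The uniform (flat) measure on the probability simplex of `S → ℝ`, up to a positive constant:
the cone measure, i.e. the image of Lebesgue measure on `{x | 0 < x, ∑ x ≤ 1}` under the radial
projection `x ↦ x / ∑ x`. -/
def simplexMeasure (S : Type*) [Fintype S] : Measure (S → ℝ) :=
  ((volume : Measure (S → ℝ)).restrict {x | (∀ i, 0 < x i) ∧ ∑ i, x i ≤ 1}).map
    (fun x i => x i / ∑ j, x j)

/-- The unnormalised Dirichlet law: density `∏ i, p i ^ (φ i - 1)` on the simplex. -/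
def dirichletWeight {S : Type*} [Fintype S] (φ : S → ℝ) : Measure (S → ℝ) :=
  (simplexMeasure S).withDensity (fun p => ENNReal.ofReal (∏ i, p i ^ (φ i - 1)))

/-- The Dirichlet distribution with parameter `φ`: density proportional to
`∏ i, p i ^ (φ i - 1)` on the simplex. -/
def dirichlet {S : Type*} [Fintype S] (φ : S → ℝ) : Measure (S → ℝ) :=
  (dirichletWeight φ Set.univ)⁻¹ • dirichletWeight φ

/-! ### Risk functionals -/

/-- `VaR_α(X) = inf {z | P(X ≤ z) ≥ α}`. -/
def valueAtRisk {E : Type*} [MeasurableSpace E] (α : ℝ) (P : Measure E) (X : E → ℝ) : ℝ :=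
  sInf {z : ℝ | α ≤ P.real {x | X x ≤ z}}

/-- `CVaR_α(X)` for a reward `X`: the mean of the lower `α`-tail of `X`. It equals
`α⁻¹ (∫_{X ≤ VaR} X dP + VaR (α - P(X ≤ VaR)))`, hence `α⁻¹ ∫_{X ≤ VaR} X dP` if
`P(X ≤ VaR) = α`. -/
def condValueAtRisk {E : Type*} [MeasurableSpace E] (α : ℝ) (P : Measure E) (X : E → ℝ) : ℝ :=
  valueAtRisk α P X - α⁻¹ * ∫ x, max (valueAtRisk α P X - X x) 0 ∂P

/-- The two admissible risk functionals. -/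
inductive RiskKind
  | VaR
  | CVaR

def risk {E : Type*} [MeasurableSpace E] (ρ : RiskKind) (α : ℝ) (P : Measure E) (X : E → ℝ) : ℝ :=
  match ρ with
  | .VaR => valueAtRisk α P X
  | .CVaR => condValueAtRisk α P X

/-- The order statistic `X_{k:N}` (`1 ≤ k ≤ N`): the `k`-th smallest of `x 0, …, x (N - 1)`. -/
def orderStat (N : ℕ) (x : ℕ → ℝ) (k : ℕ) : ℝ :=
  if h : 1 ≤ k ∧ k ≤ N then
    x (Tuple.sort (fun i : Fin N => x i) ⟨k - 1, by omega⟩)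
  else 0

/-- The Monte Carlo estimator of the risk functional from `N` samples `x 0, …, x (N - 1)`. -/
def riskEstimator (ρ : RiskKind) (α : ℝ) (N : ℕ) (x : ℕ → ℝ) : ℝ :=
  match ρ with
  | .VaR => orderStat N x ⌈(N : ℝ) * α⌉₊
  | .CVaR => (⌈(N : ℝ) * α⌉₊ : ℝ)⁻¹ * ∑ k ∈ Finset.Icc 1 ⌈(N : ℝ) * α⌉₊, orderStat N x k

/-! ### The algorithm's inputs -/

/-- The inputs of multi-stage Bayesian risk-averse Q-learning (with termination stage `∞`).
Stages are numbered from `1`; learning rates are numbered from `1` across all stages. -/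
structure Input (S A : Type*) where
  /-- reward `r s a s'` -/
  r : S → A → S → ℝ
  /-- discount factor -/
  γ : ℝ
  /-- risk functional -/
  ρ : RiskKind
  /-- risk level -/
  α : ℝ
  /-- parameters of the Dirichlet priors -/
  prior : S → A → S → ℝ
  /-- minimal Monte Carlo sample size `N` -/
  minSize : ℕ
  /-- number of real-world observations arriving at the beginning of stage `t` -/
  n : ℕ → ℕ
  /-- number of Q-learning updates in stage `t` -/
  m : ℕ → ℕ
  /-- learning rates -/
  lr : ℕ → ℝ

variable {S A : Type*} [Fintype S] [Fintype A] [DecidableEq S] [DecidableEq A]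

/-- `f(p | s, a) = ∑ s', p s' * (r s a s' + γ V s')`. -/
def backup (I : Input S A) (V : S → ℝ) (s : S) (a : A) (p : S → ℝ) : ℝ :=
  ∑ s', p s' * (I.r s a s' + I.γ * V s')

/-- `max_b Q(s, b)`. -/
def maxQ (Q : S → A → ℝ) (s : S) : ℝ := ⨆ b, Q s b

/-! ### Bayesian risk MDPs

`Φ s a` is the (posterior) law of the unknown transition vector of the pair `(s, a)`. -/

/-- The Bellman operator of the Q-function. -/
def bellman (I : Input S A) (Φ : S → A → Measure (S → ℝ)) (Q : S → A → ℝ) : S → A → ℝ :=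
  fun s a => risk I.ρ I.α (Φ s a) (backup I (maxQ Q) s a)

/-- One stage of the nested value of a randomised stationary policy `π`, with continuation
value `V`. -/
def policyStep (I : Input S A) (Φ : S → A → Measure (S → ℝ)) (π : S → stdSimplex ℝ A)
    (V : S → ℝ) : S → ℝ :=
  fun s => ∑ a, (π s : A → ℝ) a * risk I.ρ I.α (Φ s a) (backup I V s a)

/-- The infinite-horizon nested value of the policy `π`, as the limit of the `k`-stage values. -/
def policyValue (I : Input S A) (Φ : S → A → Measure (S → ℝ)) (π : S → stdSimplex ℝ A) (s : S) :
    ℝ :=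
  limUnder atTop (fun k : ℕ => ((policyStep I Φ π)^[k] 0) s)

/-- The optimal value function: supremum over all randomised policies. -/
def optimalValue (I : Input S A) (Φ : S → A → Measure (S → ℝ)) (s : S) : ℝ :=
  ⨆ π : S → stdSimplex ℝ A, policyValue I Φ π s

/-- The optimal Q-function. -/
def optimalQ (I : Input S A) (Φ : S → A → Measure (S → ℝ)) : S → A → ℝ :=
  fun s a => risk I.ρ I.α (Φ s a) (backup I (optimalValue I Φ) s a)

/-! ### Data and posteriors

A data path `d` gives the observation `d t i = (s, a, s')` number `i` (`i < n t`, counted from `0`)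
of stage `t ≥ 1`; its other values are never used. -/

/-- Parameters of the Dirichlet posteriors in stage `t`. -/
def posterior (I : Input S A) (d : ℕ → ℕ → S × A × S) : ℕ → S → A → S → ℝ
  | 0 => I.prior
  | t + 1 => fun s a s' => posterior I d t s a s' +
      ((Finset.range (I.n (t + 1))).filter (fun i => d (t + 1) i = (s, a, s'))).card

/-- Sample size of the pair `(s, a)` after the first `i` observations of stage `t`, starting from
the value `N₀`: an observation that changes the posterior of `(s, a)` decreases it by one, but not
below the minimal size, and any other observation increases it by one. -/
def batchSize (I : Input S A) (d : ℕ → ℕ → S × A × S) (t : ℕ) (s : S) (a : A) (N₀ : ℕ) : ℕ → ℕ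
  | 0 => N₀
  | i + 1 =>
    if (d t i).1 = s ∧ (d t i).2.1 = a then max (batchSize I d t s a N₀ i - 1) I.minSize
    else batchSize I d t s a N₀ i + 1

/-- The Monte Carlo sample size `N_{s,a}` used in stage `t`. -/
def sampleSize (I : Input S A) (d : ℕ → ℕ → S × A × S) : ℕ → S → A → ℕ
  | 0 => fun _ _ => I.minSize
  | t + 1 => fun s a => batchSize I d (t + 1) s a (sampleSize I d t s a) (I.n (t + 1))

/-- Total number of observed transitions `(s, a, s')`. -/
def totalCount (I : Input S A) (d : ℕ → ℕ → S × A × S) (s : S) (a : A) (s' : S) : ℕ∞ :=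
  Set.encard {q : ℕ × ℕ | 1 ≤ q.1 ∧ q.2 < I.n q.1 ∧ d q.1 q.2 = (s, a, s')}

open Classical in
/-- The limiting posterior: the Dirac mass at the true transition vector if `(s, a)` is observed
infinitely often, and otherwise the Dirichlet posterior given all observations. -/
def limitPosterior (I : Input S A) (pc : S → A → S → ℝ) (d : ℕ → ℕ → S × A × S) (s : S) (a : A) :
    Measure (S → ℝ) :=
  if ∃ s', totalCount I d s a s' = ⊤ then Measure.dirac (pc s a)
  else dirichlet (fun s' => I.prior s a s' + ((totalCount I d s a s').toNat : ℝ))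

/-- The data-conditional optimal Q-function. -/
def dataOptimalQ (I : Input S A) (pc : S → A → S → ℝ) (d : ℕ → ℕ → S × A × S) : S → A → ℝ :=
  optimalQ I (limitPosterior I pc d)

/-! ### The algorithm -/

/-- Index `(t, ℓ, s, a, i)` of a Monte Carlo draw: stage `t`, update `ℓ` (from `1`), pair `(s, a)`,
number `i` (from `0`) of the draw. -/
abbrev Draw (S A : Type*) := ℕ × ℕ × S × A × ℕ

/-- The Q-function after `ℓ` updates in stage `t`, starting from `Q₀`. -/
def stageUpdate (I : Input S A) (d : ℕ → ℕ → S × A × S) (x : Draw S A → S → ℝ) (t : ℕ)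
    (Q₀ : S → A → ℝ) : ℕ → S → A → ℝ
  | 0 => Q₀
  | ℓ + 1 => fun s a =>
    (1 - I.lr ((∑ τ ∈ Finset.Ico 1 t, I.m τ) + (ℓ + 1))) * stageUpdate I d x t Q₀ ℓ s a +
      I.lr ((∑ τ ∈ Finset.Ico 1 t, I.m τ) + (ℓ + 1)) *
        riskEstimator I.ρ I.α (sampleSize I d t s a)
          (fun i => backup I (maxQ (stageUpdate I d x t Q₀ ℓ)) s a (x (t, ℓ + 1, s, a, i)))

/-- The Q-function `Q_t` at the end of stage `t`, as a function of the data `d` and the Monte Carlo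
draws `x`. -/
def qStage (I : Input S A) (d : ℕ → ℕ → S × A × S) (x : Draw S A → S → ℝ) : ℕ → S → A → ℝ
  | 0 => 0
  | t + 1 => stageUpdate I d x (t + 1) (qStage I d x t) (I.m (t + 1))

/-! ### Probabilistic assumptions -/

variable {Ω : Type*}

/-- The σ-algebra of the observations that precede observation `i` of stage `t`. -/
@[reducible] def pastData (I : Input S A) (obs : ℕ → ℕ → Ω → S × A × S) (t i : ℕ) : MeasurableSpace Ω :=
  ⨆ (τ : ℕ) (j : ℕ) (_ : 1 ≤ τ ∧ j < I.n τ ∧ (τ < t ∨ (τ = t ∧ j < i))),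
    MeasurableSpace.comap (obs τ j) ⊤

/-- The σ-algebra of the whole observation process. -/
@[reducible] def allData (I : Input S A) (obs : ℕ → ℕ → Ω → S × A × S) : MeasurableSpace Ω :=
  ⨆ (τ : ℕ) (j : ℕ) (_ : 1 ≤ τ ∧ j < I.n τ), MeasurableSpace.comap (obs τ j) ⊤

/-- The observations are transitions of the real environment: given all earlier observations and
the current state-action pair `(s, a)`, which is chosen in an arbitrary way, the next state has
law `pc s a`. -/
def IsTransitionData [MeasurableSpace Ω] (I : Input S A) (P : Measure Ω) (pc : S → A → S → ℝ)
    (obs : ℕ → ℕ → Ω → S × A × S) : Prop :=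
  ∀ t i, 1 ≤ t → i < I.n t → ∀ (s : S) (a : A) (s' : S) (E : Set Ω),
    MeasurableSet[pastData I obs t i] E →
      P (E ∩ {ω | obs t i ω = (s, a, s')}) =
        ENNReal.ofReal (pc s a s') * P (E ∩ {ω | (obs t i ω).1 = s ∧ (obs t i ω).2.1 = a})

/-- Given the observation process (which is not influenced by the learning process), all Monte Carlo
draws are independent, and those of stage `t` for `(s, a)` have the Dirichlet posterior of stage `t`
as their law. -/
def IsPosteriorSampling [MeasurableSpace Ω] (I : Input S A) (P : Measure Ω)
    (obs : ℕ → ℕ → Ω → S × A × S) (draw : Draw S A → Ω → S → ℝ) : Prop :=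
  ∀ (F : Finset (Draw S A)), (∀ j ∈ F, 1 ≤ j.1 ∧ 1 ≤ j.2.1 ∧ j.2.1 ≤ I.m j.1) →
    ∀ B : Draw S A → Set (S → ℝ), (∀ j, MeasurableSet (B j)) →
      ∀ E : Set Ω, MeasurableSet[allData I obs] E →
        P (E ∩ ⋂ j ∈ F, draw j ⁻¹' B j) =
          ∫⁻ ω in E, ∏ j ∈ F,
            dirichlet (posterior I (fun t i => obs t i ω) j.1 j.2.2.1 j.2.2.2.1) (B j) ∂P

end BRQL

end

namespace BRQL

/-! ### Order statistics -/

/-! The algorithm is a stochastic approximation of the fixed point of a `γ`-contraction. VaR and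
CVaR are monotone and equivariant under translations, so `bellman` contracts in the sup norm, and
the greedy policy identifies its fixed point with the optimal Q-function (`bellman_eq_self_iff`). It
remains to see that the errors of the Monte Carlo estimator, weighted by the learning rates, are
harmless.

For a fixed value function `V` the error is bounded pathwise by a multiple of `ε`, a linear
combination of deviations of empirical means of three bounded functions, and a rounding term of
order `1 / N` (`exists_abs_riskEstimator_sub_risk_le`). This requires a unique `α`-quantile under
the limiting law; Dirichlet laws have it because they charge every nonempty relatively open subset
of the connected open simplex. The conditional expectations of the deviations tend to zero on almost
every data path (`tendsto_integral_abs_empMean_sub`). If a pair is observed infinitely often, its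
posteriors concentrate at the true transition vector, and few samples suffice. Otherwise its
posterior is eventually constant, while every later observation raises its sample size. Convergence
of the posterior means is a martingale argument that is insensitive to how pairs are chosen
(`ae_exists_tendsto_sum_innov`); concentration follows from the second moments of Dirichlet laws,
hence from their normalisation constant. The centred deviations are martingale differences given the
data, so square summability of the learning rates makes their weighted series converge
(`ae_exists_tendsto_sum_centered`). Both contributions are `Negligible`, and
`eventually_le_of_recursion` shows that a contracting recursion forgets such perturbations.

The iterates and the limiting law are random, whereas the noise estimates concern fixed functions.
Since the iterates are bounded and the estimator is nonexpansive in `V`, finitely many members of a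
countable dense sequence approximate all relevant `V`; the limiting law of a pair takes only
countably many values. A single null set therefore suffices. -/

theorem orderStat_eq {N k : ℕ} (x : ℕ → ℝ) (h : 1 ≤ k ∧ k ≤ N) :
    orderStat N x k = x (Tuple.sort (fun i : Fin N => x i) ⟨k - 1, by omega⟩) := by
  rw [orderStat, dif_pos h]

/-- Sorting does not change counts, so comparisons with order statistics become statements on
empirical frequencies. -/
theorem orderStat_le_iff {N k : ℕ} (x : ℕ → ℝ) (h : 1 ≤ k ∧ k ≤ N) (z : ℝ) :
    orderStat N x k ≤ z ↔ k ≤ ((Finset.range N).filter (fun i => x i ≤ z)).card := by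
  have key := Tuple.lt_card_le_iff_apply_le_of_monotone (a := z) (j := ⟨k - 1, by omega⟩)
    (Tuple.monotone_sort (fun i : Fin N => x i))
  have hcard : (Finset.univ.filter
      (fun i : Fin N => ((fun i : Fin N => x i) ∘ Tuple.sort (fun i : Fin N => x i)) i ≤ z)).card
      = ((Finset.range N).filter (fun i => x i ≤ z)).card := by
    rw [Finset.card_filter, Finset.card_filter, Finset.sum_range]
    exact Equiv.sum_comp (Tuple.sort (fun i : Fin N => x i)) (fun i => if x i ≤ z then 1 else 0)
  rw [hcard] at key
  rw [orderStat_eq x h]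
  refine key.symm.trans ?_
  show k - 1 < _ ↔ _
  omega

theorem orderStat_mono {N j k : ℕ} (x : ℕ → ℝ) (hj : 1 ≤ j) (hjk : j ≤ k) (hk : k ≤ N) :
    orderStat N x j ≤ orderStat N x k := by
  rw [orderStat_eq x ⟨hj, hjk.trans hk⟩, orderStat_eq x ⟨hj.trans hjk, hk⟩]
  exact Tuple.monotone_sort (fun i : Fin N => x i) (show j - 1 ≤ k - 1 by omega)

theorem orderStat_le_add {N k : ℕ} {x y : ℕ → ℝ} {c : ℝ} (h : 1 ≤ k ∧ k ≤ N)
    (hxy : ∀ i < N, x i ≤ y i + c) : orderStat N x k ≤ orderStat N y k + c := by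
  rw [orderStat_le_iff x h]
  refine ((orderStat_le_iff y h _).1 le_rfl).trans (Finset.card_le_card ?_)
  intro i hi
  simp only [Finset.mem_filter, Finset.mem_range] at hi ⊢
  exact ⟨hi.1, (hxy i hi.1).trans (by linarith [hi.2])⟩

theorem abs_orderStat_le {N k : ℕ} {x : ℕ → ℝ} {B : ℝ} (h : 1 ≤ k ∧ k ≤ N)
    (hx : ∀ i < N, |x i| ≤ B) : |orderStat N x k| ≤ B := by
  rw [orderStat_eq x h]
  exact hx _ (Fin.is_lt _)

/-- With `z` the `k`-th order statistic, the positive parts of `z - x i` vanish beyond position `k`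
and are the plain differences up to it. This is the empirical counterpart of the formula that
defines CVaR. -/
theorem sum_orderStat {N k : ℕ} (x : ℕ → ℝ) (h : 1 ≤ k ∧ k ≤ N) :
    ∑ j ∈ Finset.Icc 1 k, orderStat N x j =
      k * orderStat N x k - ∑ i ∈ Finset.range N, max (orderStat N x k - x i) 0 := by
  set z := orderStat N x k with hz
  have h1 : ∑ i ∈ Finset.range N, max (z - x i) 0
      = ∑ j ∈ Finset.Ico 1 (N + 1), max (z - orderStat N x j) 0 := by
    rw [Finset.sum_Ico_eq_sum_range, Finset.sum_range, Nat.add_sub_cancel, Finset.sum_range,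
      ← Equiv.sum_comp (Tuple.sort (fun i : Fin N => x i))]
    refine Finset.sum_congr rfl fun i _ => ?_
    rw [orderStat_eq x ⟨by omega, by omega⟩]
    simp
  have h2 : ∑ j ∈ Finset.Ico 1 (N + 1), max (z - orderStat N x j) 0
      = ∑ j ∈ Finset.Ico 1 (k + 1), (z - orderStat N x j) := by
    rw [← Finset.sum_Ico_consecutive _ (show 1 ≤ k + 1 by omega) (show k + 1 ≤ N + 1 by omega)]
    rw [Finset.sum_eq_zero (s := Finset.Ico (k + 1) (N + 1)), add_zero]
    · refine Finset.sum_congr rfl fun j hj => max_eq_left ?_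
      rw [Finset.mem_Ico] at hj
      exact sub_nonneg.2 (orderStat_mono x hj.1 (by omega) h.2)
    · intro j hj
      rw [Finset.mem_Ico] at hj
      exact max_eq_right (sub_nonpos.2 (orderStat_mono x h.1 (by omega) (by omega)))
  rw [h1, h2, Finset.sum_sub_distrib]
  simp
  rfl

theorem ceil_mul_mem {α : ℝ} (hα : 0 < α ∧ α < 1) {N : ℕ} (hN : 1 ≤ N) :
    1 ≤ ⌈(N : ℝ) * α⌉₊ ∧ ⌈(N : ℝ) * α⌉₊ ≤ N := by
  have hN' : (1 : ℝ) ≤ N := by exact_mod_cast hN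
  refine ⟨Nat.one_le_iff_ne_zero.2 (Nat.ceil_pos.2 (by nlinarith)).ne', Nat.ceil_le.2 ?_⟩
  nlinarith

theorem riskEstimator_le_add (ρ : RiskKind) {α : ℝ} (hα : 0 < α ∧ α < 1) {N : ℕ} (hN : 1 ≤ N)
    {x y : ℕ → ℝ} {c : ℝ} (hxy : ∀ i < N, x i ≤ y i + c) :
    riskEstimator ρ α N x ≤ riskEstimator ρ α N y + c := by
  have hk := ceil_mul_mem hα hN
  cases ρ with
  | VaR => exact orderStat_le_add hk hxy
  | CVaR =>
    simp only [riskEstimator]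
    set k := ⌈(N : ℝ) * α⌉₊
    have hk0 : (0 : ℝ) < k := by exact_mod_cast hk.1
    have : ∑ j ∈ Finset.Icc 1 k, orderStat N x j ≤ ∑ j ∈ Finset.Icc 1 k, orderStat N y j + k * c := by
      calc _ ≤ ∑ j ∈ Finset.Icc 1 k, (orderStat N y j + c) := by
            refine Finset.sum_le_sum fun j hj => orderStat_le_add ?_ hxy
            rw [Finset.mem_Icc] at hj
            exact ⟨hj.1, hj.2.trans hk.2⟩
        _ = _ := by simp [Finset.sum_add_distrib]
    calc (k : ℝ)⁻¹ * ∑ j ∈ Finset.Icc 1 k, orderStat N x j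
        ≤ (k : ℝ)⁻¹ * (∑ j ∈ Finset.Icc 1 k, orderStat N y j + k * c) := by gcongr
      _ = _ := by field_simp

theorem abs_riskEstimator_sub_le (ρ : RiskKind) {α : ℝ} (hα : 0 < α ∧ α < 1) {N : ℕ} (hN : 1 ≤ N)
    {x y : ℕ → ℝ} {c : ℝ} (hxy : ∀ i < N, |x i - y i| ≤ c) :
    |riskEstimator ρ α N x - riskEstimator ρ α N y| ≤ c := by
  rw [abs_sub_le_iff]
  constructor
  · have := riskEstimator_le_add ρ hα hN (x := x) (y := y) (c := c)
      fun i hi => by linarith [(abs_le.1 (hxy i hi)).2]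
    linarith
  · have := riskEstimator_le_add ρ hα hN (x := y) (y := x) (c := c)
      fun i hi => by linarith [(abs_le.1 (hxy i hi)).1]
    linarith

theorem abs_riskEstimator_le (ρ : RiskKind) {α : ℝ} (hα : 0 < α ∧ α < 1) {N : ℕ} (hN : 1 ≤ N)
    {x : ℕ → ℝ} {B : ℝ} (hx : ∀ i < N, |x i| ≤ B) : |riskEstimator ρ α N x| ≤ B := by
  have hk := ceil_mul_mem hα hN
  cases ρ with
  | VaR => exact abs_orderStat_le hk hx
  | CVaR =>
    simp only [riskEstimator]
    set k := ⌈(N : ℝ) * α⌉₊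
    have hk0 : (0 : ℝ) < k := by exact_mod_cast hk.1
    rw [abs_mul, abs_of_pos (inv_pos.2 hk0), inv_mul_le_iff₀ hk0]
    calc _ ≤ ∑ j ∈ Finset.Icc 1 k, |orderStat N x j| := Finset.abs_sum_le_sum_abs _ _
      _ ≤ ∑ j ∈ Finset.Icc 1 k, B := by
          refine Finset.sum_le_sum fun j hj => abs_orderStat_le ?_ hx
          rw [Finset.mem_Icc] at hj
          exact ⟨hj.1, hj.2.trans hk.2⟩
      _ = k * B := by simp

/-- The mean of `Y` over the first `N` samples. -/
noncomputable def empMean {E : Type*} (Y : E → ℝ) (N : ℕ) (x : ℕ → E) : ℝ :=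
  (N : ℝ)⁻¹ * ∑ i ∈ Finset.range N, Y (x i)

theorem sum_ite_one_zero (N : ℕ) (p : ℕ → Prop) [DecidablePred p] :
    ∑ i ∈ Finset.range N, (if p i then (1 : ℝ) else 0) = ((Finset.range N).filter p).card := by
  simp

/-- If the sample quantile exceeds `q + ε`, then the frequency of samples above `q + ε` is at least
`1 - α`, so its distance from `a₁` is at least `1 - α - a₁` and the first quotient is at least one;
the trivial bound `2 * B` is then covered. The other side is symmetric. Linearity in the deviations
means that only their first absolute moments will matter. -/
theorem orderStat_dev {α : ℝ} (hα : 0 < α ∧ α < 1) {N : ℕ} (hN : 1 ≤ N) {x : ℕ → ℝ}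
    {q B ε a₁ a₂ : ℝ} (hx : ∀ i < N, |x i| ≤ B) (hq : |q| ≤ B) (hε : 0 < ε)
    (h₁ : a₁ < 1 - α) (h₂ : a₂ < α) :
    |orderStat N x ⌈(N : ℝ) * α⌉₊ - q| ≤ ε + 2 * B *
      (|empMean (fun z => if q + ε < z then 1 else 0) N x - a₁| / (1 - α - a₁) +
        |empMean (fun z => if z < q - ε then 1 else 0) N x - a₂| / (α - a₂)) := by
  have hk := ceil_mul_mem hα hN
  have hB : 0 ≤ B := (abs_nonneg _).trans hq
  have hN0 : (0 : ℝ) < N := by exact_mod_cast hN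
  set m₁ := empMean (fun z => if q + ε < z then (1 : ℝ) else 0) N x with hm₁
  set m₂ := empMean (fun z => if z < q - ε then (1 : ℝ) else 0) N x with hm₂
  have hX := abs_orderStat_le hk hx
  have hd : |orderStat N x ⌈(N : ℝ) * α⌉₊ - q| ≤ 2 * B :=
    (abs_sub _ _).trans (by linarith)
  have e₁ : 0 ≤ |m₁ - a₁| / (1 - α - a₁) := div_nonneg (abs_nonneg _) (by linarith)
  have e₂ : 0 ≤ |m₂ - a₂| / (α - a₂) := div_nonneg (abs_nonneg _) (by linarith)
  by_cases hc₁ : orderStat N x ⌈(N : ℝ) * α⌉₊ ≤ q + ε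
  · by_cases hc₂ : q - ε ≤ orderStat N x ⌈(N : ℝ) * α⌉₊
    · have : |orderStat N x ⌈(N : ℝ) * α⌉₊ - q| ≤ ε := by rw [abs_le]; constructor <;> linarith
      have : 0 ≤ 2 * B * (|m₁ - a₁| / (1 - α - a₁) + |m₂ - a₂| / (α - a₂)) := by positivity
      linarith
    · have hm : α ≤ m₂ := by
        have h := (orderStat_le_iff x hk (orderStat N x ⌈(N : ℝ) * α⌉₊)).1 le_rfl
        have h' : ((Finset.range N).filter (fun i => x i ≤ orderStat N x ⌈(N : ℝ) * α⌉₊)).card ≤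
            ((Finset.range N).filter (fun i => x i < q - ε)).card := by
          refine Finset.card_le_card fun i hi => ?_
          simp only [Finset.mem_filter] at hi ⊢
          exact ⟨hi.1, by linarith [hi.2]⟩
        have h'' : (N : ℝ) * α ≤ ((Finset.range N).filter (fun i => x i < q - ε)).card :=
          (Nat.le_ceil _).trans (by exact_mod_cast h.trans h')
        rw [hm₂, empMean, sum_ite_one_zero, inv_mul_eq_div, le_div_iff₀ hN0]
        linarith
      have : 1 ≤ |m₂ - a₂| / (α - a₂) := by
        rw [le_div_iff₀ (by linarith), one_mul]
        exact (by linarith : α - a₂ ≤ m₂ - a₂).trans (le_abs_self _)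
      nlinarith
  · have hm : 1 - α ≤ m₁ := by
      rw [orderStat_le_iff x hk, not_le] at hc₁
      have h' : ((Finset.range N).filter (fun i => x i ≤ q + ε)).card < (N : ℝ) * α :=
        Nat.lt_ceil.1 hc₁
      have hs : ((Finset.range N).filter (fun i => x i ≤ q + ε)).card +
          ((Finset.range N).filter (fun i => q + ε < x i)).card = N := by
        simpa [not_le] using
          Finset.card_filter_add_card_filter_not (s := Finset.range N) (fun i => x i ≤ q + ε)
      have hs' : (((Finset.range N).filter (fun i => x i ≤ q + ε)).card : ℝ) +
          ((Finset.range N).filter (fun i => q + ε < x i)).card = N := by exact_mod_cast hs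
      rw [hm₁, empMean, sum_ite_one_zero, inv_mul_eq_div, le_div_iff₀ hN0]
      linarith
    have : 1 ≤ |m₁ - a₁| / (1 - α - a₁) := by
      rw [le_div_iff₀ (by linarith), one_mul]
      exact (by linarith : 1 - α - a₁ ≤ m₁ - a₁).trans (le_abs_self _)
    nlinarith

/-- Replacing the sample quantile by `q` inside the positive parts costs at most their distance per
sample. Replacing `N / ⌈N α⌉` by `α⁻¹` costs at most `1 / (α ^ 2 N)`, because the ceiling adds less
than one. -/
theorem condRiskEstimator_dev {α : ℝ} (hα : 0 < α ∧ α < 1) {N : ℕ} (hN : 1 ≤ N) (x : ℕ → ℝ)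
    (q : ℝ) {θ : ℝ} (hθ : 0 ≤ θ) :
    |riskEstimator .CVaR α N x - (q - α⁻¹ * θ)| ≤
      (1 + α⁻¹) * |orderStat N x ⌈(N : ℝ) * α⌉₊ - q| +
        (α⁻¹ * |empMean (fun z => max (q - z) 0) N x - θ| + θ / α ^ 2 * (N : ℝ)⁻¹) := by
  have hk := ceil_mul_mem hα hN
  have hkc := Nat.le_ceil ((N : ℝ) * α)
  have hkc' := Nat.ceil_lt_add_one (show 0 ≤ (N : ℝ) * α by have := hα.1; positivity)
  have hN0 : (0 : ℝ) < N := by exact_mod_cast hN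
  have hα0 := hα.1
  simp only [riskEstimator]
  rw [sum_orderStat x hk]
  set k := ⌈(N : ℝ) * α⌉₊
  set z := orderStat N x k
  have hk0 : (0 : ℝ) < k := by exact_mod_cast hk.1
  set m := empMean (fun z => max (q - z) 0) N x with hm
  have hm' : ∑ i ∈ Finset.range N, max (q - x i) 0 = N * m := by
    rw [hm, empMean]; field_simp
  have hdiff : |∑ i ∈ Finset.range N, max (z - x i) 0 - N * m| ≤ N * |z - q| := by
    rw [← hm', ← Finset.sum_sub_distrib]
    calc _ ≤ ∑ i ∈ Finset.range N, |max (z - x i) 0 - max (q - x i) 0| :=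
          Finset.abs_sum_le_sum_abs _ _
      _ ≤ ∑ i ∈ Finset.range N, |z - q| := by
          refine Finset.sum_le_sum fun i _ => ?_
          refine (abs_max_sub_max_le_abs _ _ _).trans (le_of_eq ?_)
          congr 1; ring
      _ = _ := by simp
  have hNk : N / k ≤ α⁻¹ := by
    rw [div_le_iff₀ hk0, inv_mul_eq_div, le_div_iff₀ hα0]; exact hkc
  have hNk' : α⁻¹ - N / k ≤ 1 / α ^ 2 * (N : ℝ)⁻¹ := by
    have : α⁻¹ - N / k = (k - N * α) / (α * k) := by field_simp
    rw [this, div_le_iff₀ (by positivity)]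
    have : 1 / α ^ 2 * (N : ℝ)⁻¹ * (α * k) = k / (N * α) := by field_simp
    rw [this]
    have : 1 ≤ k / (N * α) := by rw [le_div_iff₀ (by positivity)]; linarith
    linarith
  have hid : (k : ℝ)⁻¹ * (k * z - ∑ i ∈ Finset.range N, max (z - x i) 0) - (q - α⁻¹ * θ) =
      (z - q) - (k : ℝ)⁻¹ * (∑ i ∈ Finset.range N, max (z - x i) 0 - N * m)
        - N / k * (m - θ) + (α⁻¹ - N / k) * θ := by
    field_simp; ring
  rw [hid]
  have t1 : |(k : ℝ)⁻¹ * (∑ i ∈ Finset.range N, max (z - x i) 0 - N * m)| ≤ α⁻¹ * |z - q| := by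
    rw [abs_mul, abs_of_pos (inv_pos.2 hk0)]
    calc _ ≤ (k : ℝ)⁻¹ * (N * |z - q|) := by gcongr
      _ = N / k * |z - q| := by ring
      _ ≤ _ := by gcongr
  have t2 : |N / k * (m - θ)| ≤ α⁻¹ * |m - θ| := by
    rw [abs_mul, abs_of_pos (by positivity : 0 < (N : ℝ) / k)]; gcongr
  have t3 : |(α⁻¹ - N / k) * θ| ≤ θ / α ^ 2 * (N : ℝ)⁻¹ := by
    rw [abs_mul, abs_of_nonneg hθ, abs_of_nonneg (by linarith)]
    calc _ ≤ 1 / α ^ 2 * (N : ℝ)⁻¹ * θ := by gcongr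
      _ = _ := by ring
  calc _ ≤ |z - q| + |(k : ℝ)⁻¹ * (∑ i ∈ Finset.range N, max (z - x i) 0 - N * m)|
        + |N / k * (m - θ)| + |(α⁻¹ - N / k) * θ| := by
        refine (abs_add_le _ _).trans (add_le_add_left ?_ _)
        refine (abs_sub _ _).trans (add_le_add_left ?_ _)
        exact abs_sub _ _
    _ ≤ _ := by linarith

/-! ### Risk functionals -/

section Risk

variable {E : Type*} [MeasurableSpace E] {α : ℝ} {P : Measure E} {X Y : E → ℝ} {B : ℝ}

theorem lt_of_le_measureReal (hα : 0 < α) (hXB : ∀ᵐ x ∂P, |X x| ≤ B)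
    {z : ℝ} (hz : α ≤ P.real {x | X x ≤ z}) : -B ≤ z := by
  by_contra! h
  have : P {x | X x ≤ z} = 0 := by
    rw [measure_eq_zero_iff_ae_notMem]
    filter_upwards [hXB] with x hx hx'
    have := (abs_le.1 hx).1
    have := le_trans (this) (show X x ≤ z from hx')
    linarith
  rw [Measure.real, this] at hz
  simp at hz
  linarith

theorem valueAtRisk_le (hα : 0 < α) (hXB : ∀ᵐ x ∂P, |X x| ≤ B) {z : ℝ}
    (hz : α ≤ P.real {x | X x ≤ z}) : valueAtRisk α P X ≤ z :=
  csInf_le ⟨-B, fun _ hy => lt_of_le_measureReal hα hXB hy⟩ hz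

theorem measureReal_lt_of_lt_valueAtRisk (hα : 0 < α) (hXB : ∀ᵐ x ∂P, |X x| ≤ B) {z : ℝ}
    (hz : z < valueAtRisk α P X) : P.real {x | X x ≤ z} < α := by
  by_contra! h
  exact absurd (valueAtRisk_le hα hXB h) (not_le.2 hz)

variable [IsProbabilityMeasure P]

theorem measureReal_le_eq_one (hXB : ∀ᵐ x ∂P, |X x| ≤ B) : P.real {x | X x ≤ B} = 1 := by
  have : P {x | X x ≤ B} = 1 := by
    rw [← measure_univ (μ := P)]
    refine measure_congr ?_
    filter_upwards [hXB] with x hx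
    exact eq_true (abs_le.1 hx).2
  rw [Measure.real, this, ENNReal.toReal_one]

/-- The infimum is attained because distribution functions are right continuous. -/
theorem le_measureReal_valueAtRisk (hα : 0 < α ∧ α < 1) (hX : Measurable X)
    (hXB : ∀ᵐ x ∂P, |X x| ≤ B) : α ≤ P.real {x | X x ≤ valueAtRisk α P X} := by
  have hprob : IsProbabilityMeasure (P.map X) := Measure.isProbabilityMeasure_map hX.aemeasurable
  have hcdf : ∀ z, ProbabilityTheory.cdf (P.map X) z = P.real {x | X x ≤ z} := fun z => by
    rw [ProbabilityTheory.cdf_eq_real, map_measureReal_apply hX measurableSet_Iic]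
    rfl
  rw [← hcdf]
  have hcont := ((ProbabilityTheory.cdf (P.map X)).right_continuous (valueAtRisk α P X)).mono_left
    (nhdsWithin_mono _ Set.Ioi_subset_Ici_self)
  refine ge_of_tendsto hcont ?_
  filter_upwards [self_mem_nhdsWithin] with z hz
  obtain ⟨w, hw, hwz⟩ := (csInf_lt_iff ⟨-B, fun _ hy => lt_of_le_measureReal hα.1 hXB hy⟩
    ⟨B, hα.2.le.trans (measureReal_le_eq_one hXB).ge⟩).1 (show valueAtRisk α P X < z from hz)
  refine (show α ≤ P.real {x | X x ≤ w} from hw).trans ?_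
  rw [← hcdf]
  exact ProbabilityTheory.monotone_cdf _ hwz.le

theorem abs_valueAtRisk_le (hα : 0 < α ∧ α < 1) (hX : Measurable X)
    (hXB : ∀ᵐ x ∂P, |X x| ≤ B) : |valueAtRisk α P X| ≤ B := by
  rw [abs_le]
  exact ⟨lt_of_le_measureReal hα.1 hXB (le_measureReal_valueAtRisk hα hX hXB),
    valueAtRisk_le hα.1 hXB (by simpa [measureReal_le_eq_one hXB] using hα.2.le)⟩

theorem valueAtRisk_le_add (hα : 0 < α ∧ α < 1) {B' : ℝ} (hY : Measurable Y)
    (hXB : ∀ᵐ x ∂P, |X x| ≤ B) (hYB : ∀ᵐ x ∂P, |Y x| ≤ B') {c : ℝ}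
    (h : ∀ᵐ x ∂P, X x ≤ Y x + c) : valueAtRisk α P X ≤ valueAtRisk α P Y + c := by
  refine valueAtRisk_le hα.1 hXB ((le_measureReal_valueAtRisk hα hY hYB).trans ?_)
  refine ENNReal.toReal_mono (measure_ne_top _ _) (measure_mono_ae ?_)
  filter_upwards [h] with x hx hx'
  exact hx.trans (add_le_add_left hx' c)

theorem integrable_max_sub (hX : Measurable X) (hXB : ∀ᵐ x ∂P, |X x| ≤ B) (z : ℝ) :
    Integrable (fun x => max (z - X x) 0) P := by
  refine Integrable.of_bound (C := |z| + B) (by fun_prop) ?_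
  filter_upwards [hXB] with x hx
  rw [Real.norm_eq_abs, abs_of_nonneg (le_max_right _ _)]
  rw [abs_le] at hx
  exact max_le (by linarith [le_abs_self z]) (by linarith [abs_nonneg z])

/-- The Rockafellar–Uryasev principle: the left side is concave in `z` with slope `1 - α⁻¹ P(X ≤
z)`, which changes sign at the quantile, so VaR is a maximiser. The sup formula yields the
monotonicity of CVaR. -/
theorem sub_integral_le_condValueAtRisk (hα : 0 < α ∧ α < 1) (hX : Measurable X)
    (hXB : ∀ᵐ x ∂P, |X x| ≤ B) (z : ℝ) :
    z - α⁻¹ * ∫ x, max (z - X x) 0 ∂P ≤ condValueAtRisk α P X := by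
  have hα0 := hα.1
  have hint := integrable_max_sub hX hXB
  rw [condValueAtRisk]
  set q := valueAtRisk α P X with hq
  have hset : ∀ w, MeasurableSet {x | X x ≤ w} := fun w => measurableSet_le hX measurable_const
  have hind : ∀ w c : ℝ, Integrable ({x | X x ≤ w}.indicator fun _ => c) P :=
    fun w c => (integrable_const c).indicator (hset w)
  have hindint : ∀ w c : ℝ, ∫ x, {x | X x ≤ w}.indicator (fun _ => c) x ∂P
      = P.real {x | X x ≤ w} * c := fun w c => by
    rw [integral_indicator_const _ (hset w), smul_eq_mul]
  -- the objective increases up to `q`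
  have hlow : ∀ w, z ≤ w → w < q → z - α⁻¹ * ∫ x, max (z - X x) 0 ∂P ≤
      w - α⁻¹ * ∫ x, max (w - X x) 0 ∂P := by
    intro w hzw hwq
    have h1 : ∫ x, max (w - X x) 0 ∂P ≤
        ∫ x, (max (z - X x) 0 + {x | X x ≤ w}.indicator (fun _ => w - z) x) ∂P := by
      refine integral_mono (hint w) ((hint z).add (hind w _)) fun x => ?_
      by_cases hx : X x ≤ w
      · simp only [Set.indicator, Set.mem_ofPred_eq, hx, if_true]
        refine max_le ?_ (by linarith [le_max_right (z - X x) 0])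
        linarith [le_max_left (z - X x) 0]
      · simp only [Set.indicator, Set.mem_ofPred_eq, hx, if_false, add_zero]
        exact max_le ((by linarith : w - X x ≤ 0).trans (le_max_right _ _)) (le_max_right _ _)
    rw [integral_add (hint z) (hind w _), hindint] at h1
    have h2 := measureReal_lt_of_lt_valueAtRisk hα.1 hXB hwq
    have h3 : α⁻¹ * ∫ x, max (w - X x) 0 ∂P ≤ α⁻¹ * (∫ x, max (z - X x) 0 ∂P + α * (w - z)) := by
      gcongr
      refine h1.trans (add_le_add_right ?_ _)
      exact mul_le_mul_of_nonneg_right h2.le (by linarith)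
    rw [mul_add, inv_mul_cancel_left₀ hα0.ne'] at h3
    linarith
  -- The slope estimate is available only strictly below `q`; this continuity bound closes the gap
  -- to `q`.
  have hLip : ∀ w, w ≤ q → w - α⁻¹ * ∫ x, max (w - X x) 0 ∂P ≤
      q - α⁻¹ * ∫ x, max (q - X x) 0 ∂P + α⁻¹ * (q - w) := by
    intro w hwq
    have h1 : ∫ x, max (q - X x) 0 ∂P ≤ ∫ x, (max (w - X x) 0 + (q - w)) ∂P := by
      refine integral_mono (hint q) ((hint w).add (integrable_const _)) fun x => ?_
      refine max_le ?_ ?_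
      · linarith [le_max_left (w - X x) 0]
      · linarith [le_max_right (w - X x) 0]
    rw [integral_add (hint w) (integrable_const _)] at h1
    simp only [integral_const, probReal_univ, one_smul] at h1
    have h3 : α⁻¹ * ∫ x, max (q - X x) 0 ∂P ≤ α⁻¹ * (∫ x, max (w - X x) 0 ∂P + (q - w)) := by
      gcongr
    rw [mul_add] at h3
    linarith
  rcases lt_or_ge z q with hzq | hzq
  · refine le_of_forall_pos_le_add fun ε hε => ?_
    -- A point between `z` and `q` at which the continuity bound loses at most `ε`.
    set w := max z (q - α * ε) with hw
    have hwq : w < q := max_lt hzq (by nlinarith)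
    refine (hlow w (le_max_left _ _) hwq).trans ((hLip w hwq.le).trans ?_)
    have : α⁻¹ * (q - w) ≤ ε := by
      rw [inv_mul_le_iff₀ hα0]
      linarith [le_max_right z (q - α * ε)]
    linarith
  · have h1 : ∫ x, (max (q - X x) 0 + {x | X x ≤ q}.indicator (fun _ => z - q) x) ∂P ≤
        ∫ x, max (z - X x) 0 ∂P := by
      refine integral_mono ((hint q).add (hind q _)) (hint z) fun x => ?_
      by_cases hx : X x ≤ q
      · simp only [Set.indicator, Set.mem_ofPred_eq, hx, if_true]
        rw [max_eq_left (by linarith)]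
        exact (by linarith : _ ≤ z - X x).trans (le_max_left _ _)
      · simp only [Set.indicator, Set.mem_ofPred_eq, hx, if_false, add_zero]
        rw [max_eq_right (by linarith)]
        exact le_max_right _ _
    rw [integral_add (hint q) (hind q _), hindint] at h1
    have h2 := le_measureReal_valueAtRisk hα hX hXB
    have h3 : α⁻¹ * (∫ x, max (q - X x) 0 ∂P + α * (z - q)) ≤ α⁻¹ * ∫ x, max (z - X x) 0 ∂P := by
      gcongr
      refine le_trans (add_le_add_right ?_ _) h1
      exact mul_le_mul_of_nonneg_right h2 (by linarith)
    rw [mul_add, inv_mul_cancel_left₀ hα0.ne'] at h3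
    linarith

/-- The variational formula for `Y` is tested at the quantile of `X` lowered by `c`. -/
theorem condValueAtRisk_le_add (hα : 0 < α ∧ α < 1) {B' : ℝ} (hX : Measurable X)
    (hY : Measurable Y) (hXB : ∀ᵐ x ∂P, |X x| ≤ B) (hYB : ∀ᵐ x ∂P, |Y x| ≤ B') {c : ℝ}
    (h : ∀ᵐ x ∂P, X x ≤ Y x + c) : condValueAtRisk α P X ≤ condValueAtRisk α P Y + c := by
  have hα0 := hα.1
  have h1 := sub_integral_le_condValueAtRisk hα hY hYB (valueAtRisk α P X - c)
  rw [condValueAtRisk]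
  have h2 : ∫ x, max (valueAtRisk α P X - c - Y x) 0 ∂P ≤
      ∫ x, max (valueAtRisk α P X - X x) 0 ∂P := by
    refine integral_mono_ae (integrable_max_sub hY hYB _) (integrable_max_sub hX hXB _) ?_
    filter_upwards [h] with x hx
    exact max_le_max_right _ (by linarith)
  have h3 : α⁻¹ * ∫ x, max (valueAtRisk α P X - c - Y x) 0 ∂P ≤
      α⁻¹ * ∫ x, max (valueAtRisk α P X - X x) 0 ∂P := by gcongr
  linarith

theorem risk_le_add (ρ : RiskKind) (hα : 0 < α ∧ α < 1) {B' : ℝ} (hX : Measurable X)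
    (hY : Measurable Y) (hXB : ∀ᵐ x ∂P, |X x| ≤ B) (hYB : ∀ᵐ x ∂P, |Y x| ≤ B') {c : ℝ}
    (h : ∀ᵐ x ∂P, X x ≤ Y x + c) : risk ρ α P X ≤ risk ρ α P Y + c := by
  cases ρ with
  | VaR => exact valueAtRisk_le_add hα hY hXB hYB h
  | CVaR => exact condValueAtRisk_le_add hα hX hY hXB hYB h

theorem abs_risk_sub_le (ρ : RiskKind) (hα : 0 < α ∧ α < 1) {B' : ℝ} (hX : Measurable X)
    (hY : Measurable Y) (hXB : ∀ᵐ x ∂P, |X x| ≤ B) (hYB : ∀ᵐ x ∂P, |Y x| ≤ B') {c : ℝ}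
    (h : ∀ᵐ x ∂P, |X x - Y x| ≤ c) : |risk ρ α P X - risk ρ α P Y| ≤ c := by
  have h1 := risk_le_add ρ hα hX hY hXB hYB (c := c) (by
    filter_upwards [h] with x hx; linarith [(abs_le.1 hx).2])
  have h2 := risk_le_add ρ hα hY hX hYB hXB (c := c) (by
    filter_upwards [h] with x hx; linarith [(abs_le.1 hx).1])
  rw [abs_sub_le_iff]
  constructor <;> linarith

end Risk

theorem valueAtRisk_dirac {E : Type*} [MeasurableSpace E] {α : ℝ} (hα : 0 < α ∧ α < 1)
    {X : E → ℝ} (hX : Measurable X) (p : E) : valueAtRisk α (Measure.dirac p) X = X p := by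
  have hreal : ∀ z, (Measure.dirac p).real {x | X x ≤ z} = if X p ≤ z then 1 else 0 := fun z => by
    rw [Measure.real, Measure.dirac_apply' _ (measurableSet_le hX measurable_const)]
    by_cases h : X p ≤ z <;> simp [h]
  have hset : {z | α ≤ (Measure.dirac p).real {x | X x ≤ z}} = Set.Ici (X p) := by
    ext z
    rw [Set.mem_ofPred_eq, hreal, Set.mem_Ici]
    by_cases h : X p ≤ z
    · simp [h, hα.2.le]
    · simp [h, hα.1]
  rw [valueAtRisk, hset, csInf_Ici]

/-! ### Bayesian risk MDPs -/

section MDP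

variable {S A : Type*} [Fintype S]

theorem measurable_backup (I : Input S A) (V : S → ℝ) (s : S) (a : A) :
    Measurable (backup I V s a) := by
  unfold backup
  fun_prop

theorem continuous_backup (I : Input S A) (V : S → ℝ) (s : S) (a : A) :
    Continuous (backup I V s a) := by
  unfold backup
  fun_prop

theorem abs_sum_mul_le_of_mem_stdSimplex {ι : Type*} [Fintype ι] {p g : ι → ℝ} {c : ℝ}
    (hp : p ∈ stdSimplex ℝ ι) (hg : ∀ i, |g i| ≤ c) : |∑ i, p i * g i| ≤ c := by
  calc |∑ i, p i * g i| ≤ ∑ i, |p i * g i| := Finset.abs_sum_le_sum_abs _ _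
    _ ≤ ∑ i, p i * c := by
        refine Finset.sum_le_sum fun i _ => ?_
        rw [abs_mul, abs_of_nonneg (hp.1 i)]
        exact mul_le_mul_of_nonneg_left (hg i) (hp.1 i)
    _ = c := by rw [← Finset.sum_mul, hp.2, one_mul]

theorem abs_backup_sub_le (I : Input S A) (hγ : 0 ≤ I.γ) (V V' : S → ℝ) (s : S) (a : A)
    {p : S → ℝ} (hp : p ∈ stdSimplex ℝ S) :
    |backup I V s a p - backup I V' s a p| ≤ I.γ * ‖V - V'‖ := by
  have : backup I V s a p - backup I V' s a p = ∑ i, p i * (I.γ * (V - V') i) := by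
    rw [backup, backup, ← Finset.sum_sub_distrib]
    refine Finset.sum_congr rfl fun i _ => ?_
    simp only [Pi.sub_apply]
    ring
  rw [this]
  refine abs_sum_mul_le_of_mem_stdSimplex hp fun i => ?_
  rw [abs_mul, abs_of_nonneg hγ]
  exact mul_le_mul_of_nonneg_left (norm_le_pi_norm (V - V') i) hγ

theorem backup_mono (I : Input S A) (hγ : 0 ≤ I.γ) {V V' : S → ℝ} (h : V ≤ V') (s : S) (a : A)
    {p : S → ℝ} (hp : p ∈ stdSimplex ℝ S) : backup I V s a p ≤ backup I V' s a p := by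
  refine Finset.sum_le_sum fun i _ => mul_le_mul_of_nonneg_left ?_ (hp.1 i)
  exact add_le_add_right (mul_le_mul_of_nonneg_left (h i) hγ) _

variable [Fintype A]

theorem abs_backup_le (I : Input S A) (hγ : 0 ≤ I.γ) (V : S → ℝ) (s : S) (a : A)
    {p : S → ℝ} (hp : p ∈ stdSimplex ℝ S) :
    |backup I V s a p| ≤ ‖I.r‖ + I.γ * ‖V‖ := by
  refine abs_sum_mul_le_of_mem_stdSimplex hp fun i => ?_
  refine (abs_add_le _ _).trans (add_le_add ?_ ?_)
  · exact (norm_le_pi_norm (I.r s a) i).trans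
      ((norm_le_pi_norm (I.r s) a).trans (norm_le_pi_norm I.r s))
  · rw [abs_mul, abs_of_nonneg hγ]
    exact mul_le_mul_of_nonneg_left (norm_le_pi_norm V i) hγ

omit [Fintype S] in
theorem le_maxQ (Q : S → A → ℝ) (s : S) (a : A) : Q s a ≤ maxQ Q s :=
  le_ciSup (Set.finite_range _).bddAbove a

variable [Nonempty A]

theorem norm_maxQ_sub_le (Q Q' : S → A → ℝ) : ‖maxQ Q - maxQ Q'‖ ≤ ‖Q - Q'‖ := by
  have key : ∀ Q Q' : S → A → ℝ, ∀ s, maxQ Q s ≤ maxQ Q' s + ‖Q - Q'‖ := by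
    intro Q Q' s
    refine ciSup_le fun a => ?_
    have h1 := le_maxQ Q' s a
    have h2 : Q s a - Q' s a ≤ ‖Q - Q'‖ :=
      (le_abs_self _).trans ((norm_le_pi_norm ((Q - Q') s) a).trans (norm_le_pi_norm (Q - Q') s))
    linarith
  rw [pi_norm_le_iff_of_nonneg (norm_nonneg _)]
  intro s
  rw [Pi.sub_apply, Real.norm_eq_abs, abs_sub_le_iff]
  have h1 := key Q Q' s
  have h2 := key Q' Q s
  rw [norm_sub_rev] at h2
  constructor <;> linarith

theorem norm_maxQ_le (Q : S → A → ℝ) : ‖maxQ Q‖ ≤ ‖Q‖ := by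
  have h := norm_maxQ_sub_le Q 0
  have h0 : maxQ (0 : S → A → ℝ) = 0 := by
    ext s
    simp [maxQ]
  rwa [h0, sub_zero, sub_zero] at h

variable (I : Input S A) (hγ : 0 ≤ I.γ ∧ I.γ < 1) (hα : 0 < I.α ∧ I.α < 1)
  (Φ : S → A → Measure (S → ℝ)) [hprob : ∀ s a, IsProbabilityMeasure (Φ s a)]
  (hΦ : ∀ s a, ∀ᵐ p ∂Φ s a, p ∈ stdSimplex ℝ S)

include hγ hα hΦ

omit [Nonempty A] in
theorem abs_risk_backup_sub_le (V V' : S → ℝ) (s : S) (a : A) :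
    |risk I.ρ I.α (Φ s a) (backup I V s a) - risk I.ρ I.α (Φ s a) (backup I V' s a)| ≤
      I.γ * ‖V - V'‖ :=
  abs_risk_sub_le I.ρ hα (measurable_backup I V s a) (measurable_backup I V' s a)
    ((hΦ s a).mono fun _ hp => abs_backup_le I hγ.1 V s a hp)
    ((hΦ s a).mono fun _ hp => abs_backup_le I hγ.1 V' s a hp)
    ((hΦ s a).mono fun _ hp => abs_backup_sub_le I hγ.1 V V' s a hp)

omit [Nonempty A] in
theorem risk_backup_mono {V V' : S → ℝ} (h : V ≤ V') (s : S) (a : A) :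
    risk I.ρ I.α (Φ s a) (backup I V s a) ≤ risk I.ρ I.α (Φ s a) (backup I V' s a) := by
  simpa using risk_le_add I.ρ hα (c := 0) (measurable_backup I V s a) (measurable_backup I V' s a)
    ((hΦ s a).mono fun _ hp => abs_backup_le I hγ.1 V s a hp)
    ((hΦ s a).mono fun _ hp => abs_backup_le I hγ.1 V' s a hp)
    ((hΦ s a).mono fun _ hp => by simpa using backup_mono I hγ.1 h s a hp)

theorem norm_bellman_sub_le (Q Q' : S → A → ℝ) :
    ‖bellman I Φ Q - bellman I Φ Q'‖ ≤ I.γ * ‖Q - Q'‖ := by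
  have h0 : 0 ≤ I.γ * ‖Q - Q'‖ := mul_nonneg hγ.1 (norm_nonneg _)
  rw [pi_norm_le_iff_of_nonneg h0]
  intro s
  rw [pi_norm_le_iff_of_nonneg h0]
  intro a
  exact (abs_risk_backup_sub_le I hγ hα Φ hΦ (maxQ Q) (maxQ Q') s a).trans
    (mul_le_mul_of_nonneg_left (norm_maxQ_sub_le Q Q') hγ.1)

omit [Nonempty A] in
theorem contractingWith_policyStep (π : S → stdSimplex ℝ A) :
    ContractingWith ⟨I.γ, hγ.1⟩ (policyStep I Φ π) := by
  refine ⟨hγ.2, LipschitzWith.of_dist_le_mul fun V V' => ?_⟩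
  rw [dist_eq_norm, dist_eq_norm]
  change _ ≤ I.γ * _
  rw [pi_norm_le_iff_of_nonneg (mul_nonneg hγ.1 (norm_nonneg _))]
  intro s
  have : (policyStep I Φ π V - policyStep I Φ π V') s = ∑ a, (π s : A → ℝ) a *
      (risk I.ρ I.α (Φ s a) (backup I V s a) - risk I.ρ I.α (Φ s a) (backup I V' s a)) := by
    simp only [Pi.sub_apply, policyStep, mul_sub, Finset.sum_sub_distrib]
  rw [this]
  exact abs_sum_mul_le_of_mem_stdSimplex (π s).2
    fun a => abs_risk_backup_sub_le I hγ hα Φ hΦ V V' s a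

omit [Nonempty A] in
theorem policyStep_mono (π : S → stdSimplex ℝ A) : Monotone (policyStep I Φ π) := fun _ _ h s =>
  Finset.sum_le_sum fun a _ => mul_le_mul_of_nonneg_left
    (risk_backup_mono I hγ hα Φ hΦ h s a) ((π s).2.1 a)

omit [Nonempty A] in
theorem tendsto_iterate_policyStep (π : S → stdSimplex ℝ A) (V : S → ℝ) (s : S) :
    Tendsto (fun k : ℕ => ((policyStep I Φ π)^[k] V) s) atTop (𝓝 (policyValue I Φ π s)) := by
  have hc := contractingWith_policyStep I hγ hα Φ hΦ π
  have h := fun V => tendsto_pi_nhds.1 (hc.tendsto_iterate_fixedPoint V) s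
  have h0 : policyValue I Φ π s = ContractingWith.fixedPoint _ hc s := (h 0).limUnder_eq
  rw [h0]
  exact h V

/-- An average over actions is at most the maximum, so monotone iteration of any policy from `maxQ
Q` stays below `maxQ Q`; by contraction the limit does not depend on the starting point. The greedy
policy leaves `maxQ Q` fixed and attains the bound. -/
theorem optimalValue_eq_maxQ {Q : S → A → ℝ} (hQ : bellman I Φ Q = Q) :
    optimalValue I Φ = maxQ Q := by
  classical
  have hstep : ∀ π, policyStep I Φ π (maxQ Q) = fun s => ∑ a, (π s : A → ℝ) a * Q s a := by
    intro π
    ext s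
    refine Finset.sum_congr rfl fun a _ => ?_
    conv_rhs => rw [← hQ]
    rfl
  have hle : ∀ π s, policyValue I Φ π s ≤ maxQ Q s := by
    intro π s
    refine le_of_tendsto (tendsto_iterate_policyStep I hγ hα Φ hΦ π (maxQ Q) s)
      (Eventually.of_forall fun k => ?_)
    have h1 : policyStep I Φ π (maxQ Q) ≤ maxQ Q := by
      rw [hstep]
      intro s
      calc ∑ a, (π s : A → ℝ) a * Q s a ≤ ∑ a, (π s : A → ℝ) a * maxQ Q s :=
            Finset.sum_le_sum fun a _ => mul_le_mul_of_nonneg_left (le_maxQ Q s a) ((π s).2.1 a)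
        _ = maxQ Q s := by
              rw [← Finset.sum_mul]
              exact (congrArg (· * maxQ Q s) (π s).2.2).trans (one_mul _)
    have hk : (policyStep I Φ π)^[k] (maxQ Q) ≤ maxQ Q := by
      induction k with
      | zero => exact le_rfl
      | succ k ih =>
        rw [Function.iterate_succ_apply']
        exact (policyStep_mono I hγ hα Φ hΦ π ih).trans h1
    exact hk s
  have hgreedy : ∀ s, ∃ a, Q s a = maxQ Q s := fun s => exists_eq_ciSup_of_finite
  choose g hg using hgreedy
  let π₀ : S → stdSimplex ℝ A := fun s => ⟨Pi.single (g s) 1, single_mem_stdSimplex ℝ (g s)⟩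
  have hfix : policyStep I Φ π₀ (maxQ Q) = maxQ Q := by
    rw [hstep]
    ext s
    simp [π₀, Pi.single_apply, hg]
  have heq : ∀ s, policyValue I Φ π₀ s = maxQ Q s := by
    intro s
    have h := tendsto_iterate_policyStep I hγ hα Φ hΦ π₀ (maxQ Q) s
    simp only [Function.iterate_fixed hfix] at h
    exact tendsto_nhds_unique h tendsto_const_nhds
  ext s
  have hne : Nonempty (S → stdSimplex ℝ A) := ⟨π₀⟩
  refine le_antisymm (ciSup_le fun π => hle π s) ?_
  rw [← heq s]
  exact le_ciSup (f := fun π => policyValue I Φ π s)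
    ⟨maxQ Q s, by rintro _ ⟨π, rfl⟩; exact hle π s⟩ π₀

/-- Every fixed point is `optimalQ` by the preceding identification, and Banach's theorem supplies
one, so `optimalQ` itself is fixed. -/
theorem bellman_eq_self_iff (Q : S → A → ℝ) : bellman I Φ Q = Q ↔ Q = optimalQ I Φ := by
  have hopt : ∀ Q, bellman I Φ Q = Q → Q = optimalQ I Φ := fun Q hQ => by
    conv_lhs => rw [← hQ]
    unfold optimalQ
    rw [optimalValue_eq_maxQ I hγ hα Φ hΦ hQ]
    rfl
  have hc : ContractingWith ⟨I.γ, hγ.1⟩ (bellman I Φ) :=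
    ⟨hγ.2, LipschitzWith.of_dist_le_mul fun Q Q' => by
      rw [dist_eq_norm, dist_eq_norm]
      exact norm_bellman_sub_le I hγ hα Φ hΦ Q Q'⟩
  have hfix : bellman I Φ (ContractingWith.fixedPoint _ hc) = ContractingWith.fixedPoint _ hc :=
    hc.fixedPoint_isFixedPt
  refine ⟨hopt Q, ?_⟩
  rintro rfl
  rw [← hopt _ hfix]
  exact hfix

end MDP

/-! ### The normalisation constant of the Dirichlet distribution -/

section DirichletIntegral

variable {S : Type*} [Fintype S]

/-- The open positive orthant. -/
def orthant (S : Type*) : Set (S → ℝ) := {x | ∀ i, 0 < x i}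

/-- The density of the Dirichlet distribution, extended to the orthant as a function that is
homogeneous of degree `0`. -/
noncomputable def radialDensity (φ : S → ℝ) (x : S → ℝ) : ℝ :=
  ∏ i, (x i / ∑ j, x j) ^ (φ i - 1)

theorem measurableSet_orthant : MeasurableSet (orthant S) := by
  have : orthant S = ⋂ i, {x | 0 < x i} := by ext; simp [orthant]
  rw [this]
  exact MeasurableSet.iInter fun i => measurableSet_lt measurable_const (measurable_pi_apply i)

theorem isOpen_orthant : IsOpen (orthant S) := by
  have : orthant S = ⋂ i, {x | 0 < x i} := by ext; simp [orthant]
  rw [this]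
  exact isOpen_iInter_of_finite fun i => isOpen_lt continuous_const (continuous_apply i)

theorem measurable_radialDensity (φ : S → ℝ) : Measurable (radialDensity φ) := by
  unfold radialDensity
  fun_prop

theorem sum_pos_of_mem_orthant [Nonempty S] {x : S → ℝ} (hx : x ∈ orthant S) : 0 < ∑ i, x i :=
  Finset.sum_pos (fun i _ => hx i) Finset.univ_nonempty

theorem radialDensity_nonneg [Nonempty S] (φ : S → ℝ) {x : S → ℝ} (hx : x ∈ orthant S) :
    0 ≤ radialDensity φ x :=
  Finset.prod_nonneg fun i _ =>
    Real.rpow_nonneg (div_nonneg (hx i).le (sum_pos_of_mem_orthant hx).le) _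

theorem radialDensity_le_one [Nonempty S] {φ : S → ℝ} (hφ : ∀ i, 1 ≤ φ i) {x : S → ℝ}
    (hx : x ∈ orthant S) : radialDensity φ x ≤ 1 := by
  have hs := sum_pos_of_mem_orthant hx
  refine Finset.prod_le_one (fun i _ => Real.rpow_nonneg (div_nonneg (hx i).le hs.le) _)
    fun i _ => ?_
  refine Real.rpow_le_one (div_nonneg (hx i).le hs.le) ?_ (by linarith [hφ i])
  rw [div_le_one hs]
  exact Finset.single_le_sum (fun j _ => (hx j).le) (Finset.mem_univ i)

theorem radialDensity_smul (φ : S → ℝ) {c : ℝ} (hc : 0 < c) (x : S → ℝ) :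
    radialDensity φ (c • x) = radialDensity φ x := by
  unfold radialDensity
  refine Finset.prod_congr rfl fun i _ => ?_
  simp only [Pi.smul_apply, smul_eq_mul, ← Finset.mul_sum]
  rw [mul_div_mul_left _ _ hc.ne']

/-- Integrals over the simplex are moved to Lebesgue integrals over a truncated cone, where scaling
and Fubini are available. -/
theorem lintegral_dirichletWeight (φ : S → ℝ) {g : (S → ℝ) → ENNReal} (hg : Measurable g) :
    ∫⁻ p, g p ∂dirichletWeight φ =
      ∫⁻ x in orthant S ∩ {x | ∑ i, x i ≤ 1},
        ENNReal.ofReal (radialDensity φ x) * g (fun i => x i / ∑ j, x j) := by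
  have hm : Measurable (fun p : S → ℝ => ENNReal.ofReal (∏ i, p i ^ (φ i - 1))) := by fun_prop
  rw [dirichletWeight, lintegral_withDensity_eq_lintegral_mul _ hm hg, simplexMeasure,
    lintegral_map (hm.mul hg) (by fun_prop)]
  rfl

theorem volume_orthant_inter_lt_top [Nonempty S] :
    volume (orthant S ∩ {x | ∑ i, x i ≤ 1}) < ⊤ := by
  refine lt_of_le_of_lt (measure_mono ?_) (isCompact_Icc (a := (0 : S → ℝ)) (b := 1)).measure_lt_top
  rintro x ⟨hx, hx1⟩
  refine ⟨fun i => (hx i).le, fun i => ?_⟩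
  exact (Finset.single_le_sum (fun j _ => (hx j).le) (Finset.mem_univ i)).trans hx1

theorem dirichletWeight_univ (φ : S → ℝ) :
    dirichletWeight φ Set.univ =
      ∫⁻ x in orthant S ∩ {x | ∑ i, x i ≤ 1}, ENNReal.ofReal (radialDensity φ x) := by
  have := lintegral_dirichletWeight φ (g := 1) measurable_const
  simpa using this

theorem measurableSet_orthant_inter (r : ℝ) :
    MeasurableSet (orthant S ∩ {x | ∑ i, x i ≤ r}) :=
  measurableSet_orthant.inter (measurableSet_le (by fun_prop) measurable_const)

/-- Parameters at least one make the density at most one, so the mass is at most the volume of the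
truncated cone. -/
theorem dirichletWeight_univ_lt_top [Nonempty S] {φ : S → ℝ} (hφ : ∀ i, 1 ≤ φ i) :
    dirichletWeight φ Set.univ < ⊤ := by
  rw [dirichletWeight_univ]
  refine lt_of_le_of_lt ?_ (volume_orthant_inter_lt_top (S := S))
  rw [← setLIntegral_one]
  refine setLIntegral_mono measurable_const fun x hx => ?_
  exact ENNReal.ofReal_le_one.2 (radialDensity_le_one hφ hx.1)

/-- The mass of the homogeneous density below level `r` scales like `r ^ n`. -/
theorem setLIntegral_radialDensity (φ : S → ℝ) {r : ℝ} (hr : 0 < r) :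
    ∫⁻ x in orthant S ∩ {x | ∑ i, x i ≤ r}, ENNReal.ofReal (radialDensity φ x) =
      ENNReal.ofReal (r ^ Fintype.card S) * dirichletWeight φ Set.univ := by
  have hmap := Measure.map_addHaar_smul (volume : Measure (S → ℝ)) (inv_ne_zero hr.ne')
  rw [Module.finrank_fintype_fun_eq_card, inv_pow, inv_inv, abs_of_pos (pow_pos hr _)] at hmap
  rw [dirichletWeight_univ, ← lintegral_indicator (measurableSet_orthant_inter r),
    ← lintegral_indicator (measurableSet_orthant_inter 1), ← smul_eq_mul (ENNReal.ofReal _),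
    ← lintegral_smul_measure, ← hmap, lintegral_map _ (by fun_prop)]
  · refine lintegral_congr fun x => ?_
    have hiff : r⁻¹ • x ∈ orthant S ∩ {x | ∑ i, x i ≤ 1} ↔ x ∈ orthant S ∩ {x | ∑ i, x i ≤ r} := by
      refine and_congr (forall_congr' fun i => ?_) ?_
      · simp [hr]
      · simp only [Set.mem_ofPred_eq, Pi.smul_apply, smul_eq_mul, ← Finset.mul_sum]
        rw [inv_mul_le_iff₀ hr, mul_one]
    by_cases hx : x ∈ orthant S ∩ {x | ∑ i, x i ≤ r}
    · rw [Set.indicator_of_mem hx, Set.indicator_of_mem (hiff.2 hx),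
        radialDensity_smul φ (inv_pos.2 hr)]
    · rw [Set.indicator_of_notMem hx, Set.indicator_of_notMem fun h => hx (hiff.1 h)]
  · exact (measurable_radialDensity φ).ennreal_ofReal.indicator (measurableSet_orthant_inter 1)

/-- The law of `(∑ x) ^ n` under the homogeneous density is a multiple of Lebesgue measure. -/
theorem map_pow_sum_radialDensity [Nonempty S] {φ : S → ℝ} (hφ : ∀ i, 1 ≤ φ i) :
    (((volume : Measure (S → ℝ)).restrict (orthant S)).withDensity
        (fun x => ENNReal.ofReal (radialDensity φ x))).map (fun x => (∑ i, x i) ^ Fintype.card S) =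
      dirichletWeight φ Set.univ • (volume : Measure ℝ).restrict (Set.Ioi 0) := by
  have hn : Fintype.card S ≠ 0 := Fintype.card_ne_zero
  set ν := ((volume : Measure (S → ℝ)).restrict (orthant S)).withDensity
        (fun x => ENNReal.ofReal (radialDensity φ x)) with hν
  have hfin := dirichletWeight_univ_lt_top hφ
  have hmeas : Measurable fun x : S → ℝ => (∑ i, x i) ^ Fintype.card S := by fun_prop
  -- Taking the power `card S` of the level turns the scaling `r ^ n` into a linear one, which
  -- characterises Lebesgue measure.
  have hIic : ∀ b, ν.map (fun x => (∑ i, x i) ^ Fintype.card S) (Set.Iic b) =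
      dirichletWeight φ Set.univ * ENNReal.ofReal b := by
    intro b
    rw [Measure.map_apply hmeas measurableSet_Iic, hν,
      withDensity_apply _ (hmeas measurableSet_Iic), Measure.restrict_restrict
      (hmeas measurableSet_Iic)]
    rcases le_or_gt b 0 with hb | hb
    · have : (fun x : S → ℝ => (∑ i, x i) ^ Fintype.card S) ⁻¹' Set.Iic b ∩ orthant S = ∅ := by
        ext x
        simp only [Set.mem_inter_iff, Set.mem_preimage, Set.mem_Iic, Set.mem_empty_iff_false,
          iff_false, not_and]
        intro h hx
        exact absurd (pow_pos (sum_pos_of_mem_orthant hx) _) (not_lt.2 (h.trans hb))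
      rw [this, ENNReal.ofReal_of_nonpos hb]
      simp
    · have : (fun x : S → ℝ => (∑ i, x i) ^ Fintype.card S) ⁻¹' Set.Iic b ∩ orthant S =
          orthant S ∩ {x | ∑ i, x i ≤ b ^ ((Fintype.card S : ℝ)⁻¹)} := by
        rw [Set.inter_comm]
        ext x
        refine and_congr_right fun hx => ?_
        have h0 := sum_pos_of_mem_orthant hx
        show (∑ i, x i) ^ Fintype.card S ≤ b ↔ ∑ i, x i ≤ b ^ ((Fintype.card S : ℝ)⁻¹)
        rw [Real.le_rpow_inv_iff_of_pos h0.le hb.le (by positivity), Real.rpow_natCast]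
      rw [this, setLIntegral_radialDensity φ (Real.rpow_pos_of_pos hb _),
        Real.rpow_inv_natCast_pow hb.le hn, mul_comm]
  refine Measure.ext_of_Ioc' _ _ (fun a b hab => ?_) (fun a b hab => ?_)
  · refine ((measure_mono Set.Ioc_subset_Iic_self).trans_lt ?_).ne
    rw [hIic]
    exact ENNReal.mul_lt_top hfin ENNReal.ofReal_lt_top
  · have hdiff : Set.Ioc a b = Set.Iic b \ Set.Iic a := by ext; simp [and_comm]
    rw [hdiff, measure_sdiff (Set.Iic_subset_Iic.2 hab.le) measurableSet_Iic.nullMeasurableSet,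
      hIic, hIic, ← hdiff, Measure.smul_apply, Measure.restrict_apply measurableSet_Ioc, smul_eq_mul,
      ← ENNReal.mul_sub (fun _ _ => hfin.ne)]
    · congr 1
      have : Set.Ioc a b ∩ Set.Ioi 0 = Set.Ioc (max a 0) b := by
        ext; simp only [Set.mem_inter_iff, Set.mem_Ioc, Set.mem_Ioi, max_lt_iff]; tauto
      rw [this, Real.volume_Ioc]
      rcases le_or_gt a 0 with ha | ha
      · rw [max_eq_right ha, ENNReal.ofReal_of_nonpos ha]; simp
      · rw [max_eq_left ha.le, ENNReal.ofReal_sub _ ha.le]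
    · rw [hIic]
      exact (ENNReal.mul_lt_top hfin ENNReal.ofReal_lt_top).ne

theorem lintegral_prod_gamma {φ : S → ℝ} (hφ : ∀ i, 1 ≤ φ i) :
    ∫⁻ x in orthant S, ENNReal.ofReal (∏ i, x i ^ (φ i - 1) * Real.exp (-x i)) =
      ENNReal.ofReal (∏ i, Real.Gamma (φ i)) := by
  have hφ0 : ∀ i, 0 < φ i := fun i => by linarith [hφ i]
  let f : S → ℝ → ℝ := fun i => (Set.Ioi (0 : ℝ)).indicator
    (fun u => Real.exp (-u) * u ^ (φ i - 1))
  have hf0 : ∀ i u, 0 ≤ f i u := fun i u =>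
    Set.indicator_nonneg (fun u hu => mul_nonneg (Real.exp_pos _).le (Real.rpow_nonneg hu.le _)) u
  have hfi : ∀ i, Integrable (f i) := fun i =>
    (integrable_indicator_iff measurableSet_Ioi).2 (Real.GammaIntegral_convergent (hφ0 i))
  have hint : ∀ i, ∫ u, f i u = Real.Gamma (φ i) := fun i => by
    rw [Real.Gamma_eq_integral (hφ0 i), ← integral_indicator measurableSet_Ioi]
  have hpi : Integrable (fun x : S → ℝ => ∏ i, f i (x i)) := Integrable.fintype_prod hfi
  rw [← Finset.prod_congr rfl fun i _ => hint i, ← integral_fintype_prod_volume_eq_prod,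
    ofReal_integral_eq_lintegral_ofReal hpi
      (Eventually.of_forall fun x => Finset.prod_nonneg fun i _ => hf0 i (x i)),
    ← lintegral_indicator measurableSet_orthant]
  refine lintegral_congr fun x => ?_
  by_cases hx : x ∈ orthant S
  · rw [Set.indicator_of_mem hx]
    congr 1
    refine Finset.prod_congr rfl fun i _ => ?_
    rw [mul_comm]
    have hfx : f i (x i) = Real.exp (-x i) * x i ^ (φ i - 1) :=
      Set.indicator_of_mem (s := Set.Ioi (0 : ℝ)) (hx i) _
    exact hfx.symm
  · rw [Set.indicator_of_notMem hx]
    have : ∃ i, ¬ 0 < x i := by simpa [orthant] using hx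
    obtain ⟨i, hi⟩ := this
    have hz : f i (x i) = 0 := Set.indicator_of_notMem (s := Set.Ioi (0 : ℝ)) hi _
    rw [Finset.prod_eq_zero (Finset.mem_univ i) hz, ENNReal.ofReal_zero]

/-- The integral of `∏ x i ^ (φ i - 1) * exp (-x i)` over the orthant is evaluated twice: by Fubini
as a product of Gamma values, and radially as the mass of the weight times a one-dimensional Gamma
integral. The factor `card S` comes from the unnormalised cone measure. -/
theorem dirichletWeight_univ_mul [Nonempty S] {φ : S → ℝ} (hφ : ∀ i, 1 ≤ φ i) :
    dirichletWeight φ Set.univ *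
        ENNReal.ofReal (Fintype.card S * Real.Gamma (∑ i, φ i)) =
      ENNReal.ofReal (∏ i, Real.Gamma (φ i)) := by
  have hn : 0 < (Fintype.card S : ℝ) := by exact_mod_cast Fintype.card_pos
  set n : ℝ := (Fintype.card S : ℝ) with hndef
  have hΦ : n ≤ ∑ i, φ i := by
    rw [hndef, Fintype.card_eq_sum_ones, Nat.cast_sum]
    exact Finset.sum_le_sum fun i _ => by simpa using hφ i
  have hΦ0 : 0 < ∑ i, φ i := by linarith
  -- With this exponent, `((∑ x) ^ n) ^ q = (∑ x) ^ (∑ φ - n)`, which is exactly what removes the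
  -- normalisation from the homogeneous density.
  set q : ℝ := (∑ i, φ i) / n - 1 with hq
  have hq0 : 0 ≤ q := by rw [hq, sub_nonneg, le_div_iff₀ hn]; linarith
  let g : ℝ → ENNReal := fun u => ENNReal.ofReal (u ^ q * Real.exp (-u ^ n⁻¹))
  have hg : Measurable g := by fun_prop
  have hgamma : ∫⁻ u in Set.Ioi (0 : ℝ), g u = ENNReal.ofReal (n * Real.Gamma (∑ i, φ i)) := by
    have h := integral_rpow_mul_exp_neg_rpow (inv_pos.2 hn) (by linarith : -1 < q)
    have he : (q + 1) / n⁻¹ = ∑ i, φ i := by rw [hq]; field_simp; ring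
    rw [he, one_div, inv_inv] at h
    rw [← h, ofReal_integral_eq_lintegral_ofReal]
    · exact integrableOn_rpow_mul_exp_neg_rpow (by linarith) (inv_pos.2 hn)
    · refine (ae_restrict_iff' measurableSet_Ioi).2 (Eventually.of_forall fun u hu => ?_)
      exact mul_nonneg (Real.rpow_nonneg (le_of_lt hu) _) (Real.exp_pos _).le
  have h1 := congrArg (fun μ => ∫⁻ u, g u ∂μ) (map_pow_sum_radialDensity hφ)
  simp only [lintegral_smul_measure, smul_eq_mul] at h1
  rw [hgamma] at h1
  have hgs : Measurable fun x : S → ℝ => g ((∑ i, x i) ^ Fintype.card S) := by fun_prop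
  rw [← h1, lintegral_map hg (by fun_prop), lintegral_withDensity_eq_lintegral_mul _
    (measurable_radialDensity φ).ennreal_ofReal hgs, ← lintegral_prod_gamma hφ]
  refine setLIntegral_congr_fun measurableSet_orthant fun x hx => ?_
  have hs := sum_pos_of_mem_orthant hx
  simp only [Pi.mul_apply, g]
  rw [← ENNReal.ofReal_mul (radialDensity_nonneg φ hx)]
  congr 1
  have e1 : ((∑ i, x i) ^ Fintype.card S) ^ n⁻¹ = ∑ i, x i :=
    Real.pow_rpow_inv_natCast hs.le Fintype.card_ne_zero
  have e2 : ((∑ i, x i) ^ Fintype.card S) ^ q = ∏ i, (∑ j, x j) ^ (φ i - 1) := by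
    rw [← Real.rpow_natCast, ← Real.rpow_mul hs.le, ← Real.rpow_sum_of_pos hs,
      Finset.sum_sub_distrib]
    congr 1
    rw [hq, Finset.sum_const, Finset.card_univ, nsmul_eq_mul, mul_one, ← hndef]
    field_simp
  rw [e1, e2, ← mul_assoc, radialDensity, ← Finset.prod_mul_distrib,
    Finset.prod_mul_distrib (g := fun i => Real.exp (-x i)),
    ← Real.exp_sum, Finset.sum_neg_distrib]
  congr 1
  refine Finset.prod_congr rfl fun i _ => ?_
  rw [← Real.mul_rpow (div_nonneg (hx i).le hs.le) hs.le, div_mul_cancel₀ _ hs.ne']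

end DirichletIntegral

/-! ### Moments, support and concentration of Dirichlet distributions -/

section Dirichlet

variable {S : Type*} [Fintype S] [Nonempty S] {φ : S → ℝ}

theorem sum_param_pos (hφ : ∀ i, 1 ≤ φ i) : 0 < ∑ i, φ i :=
  Finset.sum_pos (fun i _ => by linarith [hφ i]) Finset.univ_nonempty

omit [Nonempty S] in
theorem prod_Gamma_pos (hφ : ∀ i, 1 ≤ φ i) : 0 < ∏ i, Real.Gamma (φ i) :=
  Finset.prod_pos fun i _ => Real.Gamma_pos_of_pos (by linarith [hφ i])

theorem dirichletWeight_univ_toReal_mul (hφ : ∀ i, 1 ≤ φ i) :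
    (dirichletWeight φ Set.univ).toReal * (Fintype.card S * Real.Gamma (∑ i, φ i)) =
      ∏ i, Real.Gamma (φ i) := by
  have h := congrArg ENNReal.toReal (dirichletWeight_univ_mul hφ)
  have hG := Real.Gamma_pos_of_pos (sum_param_pos hφ)
  rwa [ENNReal.toReal_mul, ENNReal.toReal_ofReal (by positivity),
    ENNReal.toReal_ofReal (prod_Gamma_pos hφ).le] at h

theorem dirichletWeight_univ_toReal_pos (hφ : ∀ i, 1 ≤ φ i) :
    0 < (dirichletWeight φ Set.univ).toReal := by
  have h := dirichletWeight_univ_toReal_mul hφ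
  have hG := Real.Gamma_pos_of_pos (sum_param_pos hφ)
  have hn : 0 < (Fintype.card S : ℝ) := by exact_mod_cast Fintype.card_pos
  by_contra! h0
  have h1 := prod_Gamma_pos hφ
  have h2 : 0 < Fintype.card S * Real.Gamma (∑ i, φ i) := by positivity
  nlinarith

theorem dirichletWeight_univ_ne_zero (hφ : ∀ i, 1 ≤ φ i) : dirichletWeight φ Set.univ ≠ 0 := by
  intro h
  have := dirichletWeight_univ_toReal_pos hφ
  simp [h] at this

theorem isProbabilityMeasure_dirichlet (hφ : ∀ i, 1 ≤ φ i) :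
    IsProbabilityMeasure (dirichlet φ) := by
  refine ⟨?_⟩
  rw [dirichlet, Measure.smul_apply, smul_eq_mul]
  exact ENNReal.inv_mul_cancel (dirichletWeight_univ_ne_zero hφ) (dirichletWeight_univ_lt_top hφ).ne

/-- The relative interior of the probability simplex. -/
def openSimplex (S : Type*) [Fintype S] : Set (S → ℝ) := {p | p ∈ orthant S ∧ ∑ i, p i = 1}

omit [Nonempty S] in
theorem openSimplex_subset : openSimplex S ⊆ stdSimplex ℝ S := fun _ hp =>
  ⟨fun i => (hp.1 i).le, hp.2⟩

omit [Nonempty S] in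
theorem measurableSet_openSimplex : MeasurableSet (openSimplex S) :=
  measurableSet_orthant.inter (measurableSet_eq_fun (by fun_prop) measurable_const)

theorem ae_mem_openSimplex_dirichletWeight (φ : S → ℝ) :
    ∀ᵐ p ∂dirichletWeight φ, p ∈ openSimplex S := by
  refine (withDensity_absolutelyContinuous _ _).ae_le ?_
  show ∀ᵐ p ∂simplexMeasure S, p ∈ openSimplex S
  rw [simplexMeasure, ae_map_iff (p := (· ∈ openSimplex S)) (by fun_prop) measurableSet_openSimplex]
  refine (ae_restrict_iff' (measurableSet_orthant_inter 1)).2 (Eventually.of_forall fun x hx => ?_)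
  have hs := sum_pos_of_mem_orthant hx.1
  refine ⟨fun i => div_pos (hx.1 i) hs, ?_⟩
  rw [← Finset.sum_div, div_self hs.ne']

theorem ae_mem_openSimplex (φ : S → ℝ) : ∀ᵐ p ∂dirichlet φ, p ∈ openSimplex S :=
  Measure.ae_smul_measure (ae_mem_openSimplex_dirichletWeight φ) _

theorem ae_mem_stdSimplex_dirichlet (φ : S → ℝ) : ∀ᵐ p ∂dirichlet φ, p ∈ stdSimplex ℝ S :=
  (ae_mem_openSimplex φ).mono fun _ hp => openSimplex_subset hp

omit [Nonempty S] in
theorem continuousOn_div_sum :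
    ContinuousOn (fun (x : S → ℝ) i => x i / ∑ j, x j) {x | ∑ j, x j ≠ 0} := by
  refine continuousOn_pi.2 fun i => ?_
  exact ContinuousOn.div (by fun_prop) (by fun_prop) fun x hx => hx

/-- The radial preimage of `U` in the open truncated cone is open and nonempty, hence of positive
volume, and the density is positive there. -/
theorem dirichlet_pos_of_isOpen (hφ : ∀ i, 1 ≤ φ i) {U : Set (S → ℝ)} (hU : IsOpen U)
    (hne : (U ∩ openSimplex S).Nonempty) : 0 < dirichlet φ U := by
  rw [dirichlet, Measure.smul_apply, smul_eq_mul]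
  refine ENNReal.mul_pos (ENNReal.inv_ne_zero.2 (dirichletWeight_univ_lt_top hφ).ne) (ne_of_gt ?_)
  have hUm := hU.measurableSet
  have h := lintegral_dirichletWeight φ (measurable_one.indicator hUm (f := (1 : (S → ℝ) → ENNReal)))
  rw [lintegral_indicator_one hUm] at h
  rw [h]
  set f := fun x : S → ℝ => ENNReal.ofReal (radialDensity φ x) *
    U.indicator (1 : (S → ℝ) → ENNReal) (fun i => x i / ∑ j, x j) with hf
  have hfm : Measurable f := (measurable_radialDensity φ).ennreal_ofReal.mul
    ((measurable_one.indicator hUm).comp (by fun_prop))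
  rw [setLIntegral_pos_iff hfm]
  set W : Set (S → ℝ) := (orthant S ∩ (fun (x : S → ℝ) i => x i / ∑ j, x j) ⁻¹' U) ∩
    {x | ∑ i, x i < 1}
  have hWo : IsOpen W := by
    refine IsOpen.inter ?_ (isOpen_lt (by fun_prop) continuous_const)
    exact (continuousOn_div_sum.mono fun x hx => (sum_pos_of_mem_orthant hx).ne').isOpen_inter_preimage
      isOpen_orthant hU
  have hWne : W.Nonempty := by
    obtain ⟨p, hpU, hp, hp1⟩ := hne
    have hsum : ∑ i, ((2 : ℝ)⁻¹ • p) i = 2⁻¹ := by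
      simp only [Pi.smul_apply, smul_eq_mul, ← Finset.mul_sum, hp1, mul_one]
    -- Halving a point of the simplex keeps its radial projection and makes the sum strictly less
    -- than one.
    refine ⟨(2 : ℝ)⁻¹ • p, ⟨fun i => ?_, ?_⟩, ?_⟩
    · simpa using hp i
    · show (fun i => ((2 : ℝ)⁻¹ • p) i / ∑ j, ((2 : ℝ)⁻¹ • p) j) ∈ U
      rw [hsum]
      convert hpU using 2 with i
      simp only [Pi.smul_apply, smul_eq_mul]
      ring
    · show ∑ i, ((2 : ℝ)⁻¹ • p) i < 1
      rw [hsum]; norm_num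
  refine (hWo.measure_pos volume hWne).trans_le (measure_mono ?_)
  rintro x ⟨⟨hx, hxU⟩, hx1⟩
  have hs := sum_pos_of_mem_orthant hx
  refine ⟨?_, hx, le_of_lt (show ∑ i, x i < 1 from hx1)⟩
  rw [Function.mem_support, hf]
  simp only [Set.indicator_of_mem (show (fun i => x i / ∑ j, x j) ∈ U from hxU), Pi.one_apply,
    mul_one]
  refine (ENNReal.ofReal_pos.2 ?_).ne'
  exact Finset.prod_pos fun i _ => Real.rpow_pos_of_pos (div_pos (hx i) hs) _

omit [Nonempty S] in
theorem isPreconnected_openSimplex : IsPreconnected (openSimplex S) := by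
  refine Convex.isPreconnected fun p hp q hq a b ha hb hab => ⟨fun i => ?_, ?_⟩
  · have h1 := hp.1 i
    have h2 := hq.1 i
    simp only [Pi.add_apply, Pi.smul_apply, smul_eq_mul]
    rcases ha.eq_or_lt with rfl | ha
    · have : b = 1 := by linarith
      subst this; simpa using h2
    · have := mul_pos ha h1
      have := mul_nonneg hb h2.le
      linarith
  · simp only [Pi.add_apply, Pi.smul_apply, smul_eq_mul, Finset.sum_add_distrib, ← Finset.mul_sum,
      hp.2, hq.2, mul_one, hab]

/-- Under a Dirichlet law the `α`-quantile of a continuous function is unique. -/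
theorem lt_measureReal_valueAtRisk_add {α : ℝ} (hα : 0 < α ∧ α < 1) (hφ : ∀ i, 1 ≤ φ i)
    {X : (S → ℝ) → ℝ} (hX : Continuous X) {B : ℝ} (hB : ∀ p ∈ stdSimplex ℝ S, |X p| ≤ B)
    {ε : ℝ} (hε : 0 < ε) :
    α < (dirichlet φ).real {p | X p ≤ valueAtRisk α (dirichlet φ) X + ε} := by
  have hprob := isProbabilityMeasure_dirichlet hφ
  have hae := ae_mem_openSimplex φ
  have hq := le_measureReal_valueAtRisk hα hX.measurable
    ((ae_mem_stdSimplex_dirichlet φ).mono fun p hp => hB p hp)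
  set q := valueAtRisk α (dirichlet φ) X
  by_contra! hle
  have hm1 : MeasurableSet {p | X p ≤ q} := measurableSet_le hX.measurable measurable_const
  have hm2 : MeasurableSet {p | X p ≤ q + ε} := measurableSet_le hX.measurable measurable_const
  obtain ⟨p₀, hp₀, hX₀⟩ : ∃ p ∈ openSimplex S, X p ≤ q := by
    by_contra! h
    have : dirichlet φ {p | X p ≤ q} = 0 := by
      rw [measure_eq_zero_iff_ae_notMem]
      filter_upwards [hae] with p hp
      exact not_le.2 (h p hp)
    rw [Measure.real, this] at hq
    simp at hq
    linarith
  obtain ⟨p₁, hp₁, hX₁⟩ : ∃ p ∈ openSimplex S, q + ε < X p := by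
    by_contra! h
    have : dirichlet φ {p | X p ≤ q + ε} = 1 := by
      rw [prob_compl_eq_zero_iff hm2 |>.symm, measure_eq_zero_iff_ae_notMem]
      filter_upwards [hae] with p hp
      exact fun hn => hn (h p hp)
    rw [Measure.real, this] at hle
    simp at hle
    linarith
  -- Connectedness of the open simplex supplies an intermediate value, so the open set where `q < X
  -- < q + ε` has positive mass. This contradicts that the mass is at least `α` up to `q` and at
  -- most `α` up to `q + ε`.
  obtain ⟨p, hp, hXp⟩ : q + ε / 2 ∈ X '' openSimplex S :=
    (isPreconnected_openSimplex.image X hX.continuousOn).ordConnected.out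
      (Set.mem_image_of_mem X hp₀) (Set.mem_image_of_mem X hp₁) ⟨by linarith, by linarith⟩
  have hpos := dirichlet_pos_of_isOpen hφ (isOpen_Ioo.preimage hX)
    (show (X ⁻¹' Set.Ioo q (q + ε) ∩ openSimplex S).Nonempty from
      ⟨p, ⟨by rw [hXp]; linarith, by rw [hXp]; linarith⟩, hp⟩)
  have hpos' : 0 < (dirichlet φ).real (X ⁻¹' Set.Ioo q (q + ε)) :=
    ENNReal.toReal_pos hpos.ne' (measure_ne_top _ _)
  have hadd : (dirichlet φ).real {p | X p ≤ q} + (dirichlet φ).real (X ⁻¹' Set.Ioo q (q + ε)) ≤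
      (dirichlet φ).real {p | X p ≤ q + ε} := by
    rw [← measureReal_union _ (isOpen_Ioo.preimage hX).measurableSet]
    · refine measureReal_mono ?_
      rintro p (hp | hp)
      · exact le_trans (show X p ≤ q from hp) (by linarith)
      · exact hp.2.le
    · exact Set.disjoint_left.2 fun p hp hp' => absurd hp'.1 (not_lt.2 (show X p ≤ q from hp))
  linarith

variable [DecidableEq S]

omit [Fintype S] [Nonempty S] in
theorem one_le_add_single (hφ : ∀ i, 1 ≤ φ i) (i : S) (j : S) :
    1 ≤ (φ + Pi.single i 1 : S → ℝ) j := by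
  have : (0 : ℝ) ≤ (Pi.single i 1 : S → ℝ) j := by
    rw [Pi.single_apply]; split_ifs <;> norm_num
  rw [Pi.add_apply]
  linarith [hφ j]

omit [Nonempty S] in
theorem sum_add_single (i : S) : ∑ j, (φ + Pi.single i 1 : S → ℝ) j = ∑ j, φ j + 1 := by
  simp [Finset.sum_add_distrib]

/-- The functional equation of Gamma, applied in the numerator and in the denominator of the
normalisation constant. -/
theorem dirichletWeight_add_single (hφ : ∀ i, 1 ≤ φ i) (i : S) :
    (dirichletWeight (φ + Pi.single i 1) Set.univ).toReal =
      φ i / (∑ j, φ j) * (dirichletWeight φ Set.univ).toReal := by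
  have h1 := dirichletWeight_univ_toReal_mul hφ
  have h2 := dirichletWeight_univ_toReal_mul (one_le_add_single hφ i)
  have hΦ := sum_param_pos hφ
  have hG := Real.Gamma_pos_of_pos hΦ
  have hn : 0 < (Fintype.card S : ℝ) := by exact_mod_cast Fintype.card_pos
  have hprod : ∏ j, Real.Gamma ((φ + Pi.single i 1 : S → ℝ) j) = φ i * ∏ j, Real.Gamma (φ j) := by
    rw [← Finset.mul_prod_erase _ _ (Finset.mem_univ i),
      ← Finset.mul_prod_erase _ (fun j => Real.Gamma (φ j)) (Finset.mem_univ i), ← mul_assoc]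
    congr 1
    · rw [Pi.add_apply, Pi.single_eq_same, Real.Gamma_add_one (by linarith [hφ i])]
    · refine Finset.prod_congr rfl fun j hj => ?_
      rw [Pi.add_apply, Pi.single_eq_of_ne (Finset.ne_of_mem_erase hj), add_zero]
  rw [sum_add_single, Real.Gamma_add_one hΦ.ne', hprod, ← h1] at h2
  have h3 : Fintype.card S * Real.Gamma (∑ j, φ j) ≠ 0 := by positivity
  rw [div_mul_eq_mul_div, eq_div_iff hΦ.ne']
  apply mul_right_cancel₀ h3
  linear_combination h2

/-- A factor `p i` raises the exponent of that coordinate by one; moments thereby reduce to ratios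
of total masses. -/
theorem lintegral_mul_dirichletWeight (φ : S → ℝ) (i : S)
    {g : (S → ℝ) → ENNReal} (hg : Measurable g) :
    ∫⁻ p, ENNReal.ofReal (p i) * g p ∂dirichletWeight φ =
      ∫⁻ p, g p ∂dirichletWeight (φ + Pi.single i 1) := by
  rw [lintegral_dirichletWeight _ (by fun_prop), lintegral_dirichletWeight _ hg]
  refine setLIntegral_congr_fun (measurableSet_orthant_inter 1) fun x hx => ?_
  have hs := sum_pos_of_mem_orthant hx.1
  simp only [← mul_assoc]
  rw [← ENNReal.ofReal_mul (radialDensity_nonneg φ hx.1)]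
  congr 2
  have h := fun ψ : S → ℝ => (Finset.mul_prod_erase Finset.univ
    (fun j => (x j / ∑ k, x k) ^ (ψ j - 1)) (Finset.mem_univ i)).symm
  rw [radialDensity, radialDensity, h, h, mul_right_comm]
  congr 1
  · rw [Pi.add_apply, Pi.single_eq_same, add_sub_right_comm,
      Real.rpow_add_one (div_pos (hx.1 i) hs).ne']
  · refine Finset.prod_congr rfl fun j hj => ?_
    rw [Pi.add_apply, Pi.single_eq_of_ne (Finset.ne_of_mem_erase hj), add_zero]

theorem integral_dirichlet_apply (hφ : ∀ i, 1 ≤ φ i) (i : S) :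
    ∫ p, p i ∂dirichlet φ = φ i / ∑ j, φ j := by
  have hw := dirichletWeight_univ_toReal_pos hφ
  rw [dirichlet, integral_smul_measure, integral_eq_lintegral_of_nonneg_ae
    ((ae_mem_openSimplex_dirichletWeight φ).mono fun p hp => (hp.1 i).le)
    (measurable_pi_apply i).aestronglyMeasurable]
  have h := lintegral_mul_dirichletWeight φ i (g := 1) measurable_const
  simp only [Pi.one_apply, mul_one, lintegral_one] at h
  rw [h, dirichletWeight_add_single hφ, ENNReal.toReal_inv, smul_eq_mul]
  field_simp

theorem integral_dirichlet_apply_mul_self (hφ : ∀ i, 1 ≤ φ i) (i : S) :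
    ∫ p, p i * p i ∂dirichlet φ = (φ i + 1) / (∑ j, φ j + 1) * (φ i / ∑ j, φ j) := by
  have hw := dirichletWeight_univ_toReal_pos hφ
  rw [dirichlet, integral_smul_measure, integral_eq_lintegral_of_nonneg_ae
    ((ae_mem_openSimplex_dirichletWeight φ).mono fun p hp => (mul_pos (hp.1 i) (hp.1 i)).le)
    ((measurable_pi_apply i).mul (measurable_pi_apply i)).aestronglyMeasurable]
  have h1 : ∫⁻ p, ENNReal.ofReal (p i * p i) ∂dirichletWeight φ =
      ∫⁻ p, ENNReal.ofReal (p i) * ENNReal.ofReal (p i) ∂dirichletWeight φ :=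
    lintegral_congr_ae ((ae_mem_openSimplex_dirichletWeight φ).mono fun p hp =>
      ENNReal.ofReal_mul (hp.1 i).le)
  have h2 := lintegral_mul_dirichletWeight (φ + Pi.single i 1) i (g := 1) measurable_const
  simp only [Pi.one_apply, mul_one, lintegral_one] at h2
  rw [h1, lintegral_mul_dirichletWeight φ i (by fun_prop), h2,
    dirichletWeight_add_single (one_le_add_single hφ i), dirichletWeight_add_single hφ,
    ENNReal.toReal_inv, smul_eq_mul, sum_add_single, Pi.add_apply, Pi.single_eq_same]
  field_simp

omit [DecidableEq S] in
theorem integrable_dirichlet_of_continuous (hφ : ∀ i, 1 ≤ φ i) {g : (S → ℝ) → ℝ}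
    (hg : Continuous g) : Integrable g (dirichlet φ) := by
  have := isProbabilityMeasure_dirichlet hφ
  obtain ⟨C, hC⟩ := (isCompact_stdSimplex ℝ S).exists_bound_of_continuousOn hg.continuousOn
  exact Integrable.of_bound hg.measurable.aestronglyMeasurable C
    ((ae_mem_stdSimplex_dirichlet φ).mono fun p hp => hC p hp)

theorem integral_dirichlet_sub_sq (hφ : ∀ i, 1 ≤ φ i) (i : S) (c : ℝ) :
    ∫ p, (p i - c) ^ 2 ∂dirichlet φ =
      (φ i + 1) / (∑ j, φ j + 1) * (φ i / ∑ j, φ j) - 2 * c * (φ i / ∑ j, φ j) + c ^ 2 := by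
  have := isProbabilityMeasure_dirichlet hφ
  have h1 : ∀ p : S → ℝ, (p i - c) ^ 2 = p i * p i - 2 * c * p i + c ^ 2 := fun p => by ring
  simp_rw [h1]
  rw [integral_add (integrable_dirichlet_of_continuous hφ (by fun_prop)) (integrable_const _),
    integral_sub (integrable_dirichlet_of_continuous hφ (by fun_prop))
    (integrable_dirichlet_of_continuous hφ (by fun_prop)), integral_const_mul,
    integral_dirichlet_apply hφ, integral_dirichlet_apply_mul_self hφ]
  simp

/-- Dirichlet distributions whose total parameter tends to infinity concentrate at the limit of
their means. -/
theorem tendsto_integral_dirichlet_sub {φ : ℕ → S → ℝ} (hφ : ∀ t i, 1 ≤ φ t i)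
    (hΦ : Tendsto (fun t => ∑ i, φ t i) atTop atTop) {c : S → ℝ}
    (hc : ∀ i, Tendsto (fun t => φ t i / ∑ j, φ t j) atTop (𝓝 (c i)))
    {Y : (S → ℝ) → ℝ} (hY : Measurable Y) {M : ℝ} (hM : ∀ p, |Y p| ≤ M) (hYc : ContinuousAt Y c) :
    Tendsto (fun t => ∫ p, |Y p - Y c| ∂dirichlet (φ t)) atTop (𝓝 0) := by
  have hM0 : 0 ≤ M := (abs_nonneg _).trans (hM c)
  -- In the limit the second moment formula reads `c i * c i - 2 * c i * c i + c i ^ 2 = 0`.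
  have hsq : ∀ i, Tendsto (fun t => ∫ p, (p i - c i) ^ 2 ∂dirichlet (φ t)) atTop (𝓝 0) := by
    intro i
    simp_rw [fun t => integral_dirichlet_sub_sq (hφ t) i (c i)]
    have h0 : Tendsto (fun t => (∑ j, φ t j)⁻¹) atTop (𝓝 0) := tendsto_inv_atTop_zero.comp hΦ
    have h1 : Tendsto (fun t => (φ t i + 1) / (∑ j, φ t j + 1)) atTop (𝓝 (c i)) := by
      have : Tendsto (fun t => (φ t i / ∑ j, φ t j + (∑ j, φ t j)⁻¹) / (1 + (∑ j, φ t j)⁻¹)) atTop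
          (𝓝 ((c i + 0) / (1 + 0))) :=
        ((hc i).add h0).div (tendsto_const_nhds.add h0) (by norm_num)
      rw [add_zero, add_zero, div_one] at this
      refine this.congr fun t => ?_
      have := sum_param_pos (hφ t)
      field_simp
    have h2 := ((h1.mul (hc i)).sub ((hc i).const_mul (2 * c i))).add_const (c i ^ 2)
    refine h2.trans_eq ?_
    ring_nf
  rw [Metric.tendsto_atTop]
  intro ε hε
  obtain ⟨δ, hδ, hδY⟩ := Metric.continuousAt_iff.1 hYc (ε / 2) (by positivity)
  have hsum : Tendsto (fun t => 2 * M / δ ^ 2 * ∑ i, ∫ p, (p i - c i) ^ 2 ∂dirichlet (φ t)) atTop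
      (𝓝 (2 * M / δ ^ 2 * ∑ _i : S, (0 : ℝ))) :=
    (tendsto_finsetSum _ fun i _ => hsq i).const_mul _
  simp only [Finset.sum_const_zero, mul_zero] at hsum
  obtain ⟨T, hT⟩ := Metric.tendsto_atTop.1 hsum (ε / 2) (by positivity)
  refine ⟨T, fun t ht => ?_⟩
  have := isProbabilityMeasure_dirichlet (hφ t)
  -- Chebyshev's argument: within `δ` of `c` continuity gives `ε / 2`; elsewhere some coordinate is
  -- off by at least `δ`, and the quadratic term exceeds the trivial bound `2 * M`.
  have hbound : ∀ p, |Y p - Y c| ≤ ε / 2 + 2 * M / δ ^ 2 * ∑ i, (p i - c i) ^ 2 := by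
    intro p
    have h0 : 0 ≤ ∑ i, (p i - c i) ^ 2 := Finset.sum_nonneg fun i _ => sq_nonneg _
    by_cases hp : dist p c < δ
    · have := hδY hp
      rw [Real.dist_eq] at this
      have : 0 ≤ 2 * M / δ ^ 2 * ∑ i, (p i - c i) ^ 2 := by positivity
      linarith
    · have h1 : δ ^ 2 ≤ ∑ i, (p i - c i) ^ 2 := by
        rw [dist_pi_lt_iff hδ] at hp
        push Not at hp
        obtain ⟨i, hi⟩ := hp
        rw [Real.dist_eq] at hi
        calc δ ^ 2 ≤ |p i - c i| ^ 2 := by gcongr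
          _ = (p i - c i) ^ 2 := sq_abs _
          _ ≤ _ := Finset.single_le_sum (f := fun i => (p i - c i) ^ 2)
              (fun j _ => sq_nonneg _) (Finset.mem_univ i)
      have h2 : |Y p - Y c| ≤ 2 * M := (abs_sub _ _).trans (by linarith [hM p, hM c])
      have h3 : 2 * M ≤ 2 * M / δ ^ 2 * ∑ i, (p i - c i) ^ 2 := by
        rw [div_mul_eq_mul_div, le_div_iff₀ (by positivity)]
        gcongr
      linarith
  have hi : ∀ i, Integrable (fun p : S → ℝ => (p i - c i) ^ 2) (dirichlet (φ t)) := fun i =>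
    integrable_dirichlet_of_continuous (hφ t) (by fun_prop)
  have hle : ∫ p, |Y p - Y c| ∂dirichlet (φ t) ≤
      ε / 2 + 2 * M / δ ^ 2 * ∑ i, ∫ p, (p i - c i) ^ 2 ∂dirichlet (φ t) := by
    calc _ ≤ ∫ p, (ε / 2 + 2 * M / δ ^ 2 * ∑ i, (p i - c i) ^ 2) ∂dirichlet (φ t) := by
          refine integral_mono (Integrable.of_bound (by fun_prop) (2 * M)
            (Eventually.of_forall fun p => ?_))
            ((integrable_const _).add ((integrable_finsetSum _ fun i _ => hi i).const_mul _)) hbound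
          rw [Real.norm_eq_abs, abs_abs]
          exact (abs_sub _ _).trans (by linarith [hM p, hM c])
      _ = _ := by
          rw [integral_add (integrable_const _)
            ((integrable_finsetSum _ fun i _ => hi i).const_mul _), integral_const_mul,
            integral_finsetSum _ fun i _ => hi i]
          simp
  have h2 := hT t ht
  rw [Real.dist_eq, sub_zero] at h2 ⊢
  rw [abs_of_nonneg (integral_nonneg fun p => abs_nonneg _)]
  linarith [le_abs_self (2 * M / δ ^ 2 * ∑ i, ∫ p, (p i - c i) ^ 2 ∂dirichlet (φ t))]

end Dirichlet

/-! ### Scalar stochastic approximation -/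

/-- The perturbation `η` is negligible for the step sizes `lam`: after subtraction of a null
sequence, its weighted series converges. -/
def Negligible (lam η : ℕ → ℝ) : Prop :=
  ∃ m : ℕ → ℝ, Tendsto m atTop (𝓝 0) ∧
    ∃ L, Tendsto (fun K => ∑ k ∈ Finset.range K, lam k * (η k - m k)) atTop (𝓝 L)

theorem Negligible.of_tendsto {lam η : ℕ → ℝ} (h : Tendsto η atTop (𝓝 0)) : Negligible lam η :=
  ⟨η, h, 0, by simp⟩

theorem Negligible.add {lam η η' : ℕ → ℝ} (h : Negligible lam η) (h' : Negligible lam η') :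
    Negligible lam fun k => η k + η' k := by
  obtain ⟨m, hm, L, hL⟩ := h
  obtain ⟨m', hm', L', hL'⟩ := h'
  refine ⟨fun k => m k + m' k, by simpa using hm.add hm', L + L', (hL.add hL').congr fun K => ?_⟩
  rw [← Finset.sum_add_distrib]
  exact Finset.sum_congr rfl fun k _ => by ring

theorem Negligible.const_mul {lam η : ℕ → ℝ} (h : Negligible lam η) (c : ℝ) :
    Negligible lam fun k => c * η k := by
  obtain ⟨m, hm, L, hL⟩ := h
  refine ⟨fun k => c * m k, by simpa using hm.const_mul c, c * L, (hL.const_mul c).congr fun K => ?_⟩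
  rw [Finset.mul_sum]
  exact Finset.sum_congr rfl fun k _ => by ring

theorem Negligible.sum {ι : Type*} {lam : ℕ → ℝ} (s : Finset ι) {η : ι → ℕ → ℝ}
    (h : ∀ i ∈ s, Negligible lam (η i)) : Negligible lam fun k => ∑ i ∈ s, η i k := by
  classical
  induction s using Finset.induction_on with
  | empty => exact Negligible.of_tendsto (by simp)
  | insert i s hi ih =>
    simp only [Finset.sum_insert hi]
    exact (h i (Finset.mem_insert_self i s)).add
      (ih fun j hj => h j (Finset.mem_insert_of_mem hj))

/-- A contracting recursion with step sizes `lam` forgets its past and its negligible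
perturbations. -/
theorem eventually_le_of_recursion {lam η e : ℕ → ℝ} {b c : ℝ} (hc : 0 < c)
    (hlam : ∀ k, 0 ≤ lam k) (hlam0 : Tendsto lam atTop (𝓝 0))
    (hsum : Tendsto (fun K => ∑ k ∈ Finset.range K, lam k) atTop atTop)
    (hη : Negligible lam η)
    (he : ∀ᶠ k in atTop, e (k + 1) ≤ (1 - c * lam k) * e k + lam k * (b + η k))
    {ε : ℝ} (hε : 0 < ε) : ∀ᶠ k in atTop, e k ≤ b / c + ε := by
  obtain ⟨m, hm, L, hL⟩ := hη
  -- The remainder of the convergent series. Adding it to `e` cancels the oscillating noise and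
  -- leaves the perturbation `m + c * R`, which tends to zero.
  set R : ℕ → ℝ := fun K => L - ∑ k ∈ Finset.range K, lam k * (η k - m k) with hR
  have hR0 : Tendsto R atTop (𝓝 0) := by simpa using hL.const_sub L
  have hRs : ∀ k, R (k + 1) = R k - lam k * (η k - m k) := fun k => by
    simp only [hR, Finset.sum_range_succ]; ring
  -- The three thirds of `ε` pay for `m + c * R`, for the decaying initial error and for the final
  -- removal of `R`.
  set β := b / c + ε / 3 with hβ
  have hsmall : ∀ᶠ k in atTop, m k + c * R k ≤ c * (ε / 3) := by
    have : Tendsto (fun k => m k + c * R k) atTop (𝓝 0) := by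
      simpa using hm.add (hR0.const_mul c)
    exact this.eventually (ge_mem_nhds (by positivity))
  have hcl : ∀ᶠ k in atTop, c * lam k ≤ 1 := by
    have : Tendsto (fun k => c * lam k) atTop (𝓝 0) := by simpa using hlam0.const_mul c
    exact this.eventually (ge_mem_nhds one_pos)
  obtain ⟨k₁, hk₁⟩ := eventually_atTop.1 (he.and (hsmall.and hcl))
  have hstep : ∀ k, k₁ ≤ k →
      e (k + 1) + R (k + 1) - β ≤ (1 - c * lam k) * (e k + R k - β) := by
    intro k hk
    obtain ⟨h1, h2, -⟩ := hk₁ k hk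
    have h3 : lam k * (m k + c * R k) ≤ lam k * (c * (ε / 3)) :=
      mul_le_mul_of_nonneg_left h2 (hlam k)
    have h4 : c * β = b + c * (ε / 3) := by rw [hβ]; field_simp
    have h5 : lam k * (c * β) = lam k * (b + c * (ε / 3)) := by rw [h4]
    rw [hRs]
    nlinarith
  set Λ : ℕ → ℝ := fun K => ∑ k ∈ Finset.range K, lam k with hΛ
  set D := max (e k₁ + R k₁ - β) 0 with hD
  have hexp : ∀ k, k₁ ≤ k → e k + R k - β ≤ D * Real.exp (-(c * (Λ k - Λ k₁))) := by
    intro k hk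
    induction k, hk using Nat.le_induction with
    | base => simp [hD]
    | succ k hk ih =>
      obtain ⟨-, -, h1⟩ := hk₁ k hk
      have hΛs : Λ (k + 1) = Λ k + lam k := by simp only [hΛ, Finset.sum_range_succ]
      have h2 : 1 - c * lam k ≤ Real.exp (-(c * lam k)) := Real.one_sub_le_exp_neg _
      calc e (k + 1) + R (k + 1) - β ≤ (1 - c * lam k) * (e k + R k - β) := hstep k hk
        _ ≤ (1 - c * lam k) * (D * Real.exp (-(c * (Λ k - Λ k₁)))) :=
            mul_le_mul_of_nonneg_left ih (by linarith)
        _ ≤ Real.exp (-(c * lam k)) * (D * Real.exp (-(c * (Λ k - Λ k₁)))) := by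
            have : 0 ≤ D := le_max_right _ _
            gcongr
        _ = D * Real.exp (-(c * (Λ (k + 1) - Λ k₁))) := by
            rw [mul_left_comm, ← Real.exp_add, hΛs]
            congr 2
            ring
  have hlim : Tendsto (fun k => D * Real.exp (-(c * (Λ k - Λ k₁)))) atTop (𝓝 0) := by
    have h1 : Tendsto (fun k => c * (Λ k - Λ k₁)) atTop atTop :=
      (tendsto_atTop_add_const_right _ _ hsum).const_mul_atTop hc
    simpa using (Real.tendsto_exp_neg_atTop_nhds_zero.comp h1).const_mul D
  filter_upwards [eventually_ge_atTop k₁, hlim.eventually (ge_mem_nhds (show 0 < ε / 3 by positivity)),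
    hR0.eventually (le_mem_nhds (show -(ε / 3) < 0 by linarith))] with k hk h1 h2
  have := hexp k hk
  linarith

/-- A function with vanishing integrals over the sets of a σ-algebra is orthogonal to its bounded
measurable functions. -/
theorem setIntegral_mul_eq_zero {Ω : Type*} {m mΩ : MeasurableSpace Ω} (hm : m ≤ mΩ)
    {P : Measure Ω} [IsFiniteMeasure P] {f g : Ω → ℝ} (hf : Integrable f P)
    (h0 : ∀ A, MeasurableSet[m] A → ∫ ω in A, f ω ∂P = 0) (hg : StronglyMeasurable[m] g) {B : ℝ}
    (hB : ∀ ω, |g ω| ≤ B) {A : Set Ω} (hA : MeasurableSet[m] A) :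
    ∫ ω in A, g ω * f ω ∂P = 0 := by
  have hcond : P[f|m] =ᵐ[P] 0 := by
    refine (ae_eq_condExp_of_forall_setIntegral_eq hm hf (fun _ _ _ => integrableOn_zero)
      (fun A hA _ => ?_) aestronglyMeasurable_zero).symm
    rw [h0 A hA]
    simp
  have hi : Integrable (fun ω => g ω * f ω) P :=
    hf.bdd_mul (hg.mono hm).aestronglyMeasurable (Eventually.of_forall fun ω => hB ω)
  have h := condExp_mul_of_stronglyMeasurable_left hg hi hf
  rw [← setIntegral_condExp hm hi hA]
  refine (integral_congr_ae (ae_restrict_of_ae (h.trans ?_))).trans (integral_zero Ω ℝ)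
  filter_upwards [hcond] with ω hω
  rw [Pi.mul_apply, hω]
  simp

/-- `L²`-bounded sums of martingale differences converge almost surely. -/
theorem ae_exists_tendsto_sum_of_setIntegral_eq_zero {Ω : Type*} {mΩ : MeasurableSpace Ω}
    {P : Measure Ω} [IsProbabilityMeasure P] (ℱ : Filtration ℕ mΩ) {D : ℕ → Ω → ℝ}
    (hD : ∀ k, StronglyMeasurable[ℱ (k + 1)] (D k)) {M : ℕ → ℝ} (hM : ∀ k ω, |D k ω| ≤ M k)
    (h0 : ∀ k A, MeasurableSet[ℱ k] A → ∫ ω in A, D k ω ∂P = 0)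
    {C : ℝ} (hC : ∀ K, ∑ k ∈ Finset.range K, ∫ ω, D k ω ^ 2 ∂P ≤ C) :
    ∀ᵐ ω ∂P, ∃ L, Tendsto (fun K => ∑ k ∈ Finset.range K, D k ω) atTop (𝓝 L) := by
  have hDm : ∀ k, StronglyMeasurable (D k) := fun k => (hD k).mono (ℱ.le _)
  have hDi : ∀ k, Integrable (D k) P := fun k =>
    Integrable.of_bound (hDm k).aestronglyMeasurable (M k) (Eventually.of_forall fun ω => hM k ω)
  set W : ℕ → Ω → ℝ := fun K ω => ∑ k ∈ Finset.range K, D k ω with hW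
  have hWm : ∀ K, StronglyMeasurable[ℱ K] (W K) := fun K =>
    Finset.stronglyMeasurable_fun_sum _ fun k hk =>
      (hD k).mono (ℱ.mono (Finset.mem_range.1 hk))
  have hWb : ∀ K ω, |W K ω| ≤ ∑ k ∈ Finset.range K, M k := fun K ω =>
    (Finset.abs_sum_le_sum_abs _ _).trans (Finset.sum_le_sum fun k _ => hM k ω)
  have hWi : ∀ K, Integrable (W K) P := fun K =>
    Integrable.of_bound ((hWm K).mono (ℱ.le _)).aestronglyMeasurable _
      (Eventually.of_forall fun ω => hWb K ω)
  have hWs : ∀ K ω, W (K + 1) ω = W K ω + D K ω := fun K ω => by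
    simp only [hW, Finset.sum_range_succ]
  have hmart : Martingale W ℱ P := by
    refine martingale_of_setIntegral_eq_succ hWm hWi fun K A hA => ?_
    simp_rw [hWs]
    rw [integral_add (hWi K).integrableOn (hDi K).integrableOn, h0 K A hA, add_zero]
  have hWDi : ∀ K, Integrable (fun ω => W K ω * D K ω) P := fun K =>
    (hDi K).bdd_mul ((hWm K).mono (ℱ.le _)).aestronglyMeasurable
      (Eventually.of_forall fun ω => hWb K ω)
  have hcross : ∀ K, ∫ ω, W K ω * D K ω ∂P = 0 := fun K => by
    -- The partial sum is known before the increment, so the two are orthogonal and the second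
    -- moments add up.
    simpa using setIntegral_mul_eq_zero (ℱ.le K) (hDi K) (h0 K) (hWm K) (hWb K) MeasurableSet.univ
  have hsqi : ∀ {f : Ω → ℝ} {B : ℝ}, StronglyMeasurable f → (∀ ω, |f ω| ≤ B) →
      Integrable (fun ω => f ω ^ 2) P := fun {f B} hf hB =>
    Integrable.of_bound (hf.pow 2).aestronglyMeasurable (B ^ 2) (Eventually.of_forall fun ω => by
      rw [Real.norm_eq_abs, abs_pow]
      exact pow_le_pow_left₀ (abs_nonneg _) (hB ω) 2)
  have hsq : ∀ K, ∫ ω, W K ω ^ 2 ∂P = ∑ k ∈ Finset.range K, ∫ ω, D k ω ^ 2 ∂P := by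
    intro K
    induction K with
    | zero => simp [hW]
    | succ K ih =>
      have h1 : ∀ ω, W (K + 1) ω ^ 2 = W K ω ^ 2 + 2 * (W K ω * D K ω) + D K ω ^ 2 := fun ω => by
        rw [hWs]; ring
      simp_rw [h1]
      have i1 := hsqi ((hWm K).mono (ℱ.le _)) (hWb K)
      have i2 := (hWDi K).const_mul 2
      have i12 : Integrable (fun ω => W K ω ^ 2 + 2 * (W K ω * D K ω)) P := i1.add i2
      rw [integral_add i12 (hsqi (hDm K) (hM K)), integral_add i1 i2, integral_const_mul,
        hcross, ih, Finset.sum_range_succ]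
      ring
  have hC0 : 0 ≤ C := by simpa using hC 0
  -- The inequality `|w| ≤ 1 + w ^ 2` turns the `L²` bound into the `L¹` bound required for
  -- martingale convergence.
  have hbdd : ∀ K, eLpNorm (W K) 1 P ≤ ((1 + C).toNNReal : NNReal) := by
    intro K
    rw [eLpNorm_one_eq_lintegral_enorm, ← ofReal_integral_norm_eq_lintegral_enorm (hWi K)]
    refine ENNReal.ofReal_le_ofReal ?_
    have i1 := hsqi ((hWm K).mono (ℱ.le _)) (hWb K)
    calc ∫ ω, ‖W K ω‖ ∂P ≤ ∫ ω, (1 + W K ω ^ 2) ∂P := by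
          refine integral_mono (hWi K).norm ((integrable_const _).add i1) fun ω => ?_
          rw [Real.norm_eq_abs, ← sq_abs]
          nlinarith [sq_nonneg (|W K ω| - 1), abs_nonneg (W K ω)]
      _ = 1 + ∫ ω, W K ω ^ 2 ∂P := by
          rw [integral_add (integrable_const _) i1]; simp
      _ ≤ 1 + C := by rw [hsq]; linarith [hC K]
  filter_upwards [hmart.submartingale.ae_tendsto_limitProcess hbdd] with ω hω
  exact ⟨_, hω⟩

/-! ### Conditionally independent samples -/

section Noise

variable {Ω E C : Type*} [MeasurableSpace E]

/-- The σ-algebras generated by `𝒟` (index `none`) and by single samples. -/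
@[reducible] def sampleSigma (𝒟 : MeasurableSpace Ω) (x : ℕ → ℕ → Ω → E) :
    Option (ℕ × ℕ) → MeasurableSpace Ω
  | none => 𝒟
  | some j => MeasurableSpace.comap (x j.1 j.2) inferInstance

/-- The indices of the σ-algebras that are known before step `K`. -/
def knownIndices (K : ℕ) : Set (Option (ℕ × ℕ)) := {o | ∀ j, o = some j → j.1 < K}

theorem sampleSigma_le {𝒟 mΩ : MeasurableSpace Ω} (h𝒟 : 𝒟 ≤ mΩ) {x : ℕ → ℕ → Ω → E}
    (hx : ∀ k i, Measurable (x k i)) (o : Option (ℕ × ℕ)) : sampleSigma 𝒟 x o ≤ mΩ := by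
  cases o with
  | none => exact h𝒟
  | some j => exact (hx j.1 j.2).comap_le

/-- The filtration generated by `𝒟` and the samples of the earlier steps. -/
def sampleFiltration {𝒟 mΩ : MeasurableSpace Ω} (h𝒟 : 𝒟 ≤ mΩ) {x : ℕ → ℕ → Ω → E}
    (hx : ∀ k i, Measurable (x k i)) : Filtration ℕ mΩ where
  seq K := ⨆ o ∈ knownIndices K, sampleSigma 𝒟 x o
  mono' _ _ hKL := biSup_mono fun _ ho j hj => (ho j hj).trans_le hKL
  le' _ := iSup₂_le fun o _ => sampleSigma_le h𝒟 hx o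

variable {𝒟 mΩ : MeasurableSpace Ω} {P : Measure Ω} [IsProbabilityMeasure P] (h𝒟 : 𝒟 ≤ mΩ)
  {x : ℕ → ℕ → Ω → E} (hx : ∀ k i, Measurable (x k i))
  [Countable C] [MeasurableSpace C] [MeasurableSingletonClass C]
  {κ : ℕ → Ω → C} (hκ : ∀ k, Measurable[𝒟] (κ k))
  {μ : C → Measure E} [∀ c, IsProbabilityMeasure (μ c)]
  (hlaw : ∀ (F : Finset (ℕ × ℕ)) (B : ℕ × ℕ → Set E), (∀ j, MeasurableSet (B j)) →
    ∀ A, MeasurableSet[𝒟] A → P (A ∩ ⋂ j ∈ F, x j.1 j.2 ⁻¹' B j) =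
      ∫⁻ ω in A, ∏ j ∈ F, μ (κ j.1 ω) (B j) ∂P)

include hκ hlaw

omit [IsProbabilityMeasure P] [∀ c, IsProbabilityMeasure (μ c)] in
-- On `κ K = c` the laws of the samples of step `K` are constant, so their factors leave the
-- integral; their indices are disjoint from those of earlier steps.
theorem measure_inter_box (h𝒟 : 𝒟 ≤ mΩ) {K : ℕ} (c : C) {F : Finset (ℕ × ℕ)} (hF : ∀ j ∈ F, j.1 < K)
    {B : ℕ × ℕ → Set E} (hB : ∀ j, MeasurableSet (B j)) {A : Set Ω} (hA : MeasurableSet[𝒟] A)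
    (s : Finset ℕ) {t : ℕ → Set E} (ht : ∀ i, MeasurableSet (t i)) :
    P ((A ∩ ⋂ j ∈ F, x j.1 j.2 ⁻¹' B j) ∩ (κ K ⁻¹' {c} ∩ ⋂ i ∈ s, x K i ⁻¹' t i)) =
      (∏ i ∈ s, μ c (t i)) * P ((A ∩ ⋂ j ∈ F, x j.1 j.2 ⁻¹' B j) ∩ κ K ⁻¹' {c}) := by
  classical
  have hAc : MeasurableSet[𝒟] (A ∩ κ K ⁻¹' {c}) := hA.inter (hκ K (measurableSet_singleton c))
  set G : Finset (ℕ × ℕ) := s.image (Prod.mk K) with hG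
  set B' : ℕ × ℕ → Set E := fun j => if j.1 < K then B j else t j.2 with hB'
  have hB'm : ∀ j, MeasurableSet (B' j) := fun j => by
    simp only [hB']; split_ifs
    exacts [hB j, ht j.2]
  have hdisj : Disjoint F G := by
    refine Finset.disjoint_left.2 fun j hj hj' => ?_
    rw [hG, Finset.mem_image] at hj'
    obtain ⟨i, -, rfl⟩ := hj'
    exact lt_irrefl K (hF _ hj)
  have hset : (A ∩ ⋂ j ∈ F, x j.1 j.2 ⁻¹' B j) ∩ (κ K ⁻¹' {c} ∩ ⋂ i ∈ s, x K i ⁻¹' t i) =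
      (A ∩ κ K ⁻¹' {c}) ∩ ⋂ j ∈ F ∪ G, x j.1 j.2 ⁻¹' B' j := by
    ext ω
    simp only [Set.mem_inter_iff, Set.mem_iInter, Finset.mem_union, or_imp, forall_and]
    have h1 : (∀ j ∈ F, ω ∈ x j.1 j.2 ⁻¹' B' j) ↔ ∀ j ∈ F, ω ∈ x j.1 j.2 ⁻¹' B j :=
      forall₂_congr fun j hj => by simp only [hB', if_pos (hF j hj)]
    have h2 : (∀ j ∈ G, ω ∈ x j.1 j.2 ⁻¹' B' j) ↔ ∀ i ∈ s, ω ∈ x K i ⁻¹' t i := by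
      simp only [hG, Finset.forall_mem_image, hB', lt_irrefl, if_false]
    rw [h1, h2]
    tauto
  have hset' : (A ∩ ⋂ j ∈ F, x j.1 j.2 ⁻¹' B j) ∩ κ K ⁻¹' {c} =
      (A ∩ κ K ⁻¹' {c}) ∩ ⋂ j ∈ F, x j.1 j.2 ⁻¹' B j := by
    ext ω; simp only [Set.mem_inter_iff]; tauto
  rw [hset, hset', hlaw _ B' hB'm _ hAc, hlaw F B hB _ hAc]
  have hmeas : ∀ j, Measurable fun ω => μ (κ j.1 ω) (B j) := fun j =>
    (measurable_of_countable fun c => μ c (B j)).comp ((hκ j.1).mono h𝒟 le_rfl)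
  rw [← lintegral_const_mul _ (Finset.measurable_fun_prod _ fun j _ => hmeas j)]
  refine setLIntegral_congr_fun (h𝒟 _ hAc) fun ω hω => ?_
  have hκω : κ K ω = c := hω.2
  show ∏ j ∈ F ∪ G, μ (κ j.1 ω) (B' j) = _ * ∏ j ∈ F, μ (κ j.1 ω) (B j)
  rw [Finset.prod_union hdisj, mul_comm, hG, Finset.prod_image fun _ _ _ _ h => (Prod.mk.inj h).2]
  congr 1
  · exact Finset.prod_congr rfl fun i _ => by simp [hB', hκω]
  · exact Finset.prod_congr rfl fun j hj => by simp only [hB', if_pos (hF j hj)]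

/-- Given the past and `κ K = c`, the samples of step `K` form an i.i.d. sequence. Boxes are
extended twice: in the past by a π-system that generates the filtration, and in the samples by the
uniqueness of infinite product measures. -/
theorem measure_inter_preimage {K : ℕ} (c : C) {A : Set Ω}
    (hA : MeasurableSet[sampleFiltration h𝒟 hx K] A) {B : Set (ℕ → E)} (hB : MeasurableSet B) :
    P ((A ∩ κ K ⁻¹' {c}) ∩ (fun ω i => x K i ω) ⁻¹' B) =
      P (A ∩ κ K ⁻¹' {c}) * Measure.infinitePi (fun _ : ℕ => μ c) B := by
  classical
  have hκm : MeasurableSet (κ K ⁻¹' {c}) := h𝒟 _ (hκ K (measurableSet_singleton c))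
  have hAm : MeasurableSet A := (sampleFiltration h𝒟 hx).le K _ hA
  have hxm : Measurable fun ω i => x K i ω := measurable_pi_iff.2 fun i => hx K i
  have hbox : ∀ (s : Finset ℕ) (t : ℕ → Set E), (∀ i, MeasurableSet (t i)) →
      P (A ∩ (κ K ⁻¹' {c} ∩ ⋂ i ∈ s, x K i ⁻¹' t i)) =
        (∏ i ∈ s, μ c (t i)) * P (A ∩ κ K ⁻¹' {c}) := by
    intro s t ht
    have hsm : MeasurableSet (κ K ⁻¹' {c} ∩ ⋂ i ∈ s, x K i ⁻¹' t i) :=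
      hκm.inter (Finset.measurableSet_biInter _ fun i _ => hx K i (ht i))
    have hfin : ∏ i ∈ s, μ c (t i) ≠ ⊤ := ENNReal.prod_ne_top fun i _ => measure_ne_top _ _
    have hgen : ∀ U ∈ piiUnionInter (fun o => {U | MeasurableSet[sampleSigma 𝒟 x o] U})
        (knownIndices K), P (U ∩ (κ K ⁻¹' {c} ∩ ⋂ i ∈ s, x K i ⁻¹' t i)) =
          (∏ i ∈ s, μ c (t i)) * P (U ∩ κ K ⁻¹' {c}) := by
      rintro _ ⟨J, hJ, f, hf, rfl⟩
      have hB : ∀ j : ℕ × ℕ, ∃ B : Set E, MeasurableSet B ∧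
          (some j ∈ J → x j.1 j.2 ⁻¹' B = f (some j)) := by
        intro j
        by_cases hj : some j ∈ J
        · obtain ⟨B, hB, hBf⟩ := hf _ hj
          exact ⟨B, hB, fun _ => hBf⟩
        · exact ⟨∅, MeasurableSet.empty, fun h => absurd h hj⟩
      choose B hB hBf using hB
      have hA₀ : ∃ A₀ : Set Ω, MeasurableSet[𝒟] A₀ ∧ (⋂ o ∈ J, f o) =
          A₀ ∩ ⋂ j ∈ J.eraseNone, x j.1 j.2 ⁻¹' B j := by
        -- Without a factor from `𝒟` in the finite intersection, the whole space takes its place.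
        refine ⟨if none ∈ J then f none else Set.univ, ?_, ?_⟩
        · split_ifs with h
          · exact hf _ h
          · exact MeasurableSet.univ
        · ext ω
          simp only [Set.mem_iInter, Set.mem_inter_iff, Finset.mem_eraseNone]
          constructor
          · intro h
            refine ⟨?_, fun j hj => ?_⟩
            · split_ifs with h'
              · exact h _ h'
              · trivial
            · rw [hBf j hj]
              exact h _ hj
          · rintro ⟨h1, h2⟩ (_ | j) ho
            · rwa [if_pos ho] at h1
            · rw [← hBf j ho]
              exact h2 j ho
      obtain ⟨A₀, hA₀, hU⟩ := hA₀
      rw [hU]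
      exact measure_inter_box hκ hlaw h𝒟 c
        (fun j hj => hJ (Finset.mem_coe.2 (Finset.mem_eraseNone.1 hj)) j rfl) hB hA₀ s ht
    have h1 : (P.restrict (κ K ⁻¹' {c} ∩ ⋂ i ∈ s, x K i ⁻¹' t i)) A =
        ((∏ i ∈ s, μ c (t i)) • P.restrict (κ K ⁻¹' {c})) A := by
      have hfm : IsFiniteMeasure ((∏ i ∈ s, μ c (t i)) • P.restrict (κ K ⁻¹' {c})) :=
        Measure.smul_finite _ hfin
      refine ext_on_measurableSpace_of_generate_finite mΩ _ (fun U hU => ?_)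
        ((sampleFiltration h𝒟 hx).le K)
        (generateFrom_piiUnionInter_measurableSet (sampleSigma 𝒟 x) (knownIndices K)).symm
        (isPiSystem_piiUnionInter _ (fun o => (sampleSigma 𝒟 x o).isPiSystem_measurableSet) _) ?_ hA
      · have hUm : MeasurableSet U := by
          refine (sampleFiltration h𝒟 hx).le K _ ?_
          exact measurableSet_iSup_of_mem_piiUnionInter _ _ _ hU
        rw [Measure.restrict_apply hUm, Measure.smul_apply, Measure.restrict_apply hUm,
          smul_eq_mul, hgen U hU]
      · have h := hgen Set.univ (by
          refine ⟨∅, by simp, fun _ => Set.univ, by simp, by simp⟩)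
        rwa [Measure.restrict_apply MeasurableSet.univ, Measure.smul_apply,
          Measure.restrict_apply MeasurableSet.univ, smul_eq_mul]
    rwa [Measure.restrict_apply hAm, Measure.smul_apply, Measure.restrict_apply hAm,
      smul_eq_mul] at h1
  by_cases h0 : P (A ∩ κ K ⁻¹' {c}) = 0
  · rw [h0, zero_mul]
    exact measure_mono_null Set.inter_subset_left h0
  -- The event now has positive probability, so the law of the samples on it can be normalised and
  -- compared with the product measure on boxes.
  have hν : (P (A ∩ κ K ⁻¹' {c}))⁻¹ • (P.restrict (A ∩ κ K ⁻¹' {c})).map (fun ω i => x K i ω) =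
      Measure.infinitePi (fun _ : ℕ => μ c) := by
    refine Measure.eq_infinitePi _ fun s t ht => ?_
    have hm : MeasurableSet (Set.pi (s : Set ℕ) t) :=
      MeasurableSet.pi s.countable_toSet fun i _ => ht i
    have hpre : (fun ω i => x K i ω) ⁻¹' Set.pi (s : Set ℕ) t ∩ (A ∩ κ K ⁻¹' {c}) =
        A ∩ (κ K ⁻¹' {c} ∩ ⋂ i ∈ s, x K i ⁻¹' t i) := by
      ext ω
      simp only [Set.mem_inter_iff, Set.mem_preimage, Set.mem_pi, Set.mem_iInter, Finset.mem_coe]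
      tauto
    rw [Measure.smul_apply, Measure.map_apply hxm hm, Measure.restrict_apply (hxm hm), hpre,
      hbox s t ht, smul_eq_mul, mul_comm, mul_assoc, ENNReal.mul_inv_cancel h0 (measure_ne_top _ _),
      mul_one]
  rw [← hν, Measure.smul_apply, Measure.map_apply hxm hB, Measure.restrict_apply (hxm hB),
    smul_eq_mul, ← mul_assoc, ENNReal.mul_inv_cancel h0 (measure_ne_top _ _), one_mul,
    Set.inter_comm]

include h𝒟 hx in
/-- The centred functionals of the samples of the single steps are martingale differences, so
their square summable series converge. -/
theorem ae_exists_tendsto_sum_centered {h : ℕ → C → (ℕ → E) → ℝ} {M : ℝ}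
    (hh : ∀ k c, Measurable (h k c)) (hM : ∀ k c y, |h k c y| ≤ M) {lam : ℕ → ℝ}
    (hlam : Summable fun k => lam k ^ 2) :
    ∀ᵐ ω ∂P, ∃ L, Tendsto (fun K => ∑ k ∈ Finset.range K, lam k * (h k (κ k ω) (fun i => x k i ω) -
      ∫ y, h k (κ k ω) y ∂Measure.infinitePi (fun _ : ℕ => μ (κ k ω)))) atTop (𝓝 L) := by
  have hle : ∀ K o, o ∈ knownIndices K → sampleSigma 𝒟 x o ≤ sampleFiltration h𝒟 hx K :=
    fun K o ho => le_iSup₂ (f := fun o (_ : o ∈ knownIndices K) => sampleSigma 𝒟 x o) o ho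
  have hκℱ : ∀ k K, Measurable[sampleFiltration h𝒟 hx K] (κ k) := fun k K =>
    (hκ k).mono (hle K none fun j hj => by simp at hj) le_rfl
  have hxℱ : ∀ K, Measurable[sampleFiltration h𝒟 hx (K + 1)] fun ω i => x K i ω := fun K =>
    @measurable_pi_lambda _ _ _ (sampleFiltration h𝒟 hx (K + 1)) _ _ fun i =>
      (comap_measurable (x K i)).mono
      (hle (K + 1) (some (K, i)) fun j hj => by
        rw [← Option.some_inj.1 hj]; exact Nat.lt_succ_self K) le_rfl
  have hxm : ∀ K, Measurable fun ω i => x K i ω := fun K => measurable_pi_iff.2 fun i => hx K i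
  set m : ℕ → C → ℝ := fun k c => ∫ y, h k c y ∂Measure.infinitePi (fun _ : ℕ => μ c) with hm
  have hmM : ∀ k c, |m k c| ≤ M := fun k c => by
    have := norm_integral_le_of_norm_le_const (μ := Measure.infinitePi (fun _ : ℕ => μ c))
      (f := h k c) (C := M) (Eventually.of_forall fun y => hM k c y)
    simpa using this
  set f : ℕ → Ω → ℝ := fun k ω => h k (κ k ω) (fun i => x k i ω) - m k (κ k ω) with hf
  have hfM : ∀ k ω, |f k ω| ≤ 2 * M := fun k ω =>
    (abs_sub _ _).trans (by linarith [hM k (κ k ω) (fun i => x k i ω), hmM k (κ k ω)])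
  have hfm : ∀ k, Measurable[sampleFiltration h𝒟 hx (k + 1)] (f k) := by
    intro k
    have hg : Measurable fun z : C × (ℕ → E) => h k z.1 z.2 - m k z.1 :=
      measurable_from_prod_countable_right fun c => (hh k c).sub_const (m k c)
    exact hg.comp ((hκℱ k (k + 1)).prodMk (hxℱ k))
  have hfi : ∀ k, Integrable (f k) P := fun k =>
    Integrable.of_bound (((hfm k).mono ((sampleFiltration h𝒟 hx).le _) le_rfl).aestronglyMeasurable)
      (2 * M) (Eventually.of_forall fun ω => hfM k ω)
  -- The event is cut along the countably many values of `κ k`; on each piece the samples have the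
  -- product law, whose mean was subtracted.
  have hf0 : ∀ k A, MeasurableSet[sampleFiltration h𝒟 hx k] A → ∫ ω in A, f k ω ∂P = 0 := by
    intro k A hA
    have hAm : MeasurableSet A := (sampleFiltration h𝒟 hx).le k _ hA
    have hκm : ∀ c, MeasurableSet (κ k ⁻¹' {c}) := fun c => h𝒟 _ (hκ k (measurableSet_singleton c))
    have hAU : A = ⋃ c, A ∩ κ k ⁻¹' {c} := by ext ω; simp
    rw [hAU, integral_iUnion (fun c => hAm.inter (hκm c)) _ (hfi k).integrableOn]
    · refine (tsum_congr fun c => ?_).trans tsum_zero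
      have hmap : (P.restrict (A ∩ κ k ⁻¹' {c})).map (fun ω i => x k i ω) =
          P (A ∩ κ k ⁻¹' {c}) • Measure.infinitePi (fun _ : ℕ => μ c) := by
        ext B hB
        rw [Measure.map_apply (hxm k) hB, Measure.restrict_apply (hxm k hB), Set.inter_comm,
          measure_inter_preimage h𝒟 hx hκ hlaw c hA hB, Measure.smul_apply, smul_eq_mul]
      have hi : Integrable (h k c) ((P.restrict (A ∩ κ k ⁻¹' {c})).map (fun ω i => x k i ω)) := by
        rw [hmap]
        exact (Integrable.of_bound (hh k c).aestronglyMeasurable M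
          (Eventually.of_forall fun y => hM k c y)).smul_measure (measure_ne_top _ _)
      have hcongr : ∫ ω in A ∩ κ k ⁻¹' {c}, f k ω ∂P =
          ∫ ω in A ∩ κ k ⁻¹' {c}, (h k c (fun i => x k i ω) - m k c) ∂P :=
        setIntegral_congr_fun (hAm.inter (hκm c)) fun ω hω => by
          simp only [hf, show κ k ω = c from hω.2]
      have hic : Integrable (fun ω => h k c (fun i => x k i ω)) (P.restrict (A ∩ κ k ⁻¹' {c})) :=
        hi.comp_measurable (hxm k)
      rw [hcongr, integral_sub hic (integrable_const _),
        ← integral_map (hxm k).aemeasurable (f := h k c) (hh k c).aestronglyMeasurable, hmap,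
        integral_smul_measure, setIntegral_const]
      simp [hm, Measure.real]
    · intro c c' hcc
      refine Set.disjoint_left.2 fun ω hω hω' => hcc ?_
      rw [← show κ k ω = c from hω.2, ← show κ k ω = c' from hω'.2]
  have hD := ae_exists_tendsto_sum_of_setIntegral_eq_zero (P := P) (sampleFiltration h𝒟 hx)
    (D := fun k ω => lam k * f k ω) (fun k => ((hfm k).const_mul (lam k)).stronglyMeasurable)
    (M := fun k => |lam k| * (2 * M))
    (fun k ω => by rw [abs_mul]; exact mul_le_mul_of_nonneg_left (hfM k ω) (abs_nonneg _))
    (fun k A hA => by rw [integral_const_mul, hf0 k A hA, mul_zero])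
    (C := (∑' k, lam k ^ 2) * (2 * M) ^ 2) (fun K => by
      have h1 : ∀ k, ∫ ω, (lam k * f k ω) ^ 2 ∂P ≤ lam k ^ 2 * (2 * M) ^ 2 := fun k => by
        have h2 : ∀ ω, (lam k * f k ω) ^ 2 ≤ lam k ^ 2 * (2 * M) ^ 2 := fun ω => by
          rw [mul_pow, ← sq_abs (f k ω)]
          have := hfM k ω
          gcongr
        have := integral_mono_of_nonneg (μ := P)
          (Eventually.of_forall fun ω => sq_nonneg (lam k * f k ω)) (integrable_const _)
          (Eventually.of_forall h2)
        simpa using this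
      refine (Finset.sum_le_sum fun k _ => h1 k).trans ?_
      rw [← Finset.sum_mul]
      exact mul_le_mul_of_nonneg_right (hlam.sum_le_tsum _ fun _ _ => sq_nonneg _) (sq_nonneg _))
  exact hD

end Noise

/-! ### Means of independent samples -/

section EmpiricalMean

variable {E : Type*} [MeasurableSpace E] {Y : E → ℝ} {M : ℝ}

omit [MeasurableSpace E] in
theorem abs_empMean_sub_le (Y : E → ℝ) {N : ℕ} (hN : 1 ≤ N) (y : ℕ → E) (a : ℝ) :
    |empMean Y N y - a| ≤ (N : ℝ)⁻¹ * ∑ i ∈ Finset.range N, |Y (y i) - a| := by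
  have hN0 : (0 : ℝ) < N := by exact_mod_cast hN
  have h : empMean Y N y - a = (N : ℝ)⁻¹ * ∑ i ∈ Finset.range N, (Y (y i) - a) := by
    rw [empMean, Finset.sum_sub_distrib, mul_sub]
    simp [hN0.ne']
  rw [h, abs_mul, abs_of_pos (inv_pos.2 hN0)]
  exact mul_le_mul_of_nonneg_left (Finset.abs_sum_le_sum_abs _ _) (inv_pos.2 hN0).le

omit [MeasurableSpace E] in
theorem abs_empMean_le (hM : ∀ z, |Y z| ≤ M) (hM0 : 0 ≤ M) (N : ℕ) (y : ℕ → E) :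
    |empMean Y N y| ≤ M := by
  rcases Nat.eq_zero_or_pos N with rfl | hN
  · simpa [empMean] using hM0
  · have hN0 : (0 : ℝ) < N := by exact_mod_cast hN
    have h := abs_empMean_sub_le Y hN y 0
    simp only [sub_zero] at h
    refine h.trans ?_
    rw [inv_mul_le_iff₀ hN0]
    exact (Finset.sum_le_sum fun i _ => hM (y i)).trans (by simp)

theorem measurable_empMean (hY : Measurable Y) (N : ℕ) : Measurable (empMean Y N) := by
  unfold empMean
  fun_prop

variable (μ : Measure E) [IsProbabilityMeasure μ]

theorem integral_infinitePi_eval {f : E → ℝ} (hf : Measurable f) (i : ℕ) :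
    ∫ y, f (y i) ∂Measure.infinitePi (fun _ : ℕ => μ) = ∫ z, f z ∂μ := by
  have h := Measure.infinitePi_map_eval (fun _ : ℕ => μ) i
  conv_rhs => rw [← h]
  rw [integral_map (measurable_pi_apply i).aemeasurable hf.aestronglyMeasurable]

/-- The triangle inequality alone, uniformly in `N`: this serves laws that concentrate while the
sample size may stay bounded. -/
theorem integral_abs_empMean_sub_le (hY : Measurable Y) (hM : ∀ z, |Y z| ≤ M) {N : ℕ} (hN : 1 ≤ N)
    (a : ℝ) : ∫ y, |empMean Y N y - a| ∂Measure.infinitePi (fun _ : ℕ => μ) ≤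
      ∫ z, |Y z - a| ∂μ := by
  have hN0 : (0 : ℝ) < N := by exact_mod_cast hN
  have hi : ∀ i, Integrable (fun y : ℕ → E => |Y (y i) - a|) (Measure.infinitePi (fun _ : ℕ => μ)) :=
    fun i => Integrable.of_bound
      (((hY.comp (measurable_pi_apply i)).sub_const a).norm).aestronglyMeasurable (M + |a|)
      (Eventually.of_forall fun y => by
      rw [Real.norm_eq_abs, abs_abs]
      exact (abs_sub _ _).trans (by linarith [hM (y i)]))
  calc _ ≤ ∫ y, (N : ℝ)⁻¹ * ∑ i ∈ Finset.range N, |Y (y i) - a|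
        ∂Measure.infinitePi (fun _ : ℕ => μ) :=
        integral_mono_of_nonneg (Eventually.of_forall fun y => abs_nonneg _)
          ((integrable_finsetSum _ fun i _ => hi i).const_mul _)
          (Eventually.of_forall fun y => abs_empMean_sub_le Y hN y a)
    _ = ∫ z, |Y z - a| ∂μ := by
        rw [integral_const_mul, integral_finsetSum _ fun i _ => hi i]
        simp_rw [integral_infinitePi_eval μ (f := fun z => |Y z - a|) (hY.sub_const a).norm]
        simp [hN0.ne']

/-- The variance of the mean is at most `M ^ 2 / N` by independence: this serves a fixed law with
growing sample size. -/
theorem integral_abs_empMean_sub_integral_le (hY : Measurable Y) (hM : ∀ z, |Y z| ≤ M)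
    {N : ℕ} (hN : 1 ≤ N) :
    ∫ y, |empMean Y N y - ∫ z, Y z ∂μ| ∂Measure.infinitePi (fun _ : ℕ => μ) ≤
      (M ^ 2 + 1) / 2 * (√N)⁻¹ := by
  have hN0 : (0 : ℝ) < N := by exact_mod_cast hN
  obtain ⟨z₀⟩ : Nonempty E := nonempty_of_isProbabilityMeasure μ
  have hM0 : 0 ≤ M := (abs_nonneg _).trans (hM z₀)
  set K := Measure.infinitePi (fun _ : ℕ => μ) with hK
  have hX : ∀ i : ℕ, MemLp (fun y : ℕ → E => Y (y i)) 2 K := fun i =>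
    MemLp.of_bound (hY.comp (measurable_pi_apply i)).aestronglyMeasurable M
      (Eventually.of_forall fun y => hM (y i))
  have hmean : ∫ y, empMean Y N y ∂K = ∫ z, Y z ∂μ := by
    unfold empMean
    rw [integral_const_mul, integral_finsetSum _ fun i _ => (hX i).integrable (by norm_num)]
    simp_rw [hK, integral_infinitePi_eval μ hY]
    simp [hN0.ne']
  have hvar1 : ∀ i : ℕ, ProbabilityTheory.variance (fun y : ℕ → E => Y (y i)) K ≤ M ^ 2 := fun i => by
    have := ProbabilityTheory.variance_le_sq_of_bounded (μ := K) (a := -M) (b := M)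
      (X := fun y : ℕ → E => Y (y i)) (Eventually.of_forall fun y => abs_le.1 (hM (y i)))
      (hY.comp (measurable_pi_apply i)).aemeasurable
    refine this.trans (le_of_eq (by ring))
  have hind : ProbabilityTheory.iIndepFun (fun (i : ℕ) (y : ℕ → E) => Y (y i)) K :=
    ProbabilityTheory.iIndepFun_infinitePi fun _ => hY
  have hvar : ProbabilityTheory.variance (empMean Y N) K ≤ M ^ 2 * (N : ℝ)⁻¹ := by
    have h1 : empMean Y N = fun y => (N : ℝ)⁻¹ *
        (∑ i ∈ Finset.range N, fun y : ℕ → E => Y (y i)) y := by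
      ext y; simp [empMean]
    rw [h1, ProbabilityTheory.variance_const_mul,
      ProbabilityTheory.IndepFun.variance_sum (fun i _ => hX i)
        fun i _ j _ hij => hind.indepFun hij]
    calc _ ≤ ((N : ℝ)⁻¹) ^ 2 * ∑ i ∈ Finset.range N, M ^ 2 := by
          gcongr with i _
          exact hvar1 i
      _ = _ := by
          rw [Finset.sum_const, Finset.card_range, nsmul_eq_mul]
          field_simp
  rw [ProbabilityTheory.variance_eq_integral (measurable_empMean hY N).aemeasurable, hmean] at hvar
  have hb : ∀ y : ℕ → E, |empMean Y N y - ∫ z, Y z ∂μ| ≤ M + |∫ z, Y z ∂μ| := fun y =>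
    (abs_sub _ _).trans (by linarith [abs_empMean_le hM hM0 N y])
  have hmm := measurable_empMean hY N
  have hs : 0 < √(N : ℝ) := Real.sqrt_pos.2 hN0
  have hi2 : Integrable (fun y : ℕ → E => (empMean Y N y - ∫ z, Y z ∂μ) ^ 2) K :=
    Integrable.of_bound (by fun_prop) ((M + |∫ z, Y z ∂μ|) ^ 2) (Eventually.of_forall fun y => by
      rw [Real.norm_eq_abs, abs_pow]
      exact pow_le_pow_left₀ (abs_nonneg _) (hb y) 2)
  -- Young's inequality `u ≤ √N / 2 * u ^ 2 + (√N)⁻¹ / 2`, with weights that balance the variance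
  -- bound.
  calc _ ≤ ∫ y, (√N / 2 * (empMean Y N y - ∫ z, Y z ∂μ) ^ 2 + (√N)⁻¹ / 2) ∂K := by
        refine integral_mono_of_nonneg (Eventually.of_forall fun y => abs_nonneg _)
          ((hi2.const_mul _).add (integrable_const _)) (Eventually.of_forall fun y => ?_)
        show |empMean Y N y - ∫ z, Y z ∂μ| ≤
          √N / 2 * (empMean Y N y - ∫ z, Y z ∂μ) ^ 2 + (√N)⁻¹ / 2
        rw [← sq_abs]
        set u := |empMean Y N y - ∫ z, Y z ∂μ|
        have h1 : √N * (√N)⁻¹ = 1 := mul_inv_cancel₀ hs.ne'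
        have h2 : √N / 2 * u ^ 2 + (√N)⁻¹ / 2 - u = √N / 2 * (u - (√N)⁻¹) ^ 2 := by
          linear_combination (u - (√N)⁻¹ / 2) * h1
        have h3 : 0 ≤ √N / 2 * (u - (√N)⁻¹) ^ 2 := by positivity
        linarith
    _ = √N / 2 * ∫ y, (empMean Y N y - ∫ z, Y z ∂μ) ^ 2 ∂K + (√N)⁻¹ / 2 := by
        rw [integral_add (hi2.const_mul _) (integrable_const _), integral_const_mul]
        simp
    _ ≤ √N / 2 * (M ^ 2 * (N : ℝ)⁻¹) + (√N)⁻¹ / 2 := by gcongr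
    _ = _ := by
        have : (N : ℝ)⁻¹ = (√N)⁻¹ * (√N)⁻¹ := by rw [← mul_inv, Real.mul_self_sqrt hN0.le]
        rw [this]
        field_simp

end EmpiricalMean

/-! ### Enumeration of the pairs `(t, i)` with `1 ≤ t` and `i < m t` -/

/-- Number of pairs in the stages before stage `t`. -/
def cumul (m : ℕ → ℕ) (t : ℕ) : ℕ := ∑ τ ∈ Finset.Ico 1 t, m τ

theorem cumul_one (m : ℕ → ℕ) : cumul m 1 = 0 := by simp [cumul]

theorem cumul_succ (m : ℕ → ℕ) {t : ℕ} (ht : 1 ≤ t) : cumul m (t + 1) = cumul m t + m t :=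
  Finset.sum_Ico_succ_top ht m

theorem cumul_mono (m : ℕ → ℕ) : Monotone (cumul m) := fun _ _ h =>
  Finset.sum_le_sum_of_subset (Finset.Ico_subset_Ico_right h)

section Enumeration

variable {m : ℕ → ℕ}

theorem exists_lt_cumul (hm : ∀ t, ∃ t', t ≤ t' ∧ 1 ≤ m t') (k : ℕ) :
    ∃ t, k < cumul m (t + 1) := by
  induction k with
  | zero =>
    obtain ⟨t, ht, h⟩ := hm 1
    exact ⟨t, by rw [cumul_succ m ht]; omega⟩
  | succ k ih =>
    obtain ⟨t, ht⟩ := ih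
    obtain ⟨t', ht', h⟩ := hm (t + 1)
    refine ⟨t', ?_⟩
    have := cumul_mono m ht'
    rw [cumul_succ m (by omega)]
    omega

theorem tendsto_cumul (hm : ∀ t, ∃ t', t ≤ t' ∧ 1 ≤ m t') :
    Tendsto (fun t => cumul m (t + 1)) atTop atTop := by
  refine tendsto_atTop_mono' _ (EventuallyLE.refl _ _) (tendsto_atTop_atTop.2 fun k => ?_)
  obtain ⟨t, ht⟩ := exists_lt_cumul hm k
  exact ⟨t, fun t' h => ht.le.trans (cumul_mono m (by omega))⟩

variable (hm : ∀ t, ∃ t', t ≤ t' ∧ 1 ≤ m t')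

/-- The stage of the `k`-th pair. -/
def stageOf (k : ℕ) : ℕ := Nat.find (exists_lt_cumul hm k)

/-- The position of the `k`-th pair in its stage. -/
def locOf (k : ℕ) : ℕ := k - cumul m (stageOf hm k)

theorem lt_cumul_stageOf (k : ℕ) : k < cumul m (stageOf hm k + 1) :=
  Nat.find_spec (exists_lt_cumul hm k)

theorem one_le_stageOf (k : ℕ) : 1 ≤ stageOf hm k := by
  by_contra! h
  have h1 := lt_cumul_stageOf hm k
  rw [Nat.lt_one_iff.1 h, cumul_one] at h1
  omega

theorem cumul_stageOf_le (k : ℕ) : cumul m (stageOf hm k) ≤ k := by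
  have h1 := one_le_stageOf hm k
  have h := Nat.find_min (exists_lt_cumul hm k) (show stageOf hm k - 1 < stageOf hm k by omega)
  rwa [Nat.sub_add_cancel h1, not_lt] at h

theorem cumul_add_locOf (k : ℕ) : cumul m (stageOf hm k) + locOf hm k = k :=
  Nat.add_sub_cancel' (cumul_stageOf_le hm k)

theorem locOf_lt (k : ℕ) : locOf hm k < m (stageOf hm k) := by
  have h1 := lt_cumul_stageOf hm k
  rw [cumul_succ m (one_le_stageOf hm k)] at h1
  have := cumul_add_locOf hm k
  omega

theorem stageOf_cumul_add {t i : ℕ} (ht : 1 ≤ t) (hi : i < m t) :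
    stageOf hm (cumul m t + i) = t := by
  have h1 := lt_cumul_stageOf hm (cumul m t + i)
  have h2 := cumul_stageOf_le hm (cumul m t + i)
  have h3 := cumul_succ m ht
  rcases lt_trichotomy (stageOf hm (cumul m t + i)) t with h | h | h
  · have := cumul_mono m (show stageOf hm (cumul m t + i) + 1 ≤ t by omega)
    omega
  · exact h
  · have := cumul_mono m (show t + 1 ≤ stageOf hm (cumul m t + i) by omega)
    omega

theorem locOf_cumul_add {t i : ℕ} (ht : 1 ≤ t) (hi : i < m t) :
    locOf hm (cumul m t + i) = i := by
  have h := cumul_add_locOf hm (cumul m t + i)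
  rw [stageOf_cumul_add hm ht hi] at h
  omega

theorem stageOf_mono : Monotone (stageOf hm) := fun _ l hkl =>
  Nat.find_min' _ (hkl.trans_lt (lt_cumul_stageOf hm l))

theorem tendsto_stageOf : Tendsto (stageOf hm) atTop atTop := by
  refine tendsto_atTop_atTop.2 fun t => ⟨cumul m (t + 1), fun k hk => ?_⟩
  by_contra! h
  have h1 := lt_cumul_stageOf hm k
  have := cumul_mono m (show stageOf hm k + 1 ≤ t + 1 by omega)
  omega

theorem stageOf_locOf_injective : Function.Injective fun k => (stageOf hm k, locOf hm k) := by
  intro k l h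
  have h1 := (Prod.mk.inj h).1
  have h2 := (Prod.mk.inj h).2
  rw [← cumul_add_locOf hm k, ← cumul_add_locOf hm l, h1, h2]

end Enumeration

/-! ### The algorithm along the enumerations of updates and observations -/

section Flat

variable {S A : Type*} [Fintype S] [DecidableEq S] [DecidableEq A]

/-- The `k`-th Q-learning iterate, counted across all stages. -/
noncomputable def qSeq (I : Input S A) (hm : ∀ t, ∃ t', t ≤ t' ∧ 1 ≤ I.m t') (d : ℕ → ℕ → S × A × S)
    (x : Draw S A → S → ℝ) : ℕ → S → A → ℝ
  | 0 => 0
  | k + 1 => fun s a => (1 - I.lr (k + 1)) * qSeq I hm d x k s a +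
      I.lr (k + 1) * riskEstimator I.ρ I.α (sampleSize I d (stageOf hm k) s a)
        (fun i => backup I (maxQ (qSeq I hm d x k)) s a
          (x (stageOf hm k, locOf hm k + 1, s, a, i)))

theorem qSeq_succ (I : Input S A) (hm : ∀ t, ∃ t', t ≤ t' ∧ 1 ≤ I.m t') (d : ℕ → ℕ → S × A × S)
    (x : Draw S A → S → ℝ) (k : ℕ) (s : S) (a : A) :
    qSeq I hm d x (k + 1) s a = (1 - I.lr (k + 1)) * qSeq I hm d x k s a +
      I.lr (k + 1) * riskEstimator I.ρ I.α (sampleSize I d (stageOf hm k) s a)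
        (fun i => backup I (maxQ (qSeq I hm d x k)) s a
          (x (stageOf hm k, locOf hm k + 1, s, a, i))) := rfl

/-- Updates are enumerated from zero, while learning rates and updates within a stage are numbered
from one; hence the shifts by one in `qSeq`. -/
theorem stageUpdate_eq_qSeq (I : Input S A) (hm : ∀ t, ∃ t', t ≤ t' ∧ 1 ≤ I.m t')
    (d : ℕ → ℕ → S × A × S) (x : Draw S A → S → ℝ) {t : ℕ} (ht : 1 ≤ t) {l : ℕ} (hl : l ≤ I.m t) :
    stageUpdate I d x t (qSeq I hm d x (cumul I.m t)) l = qSeq I hm d x (cumul I.m t + l) := by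
  induction l with
  | zero => rfl
  | succ l ih =>
    have h1 := stageOf_cumul_add hm ht (show l < I.m t by omega)
    have h2 := locOf_cumul_add hm ht (show l < I.m t by omega)
    rw [stageUpdate, ih (by omega)]
    funext s a
    rw [← add_assoc, ← add_assoc, qSeq_succ, h1, h2]
    rfl

theorem qStage_eq_qSeq (I : Input S A) (hm : ∀ t, ∃ t', t ≤ t' ∧ 1 ≤ I.m t')
    (d : ℕ → ℕ → S × A × S) (x : Draw S A → S → ℝ) (t : ℕ) :
    qStage I d x t = qSeq I hm d x (cumul I.m (t + 1)) := by
  induction t with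
  | zero => rw [cumul_one]; rfl
  | succ t ih =>
    rw [qStage, ih, stageUpdate_eq_qSeq I hm d x (by omega) le_rfl,
      ← cumul_succ I.m (show 1 ≤ t + 1 by omega)]

variable (I : Input S A) (hn : ∀ t, ∃ t', t ≤ t' ∧ 1 ≤ I.n t')

/-- The `k`-th observation, counted across all stages. -/
def obsSeq (d : ℕ → ℕ → S × A × S) (k : ℕ) : S × A × S := d (stageOf hn k) (locOf hn k)

omit [Fintype S] [DecidableEq S] [DecidableEq A] in
theorem obsSeq_cumul_add (d : ℕ → ℕ → S × A × S) {t i : ℕ} (ht : 1 ≤ t) (hi : i < I.n t) :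
    obsSeq I hn d (cumul I.n t + i) = d t i := by
  rw [obsSeq, stageOf_cumul_add hn ht hi, locOf_cumul_add hn ht hi]

omit [Fintype S] in
-- The posterior is determined by finitely many integer counts, so it takes countably many values
-- and is measurable in the data.
theorem posterior_eq_add_count (d : ℕ → ℕ → S × A × S) (t : ℕ) (s : S) (a : A) (s' : S) :
    posterior I d t s a s' =
      I.prior s a s' + Nat.count (fun k => obsSeq I hn d k = (s, a, s')) (cumul I.n (t + 1)) := by
  induction t with
  | zero => simp [posterior, cumul_one]
  | succ t ih =>
    show posterior I d t s a s' + _ = _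
    rw [ih, cumul_succ I.n (show 1 ≤ t + 1 by omega), Nat.count_add, add_assoc,
      ← Nat.cast_add]
    congr 3
    rw [Nat.count_eq_card_filter_range]
    congr 1
    refine Finset.filter_congr fun i hi => ?_
    rw [obsSeq_cumul_add I hn d (by omega) (Finset.mem_range.1 hi)]

/-- The sample size of the pair `(s, a)` after `k` observations. -/
def sizeSeq (d : ℕ → ℕ → S × A × S) (s : S) (a : A) : ℕ → ℕ
  | 0 => I.minSize
  | k + 1 =>
    if (obsSeq I hn d k).1 = s ∧ (obsSeq I hn d k).2.1 = a then
      max (sizeSeq d s a k - 1) I.minSize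
    else sizeSeq d s a k + 1

omit [Fintype S] in
theorem sampleSize_eq_sizeSeq (d : ℕ → ℕ → S × A × S) (t : ℕ) (s : S) (a : A) :
    sampleSize I d t s a = sizeSeq I hn d s a (cumul I.n (t + 1)) := by
  induction t with
  | zero => rw [cumul_one]; rfl
  | succ t ih =>
    have key : ∀ i ≤ I.n (t + 1), batchSize I d (t + 1) s a (sizeSeq I hn d s a (cumul I.n (t + 1))) i
        = sizeSeq I hn d s a (cumul I.n (t + 1) + i) := by
      intro i hi
      induction i with
      | zero => rfl
      | succ i ihi =>
        rw [batchSize, ihi (by omega), ← add_assoc, sizeSeq,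
          obsSeq_cumul_add I hn d (by omega) (show i < I.n (t + 1) by omega)]
    show batchSize I d (t + 1) s a (sampleSize I d t s a) (I.n (t + 1)) = _
    rw [ih, key _ le_rfl, ← cumul_succ I.n (show 1 ≤ t + 1 by omega)]

omit [Fintype S] in
theorem minSize_le_sizeSeq (d : ℕ → ℕ → S × A × S) (s : S) (a : A) (k : ℕ) :
    I.minSize ≤ sizeSeq I hn d s a k := by
  induction k with
  | zero => exact le_rfl
  | succ k ih =>
    rw [sizeSeq]
    split_ifs
    · exact le_max_right _ _
    · omega

omit [Fintype S] in
-- After the last visit of the pair, every observation belongs to another pair and adds one sample.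
theorem tendsto_sizeSeq (d : ℕ → ℕ → S × A × S) (s : S) (a : A)
    (h : ∀ᶠ k in atTop, ¬ ((obsSeq I hn d k).1 = s ∧ (obsSeq I hn d k).2.1 = a)) :
    Tendsto (sizeSeq I hn d s a) atTop atTop := by
  obtain ⟨K, hK⟩ := eventually_atTop.1 h
  have h1 : ∀ j, j ≤ sizeSeq I hn d s a (K + j) := by
    intro j
    induction j with
    | zero => exact Nat.zero_le _
    | succ j ih =>
      rw [← add_assoc, sizeSeq, if_neg (hK (K + j) (by omega))]
      omega
  refine tendsto_atTop_atTop.2 fun b => ⟨K + b, fun k hk => ?_⟩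
  have := h1 (k - K)
  rw [Nat.add_sub_cancel' (by omega)] at this
  omega

omit [Fintype S] [DecidableEq S] [DecidableEq A] in
theorem totalCount_eq_encard (d : ℕ → ℕ → S × A × S) (s : S) (a : A) (s' : S) :
    totalCount I d s a s' = {k | obsSeq I hn d k = (s, a, s')}.encard := by
  rw [totalCount, ← (stageOf_locOf_injective hn).encard_image]
  congr 1
  ext ⟨t, i⟩
  constructor
  · rintro ⟨h1, h2, h3⟩
    refine ⟨cumul I.n t + i, ?_, ?_⟩
    · show obsSeq I hn d (cumul I.n t + i) = _
      rw [obsSeq_cumul_add I hn d h1 h2]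
      exact h3
    · show (stageOf hn (cumul I.n t + i), locOf hn (cumul I.n t + i)) = _
      rw [stageOf_cumul_add hn h1 h2, locOf_cumul_add hn h1 h2]
  · rintro ⟨k, hk, he⟩
    obtain ⟨rfl, rfl⟩ := Prod.mk.inj he
    exact ⟨one_le_stageOf hn k, locOf_lt hn k, hk⟩

/-- Finitely many occurrences: the counting function is eventually equal to the total count. -/
theorem eventually_count_eq {p : ℕ → Prop} [DecidablePred p] (h : {k | p k}.encard ≠ ⊤) :
    ∀ᶠ k in atTop, Nat.count p k = {k | p k}.encard.toNat := by
  have hfin : {k | p k}.Finite := Set.encard_ne_top_iff.1 h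
  obtain ⟨b, hb⟩ := hfin.bddAbove
  filter_upwards [eventually_gt_atTop b] with k hk
  rw [← Set.ncard_def, Set.ncard_eq_toFinset_card _ hfin, Nat.count_eq_card_filter_range]
  congr 1
  ext j
  simp only [Finset.mem_filter, Finset.mem_range, Set.Finite.mem_toFinset]
  exact ⟨fun h => h.2, fun h => ⟨(hb h).trans_lt hk, h⟩⟩

theorem tendsto_count {p : ℕ → Prop} [DecidablePred p] (h : {k | p k}.encard = ⊤) :
    Tendsto (Nat.count p) atTop atTop := by
  have hinf : {k | p k}.Infinite := Set.encard_eq_top_iff.1 h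
  refine tendsto_atTop_atTop_of_monotone (Nat.count_monotone p) fun b => ⟨Nat.nth p b, ?_⟩
  exact (Nat.count_nth_of_infinite hinf b).ge

end Flat

/-! ### Consistency of the posterior means -/

section Data

theorem comap_top_le {Ω β : Type*} [Countable β] {mΩ : MeasurableSpace Ω} {f : Ω → β}
    (hf : ∀ z, MeasurableSet (f ⁻¹' {z})) : MeasurableSpace.comap f ⊤ ≤ mΩ := by
  rintro _ ⟨B, -, rfl⟩
  rw [← Set.biUnion_preimage_singleton]
  exact MeasurableSet.biUnion B.to_countable fun z _ => hf z

variable {S A Ω : Type*} (I : Input S A) (hn : ∀ t, ∃ t', t ≤ t' ∧ 1 ≤ I.n t')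
  (obs : ℕ → ℕ → Ω → S × A × S)

/-- The `k`-th observation as a random variable. -/
noncomputable def obsAt (k : ℕ) (ω : Ω) : S × A × S := obsSeq I hn (fun t i => obs t i ω) k

/-- The σ-algebra of the first `K` observations. -/
@[reducible] noncomputable def obsSigma (K : ℕ) : MeasurableSpace Ω :=
  ⨆ (j : ℕ) (_ : j < K), MeasurableSpace.comap (obsAt I hn obs j) ⊤

theorem obsSigma_mono : Monotone (obsSigma I hn obs) := fun _ _ h =>
  iSup₂_le fun j hj => le_iSup₂_of_le j (hj.trans_le h) le_rfl

theorem obsSigma_le_allData (K : ℕ) : obsSigma I hn obs K ≤ allData I obs :=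
  iSup₂_le fun j _ => le_iSup₂_of_le (stageOf hn j) (locOf hn j)
    (le_iSup_of_le ⟨one_le_stageOf hn j, locOf_lt hn j⟩ le_rfl)

theorem obsSigma_le_pastData (k : ℕ) :
    obsSigma I hn obs k ≤ pastData I obs (stageOf hn k) (locOf hn k) := by
  refine iSup₂_le fun j hj => le_iSup₂_of_le (stageOf hn j) (locOf hn j)
    (le_iSup_of_le ⟨one_le_stageOf hn j, locOf_lt hn j, ?_⟩ le_rfl)
  rcases (stageOf_mono hn hj.le).lt_or_eq with h | h
  · exact Or.inl h
  · refine Or.inr ⟨h, ?_⟩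
    have h1 := cumul_add_locOf hn j
    have h2 := cumul_add_locOf hn k
    rw [h] at h1
    omega

theorem allData_le [Finite S] [Finite A] {mΩ : MeasurableSpace Ω}
    (hobs_meas : ∀ t i, 1 ≤ t → i < I.n t → ∀ z, MeasurableSet (obs t i ⁻¹' {z})) :
    allData I obs ≤ mΩ :=
  iSup₂_le fun t i => iSup_le fun h => comap_top_le (hobs_meas t i h.1 h.2)

theorem measurable_comp_obsAt {β : Type*} [MeasurableSpace β] (f : S × A × S → β) {j K : ℕ}
    (hj : j < K) : Measurable[obsSigma I hn obs K] fun ω => f (obsAt I hn obs j ω) := by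
  have h : Measurable[MeasurableSpace.comap (obsAt I hn obs j) ⊤, ⊤] (obsAt I hn obs j) :=
    @comap_measurable _ _ ⊤ _
  exact (@Measurable.comp _ _ _ _ ⊤ _ _ _ measurable_from_top h).mono
    (le_iSup₂ (f := fun j (_ : j < K) => MeasurableSpace.comap (obsAt I hn obs j) ⊤) j hj) le_rfl

theorem measurable_count (p : S × A × S → Prop) [DecidablePred p] (k : ℕ) :
    Measurable[obsSigma I hn obs k] fun ω => Nat.count (fun j => p (obsAt I hn obs j ω)) k := by
  induction k with
  | zero => simp only [Nat.count_zero]; exact measurable_const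
  | succ k ih =>
    simp only [Nat.count_succ]
    have h1 := ih.mono (obsSigma_mono I hn obs k.le_succ) le_rfl
    have h2 := measurable_comp_obsAt I hn obs (fun z => if p z then 1 else 0) k.lt_succ_self
    let _ := obsSigma I hn obs (k + 1)
    exact h1.add h2

theorem measurable_sizeSeq [DecidableEq S] [DecidableEq A] (s : S) (a : A) (k : ℕ) :
    Measurable[obsSigma I hn obs k] fun ω => sizeSeq I hn (fun t i => obs t i ω) s a k := by
  induction k with
  | zero => exact measurable_const
  | succ k ih =>
    have h1 := ih.mono (obsSigma_mono I hn obs k.le_succ) le_rfl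
    have h2 := measurable_comp_obsAt I hn obs (fun z => z.1 = s ∧ z.2.1 = a) k.lt_succ_self
    let _ := obsSigma I hn obs (k + 1)
    exact Measurable.ite h2.setOf
      ((measurable_from_top (f := fun n : ℕ => max (n - 1) I.minSize)).comp h1)
      ((measurable_from_top (f := fun n : ℕ => n + 1)).comp h1)

theorem tendsto_sum_inv_add_atTop (x : ℝ) (hx : 0 ≤ x) :
    Tendsto (fun n : ℕ => ∑ j ∈ Finset.range n, (x + j + 1)⁻¹) atTop atTop := by
  rw [← not_summable_iff_tendsto_nat_atTop_of_nonneg fun j => by positivity]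
  intro h
  have h1 : ¬ Summable fun n : ℕ => ((n : ℝ))⁻¹ := Real.not_summable_natCast_inv
  refine h1 ((summable_nat_add_iff (⌈x⌉₊ + 1)).1 (h.of_nonneg_of_le (fun j => by positivity)
    fun j => inv_anti₀ (by positivity) ?_))
  push_cast
  linarith [Nat.le_ceil x]

variable [Fintype S] [DecidableEq S] [DecidableEq A]

theorem sum_count_eq (z : ℕ → S × A × S) (s : S) (a : A) (k : ℕ) :
    ∑ s', Nat.count (fun j => z j = (s, a, s')) k =
      Nat.count (fun j => (z j).1 = s ∧ (z j).2.1 = a) k := by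
  induction k with
  | zero => simp
  | succ k ih =>
    simp only [Nat.count_succ, Finset.sum_add_distrib, ih]
    congr 1
    obtain ⟨s₀, a₀, s₁⟩ := z k
    by_cases h : s₀ = s ∧ a₀ = a
    · obtain ⟨rfl, rfl⟩ := h
      simp
    · rw [if_neg h]
      refine Finset.sum_eq_zero fun s' _ => if_neg fun h' => h ?_
      simp only [Prod.mk.injEq] at h'
      exact ⟨h'.1, h'.2.1⟩

/-- The summands `(1{obs = (s, a, s')} - pc s a s' 1{pair = (s, a)})` of the data martingale. -/
noncomputable def innov (pc : S → A → S → ℝ) (s : S) (a : A) (s' : S) (z : S × A × S) : ℝ :=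
  (if z = (s, a, s') then 1 else 0) - pc s a s' * (if z.1 = s ∧ z.2.1 = a then 1 else 0)

theorem abs_innov_le {pc : S → A → S → ℝ} (hpc : ∀ s a, pc s a ∈ stdSimplex ℝ S) (s : S) (a : A)
    (s' : S) (z : S × A × S) :
    |innov pc s a s' z| ≤ if z.1 = s ∧ z.2.1 = a then 1 else 0 := by
  have h0 : 0 ≤ pc s a s' := (hpc s a).1 s'
  have h1 : pc s a s' ≤ 1 := by
    rw [← (hpc s a).2]
    exact Finset.single_le_sum (fun i _ => (hpc s a).1 i) (Finset.mem_univ s')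
  obtain ⟨s₀, a₀, s₁⟩ := z
  unfold innov
  by_cases h : s₀ = s ∧ a₀ = a
  · obtain ⟨rfl, rfl⟩ := h
    simp only [and_self, if_true, mul_one]
    split_ifs <;> rw [abs_le] <;> constructor <;> linarith
  · rw [if_neg h, if_neg fun h' => h ?_]
    · simp
    · simp only [Prod.mk.injEq] at h'
      exact ⟨h'.1, h'.2.1⟩

variable [Finite A] {mΩ : MeasurableSpace Ω} {P : Measure Ω} [IsProbabilityMeasure P]

/-- Number of visits of the pair `(s, a)` among the first `k` observations. -/
noncomputable def visits (z : ℕ → S × A × S) (s : S) (a : A) (k : ℕ) : ℕ :=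
  Nat.count (fun j => (z j).1 = s ∧ (z j).2.1 = a) k

omit [Fintype S] [Finite A] in
-- The martingale difference property of the innovations: earlier observations in the enumeration
-- belong to `pastData`, so the transition hypothesis applies.
theorem setIntegral_innov {pc : S → A → S → ℝ} (hpc0 : ∀ s a s', 0 ≤ pc s a s')
    (hobs : IsTransitionData I P pc obs) (k : ℕ) (s : S) (a : A) (s' : S)
    (hle : obsSigma I hn obs (k + 1) ≤ mΩ) {E : Set Ω} (hE : MeasurableSet[obsSigma I hn obs k] E) :
    ∫ ω in E, innov pc s a s' (obsAt I hn obs k ω) ∂P = 0 := by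
  have h := hobs (stageOf hn k) (locOf hn k) (one_le_stageOf hn k) (locOf_lt hn k) s a s' E
    (obsSigma_le_pastData I hn obs k E hE)
  have m1 : MeasurableSet {ω | obsAt I hn obs k ω = (s, a, s')} := by
    refine hle _ ?_
    have h1 := measurable_comp_obsAt I hn obs (fun z => z = (s, a, s')) k.lt_succ_self
    let _ := obsSigma I hn obs (k + 1)
    exact h1.setOf
  have m2 : MeasurableSet {ω | (obsAt I hn obs k ω).1 = s ∧ (obsAt I hn obs k ω).2.1 = a} := by
    refine hle _ ?_
    have h1 := measurable_comp_obsAt I hn obs (fun z => z.1 = s ∧ z.2.1 = a) k.lt_succ_self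
    let _ := obsSigma I hn obs (k + 1)
    exact h1.setOf
  have e1 : (fun ω => innov pc s a s' (obsAt I hn obs k ω)) = fun ω =>
      Set.indicator {ω | obsAt I hn obs k ω = (s, a, s')} (fun _ => (1 : ℝ)) ω - pc s a s' *
      Set.indicator {ω | (obsAt I hn obs k ω).1 = s ∧ (obsAt I hn obs k ω).2.1 = a}
        (fun _ => (1 : ℝ)) ω := by
    funext ω
    simp [innov, Set.indicator_apply]
  have i1 : ∀ {U : Set Ω}, MeasurableSet U →
      Integrable (U.indicator fun _ => (1 : ℝ)) (P.restrict E) := fun hU =>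
    (integrable_const 1).indicator hU
  rw [e1, integral_sub (i1 m1) ((i1 m2).const_mul _), integral_const_mul, integral_indicator m1,
    integral_indicator m2, Measure.restrict_restrict m1, Measure.restrict_restrict m2]
  simp only [integral_const, smul_eq_mul, mul_one, measureReal_def, Measure.restrict_apply,
    MeasurableSet.univ, Set.univ_inter]
  rw [Set.inter_comm, Set.inter_comm _ E]
  have h' : (P (E ∩ {ω | obsAt I hn obs k ω = (s, a, s')})).toReal = pc s a s' *
      (P (E ∩ {ω | (obsAt I hn obs k ω).1 = s ∧ (obsAt I hn obs k ω).2.1 = a})).toReal := by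
    rw [← ENNReal.toReal_ofReal (hpc0 s a s'), ← ENNReal.toReal_mul]
    exact congrArg ENNReal.toReal h
  rw [h', sub_self]

/-- The weights depend only on past visits, hence are predictable. The innovation vanishes off
visits, so the squares telescope to at most `1 / Φ₀ ≤ 1`, whatever the rule that selects the pairs.
-/
theorem ae_exists_tendsto_sum_innov {pc : S → A → S → ℝ} (hpc : ∀ s a, pc s a ∈ stdSimplex ℝ S)
    (hobs_meas : ∀ t i, 1 ≤ t → i < I.n t → ∀ z, MeasurableSet (obs t i ⁻¹' {z}))
    (hobs : IsTransitionData I P pc obs) (s : S) (a : A) (s' : S) {Φ₀ : ℝ} (hΦ : 1 ≤ Φ₀) :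
    ∀ᵐ ω ∂P, ∃ L, Tendsto (fun K => ∑ k ∈ Finset.range K,
      (Φ₀ + visits (fun j => obsAt I hn obs j ω) s a k + 1)⁻¹ *
        innov pc s a s' (obsAt I hn obs k ω)) atTop (𝓝 L) := by
  have hle : ∀ K, obsSigma I hn obs K ≤ mΩ := fun K =>
    (obsSigma_le_allData I hn obs K).trans (allData_le I obs hobs_meas)
  let ℱ : Filtration ℕ mΩ := ⟨obsSigma I hn obs, obsSigma_mono I hn obs, hle⟩
  have hg : ∀ k, Measurable[obsSigma I hn obs k]
      fun ω => (Φ₀ + visits (fun j => obsAt I hn obs j ω) s a k + 1)⁻¹ := fun k =>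
    (measurable_from_top (f := fun n : ℕ => (Φ₀ + n + 1)⁻¹)).comp
      (measurable_count I hn obs (fun z => z.1 = s ∧ z.2.1 = a) k)
  have hi : ∀ k, Measurable[obsSigma I hn obs (k + 1)]
      fun ω => innov pc s a s' (obsAt I hn obs k ω) := fun k =>
    measurable_comp_obsAt I hn obs _ k.lt_succ_self
  have hD : ∀ k, Measurable[obsSigma I hn obs (k + 1)] fun ω =>
      (Φ₀ + visits (fun j => obsAt I hn obs j ω) s a k + 1)⁻¹ *
        innov pc s a s' (obsAt I hn obs k ω) := fun k => by
    have h1 := (hg k).mono (obsSigma_mono I hn obs k.le_succ) le_rfl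
    have h2 := hi k
    let _ := obsSigma I hn obs (k + 1)
    exact h1.mul h2
  have hb1 : ∀ z, |innov pc s a s' z| ≤ 1 := fun z =>
    (abs_innov_le hpc s a s' z).trans (by split_ifs <;> norm_num)
  have hb2 : ∀ k ω, |(Φ₀ + visits (fun j => obsAt I hn obs j ω) s a k + 1)⁻¹| ≤ 1 := fun k ω => by
    rw [abs_of_nonneg (by positivity)]
    exact inv_le_one_of_one_le₀ (by linarith [(visits (fun j => obsAt I hn obs j ω) s a k).cast_nonneg (α := ℝ)])
  refine ae_exists_tendsto_sum_of_setIntegral_eq_zero ℱ (M := fun _ => 1) (C := 1)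
    (fun k => (hD k).stronglyMeasurable)
    (fun k ω => ?_) (fun k E hE => ?_) fun K => ?_
  · rw [abs_mul]
    exact mul_le_one₀ (hb2 k ω) (abs_nonneg _) (hb1 _)
  · exact setIntegral_mul_eq_zero (hle k)
      (Integrable.of_bound ((hi k).mono (hle _) le_rfl).aestronglyMeasurable 1
        (Eventually.of_forall fun ω => hb1 _))
      (fun E hE => setIntegral_innov I hn obs (fun s a => (hpc s a).1) hobs k s a s' (hle _) hE)
      (hg k).stronglyMeasurable (hb2 k) hE
  · have hsq : ∀ k ω, ((Φ₀ + visits (fun j => obsAt I hn obs j ω) s a k + 1)⁻¹ *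
        innov pc s a s' (obsAt I hn obs k ω)) ^ 2 ≤
        (Φ₀ + visits (fun j => obsAt I hn obs j ω) s a k)⁻¹ -
          (Φ₀ + visits (fun j => obsAt I hn obs j ω) s a (k + 1))⁻¹ := by
      intro k ω
      have h1 := abs_innov_le hpc s a s' (obsAt I hn obs k ω)
      have h2 : visits (fun j => obsAt I hn obs j ω) s a (k + 1) =
          visits (fun j => obsAt I hn obs j ω) s a k +
            if (obsAt I hn obs k ω).1 = s ∧ (obsAt I hn obs k ω).2.1 = a then 1 else 0 :=
        Nat.count_succ _ _
      rw [h2]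
      have h3 : 0 ≤ (visits (fun j => obsAt I hn obs j ω) s a k : ℝ) := Nat.cast_nonneg _
      push_cast
      generalize (visits (fun j => obsAt I hn obs j ω) s a k : ℝ) = v at h3 ⊢
      split_ifs at h1 ⊢ with h
      · have h4 : innov pc s a s' (obsAt I hn obs k ω) ^ 2 ≤ 1 := (sq_le_one_iff_abs_le_one _).2 h1
        have h5 : 0 < Φ₀ + v := by linarith
        rw [← add_assoc, mul_pow]
        calc (Φ₀ + v + 1)⁻¹ ^ 2 * innov pc s a s' (obsAt I hn obs k ω) ^ 2
            ≤ (Φ₀ + v + 1)⁻¹ ^ 2 := mul_le_of_le_one_right (sq_nonneg _) h4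
          _ ≤ (Φ₀ + v)⁻¹ * (Φ₀ + v + 1)⁻¹ := by
              rw [sq]
              exact mul_le_mul_of_nonneg_right (inv_anti₀ h5 (by linarith)) (inv_nonneg.2 (by linarith))
          _ = _ := by field_simp; ring
      · rw [abs_nonpos_iff.1 h1]
        simp
    have hint : ∀ k, Integrable (fun ω => ((Φ₀ + visits (fun j => obsAt I hn obs j ω) s a k + 1)⁻¹ *
        innov pc s a s' (obsAt I hn obs k ω)) ^ 2) P := fun k =>
      Integrable.of_bound (((hD k).mono (hle _) le_rfl).pow_const 2).aestronglyMeasurable 1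
        (Eventually.of_forall fun ω => by
          rw [Real.norm_eq_abs, abs_pow, abs_mul]
          exact pow_le_one₀ (by positivity) (mul_le_one₀ (hb2 k ω) (abs_nonneg _) (hb1 _)))
    rw [← integral_finsetSum _ fun k _ => hint k]
    calc _ ≤ ∫ _, (1 : ℝ) ∂P := by
          refine integral_mono (integrable_finsetSum _ fun k _ => hint k) (integrable_const _)
            fun ω => (Finset.sum_le_sum fun k _ => hsq k ω).trans ?_
          rw [Finset.sum_range_sub']
          have h1 : (Φ₀ + visits (fun j => obsAt I hn obs j ω) s a 0)⁻¹ ≤ 1 :=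
            inv_le_one_of_one_le₀ (by
              linarith [(visits (fun j => obsAt I hn obs j ω) s a 0).cast_nonneg (α := ℝ)])
          have h2 : 0 ≤ (Φ₀ + visits (fun j => obsAt I hn obs j ω) s a K)⁻¹ := by positivity
          linarith
      _ = 1 := by simp

omit [Fintype S] [Finite A] in
/-- The posterior means converge along paths on which the data martingale converges. -/
theorem tendsto_mean_of_tendsto_sum_innov {z : ℕ → S × A × S} {pc : S → A → S → ℝ} {s : S} {a : A}
    {s' : S} {Φ₀ φ : ℝ} (hΦ : 1 ≤ Φ₀)
    (hL : ∃ L, Tendsto (fun K => ∑ k ∈ Finset.range K,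
      (Φ₀ + visits z s a k + 1)⁻¹ * innov pc s a s' (z k)) atTop (𝓝 L))
    (hv : Tendsto (visits z s a) atTop atTop) :
    Tendsto (fun k => (φ + Nat.count (fun j => z j = (s, a, s')) k) / (Φ₀ + visits z s a k)) atTop
      (𝓝 (pc s a s')) := by
  set lam : ℕ → ℝ := fun k =>
    if (z k).1 = s ∧ (z k).2.1 = a then (Φ₀ + visits z s a k + 1)⁻¹ else 0 with hlam
  set e : ℕ → ℝ := fun k =>
    (φ + Nat.count (fun j => z j = (s, a, s')) k) / (Φ₀ + visits z s a k) - pc s a s' with he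
  have hvs : ∀ k, visits z s a (k + 1) =
      visits z s a k + if (z k).1 = s ∧ (z k).2.1 = a then 1 else 0 := fun k => Nat.count_succ _ _
  have hlam_nonneg : ∀ k, 0 ≤ lam k := fun k => by simp only [hlam]; split_ifs <;> positivity
  have hinv : Tendsto (fun k => (Φ₀ + visits z s a k + 1)⁻¹) atTop (𝓝 0) :=
    tendsto_inv_atTop_zero.comp (tendsto_atTop_add_const_right _ _
      (tendsto_atTop_add_const_left _ _ (tendsto_natCast_atTop_atTop.comp hv)))
  have hlam0 : Tendsto lam atTop (𝓝 0) := by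
    refine squeeze_zero hlam_nonneg (fun k => ?_) hinv
    simp only [hlam]
    split_ifs
    · exact le_rfl
    · positivity
  -- Only visits contribute, and along them the step sizes form a shifted harmonic series.
  have hsum : Tendsto (fun K => ∑ k ∈ Finset.range K, lam k) atTop atTop := by
    refine ((tendsto_sum_inv_add_atTop Φ₀ (by linarith)).comp hv).congr fun K => ?_
    induction K with
    | zero => simp [visits]
    | succ K ih =>
      rw [Finset.sum_range_succ, ← ih]
      simp only [Function.comp_apply, hvs, hlam]
      split_ifs
      · rw [Finset.sum_range_succ]
      · simp
  have hmul : ∀ k, lam k * innov pc s a s' (z k) =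
      (Φ₀ + visits z s a k + 1)⁻¹ * innov pc s a s' (z k) := by
    intro k
    simp only [hlam]
    split_ifs with h
    · rfl
    · have : innov pc s a s' (z k) = 0 := by
        rw [innov, if_neg h, if_neg fun h' => h (by rw [h']; exact ⟨rfl, rfl⟩)]
        simp
      rw [this]; simp
  have hneg : Negligible lam fun k => innov pc s a s' (z k) := by
    refine ⟨0, tendsto_const_nhds, ?_⟩
    simpa [hmul] using hL
  -- The error of the posterior mean is itself a stochastic approximation, with contraction constant
  -- one and the innovations as noise.
  have hrec : ∀ k, e (k + 1) = (1 - 1 * lam k) * e k + lam k * (0 + innov pc s a s' (z k)) := by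
    intro k
    have h0 : (0 : ℝ) < Φ₀ + visits z s a k := by positivity
    simp only [he, hlam, hvs, innov, Nat.count_succ]
    by_cases h : (z k).1 = s ∧ (z k).2.1 = a
    · simp only [if_pos h]
      push_cast
      field_simp
      ring
    · rw [if_neg h, if_neg h, if_neg fun h' => h (by rw [h']; exact ⟨rfl, rfl⟩)]
      simp
  have hlim : Tendsto e atTop (𝓝 0) := by
    refine tendsto_order.2 ⟨fun b hb => ?_, fun b hb => ?_⟩
    -- The recursion lemma is one-sided, so it is applied to the error and to its negative.
    · have h := eventually_le_of_recursion (e := fun k => -e k) (b := 0) one_pos hlam_nonneg hlam0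
        hsum (hneg.const_mul (-1)) (Eventually.of_forall fun k => (by rw [hrec]; ring_nf; rfl))
        (show 0 < -b / 2 by linarith)
      filter_upwards [h] with k hk
      linarith
    · have h := eventually_le_of_recursion (e := e) (b := 0) one_pos hlam_nonneg hlam0
        hsum hneg (Eventually.of_forall fun k => (hrec k).le) (show 0 < b / 2 by linarith)
      filter_upwards [h] with k hk
      linarith
  simpa [he] using hlim.add_const (pc s a s')

end Data

/-! ### Deviation of the Monte Carlo estimator of the risk of a backup -/

section Deviation

variable {S A : Type*} [Fintype S] [Fintype A]

/-- Bound of the backups of `V` on the simplex. -/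
noncomputable def backupBound (I : Input S A) (V : S → ℝ) : ℝ := ‖I.r‖ + I.γ * ‖V‖

/-- The bounded functions whose empirical means control the estimators of the risk of the backup of
`V` when the law has the value at risk `q`. -/
noncomputable def tailFun (I : Input S A) (V : S → ℝ) (s : S) (a : A) (q ε : ℝ) :
    Fin 3 → (S → ℝ) → ℝ
  | 0 => fun p => if q + ε < backup I V s a p then 1 else 0
  | 1 => fun p => if backup I V s a p < q - ε then 1 else 0
  | 2 => fun p => min (max (q - backup I V s a p) 0) (2 * backupBound I V)

theorem measurable_tailFun (I : Input S A) (V : S → ℝ) (s : S) (a : A) (q ε : ℝ) (i : Fin 3) :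
    Measurable (tailFun I V s a q ε i) := by
  have h := measurable_backup I V s a
  fin_cases i
  · exact Measurable.ite (measurableSet_lt measurable_const h) measurable_const measurable_const
  · exact Measurable.ite (measurableSet_lt h measurable_const) measurable_const measurable_const
  · exact ((h.const_sub q).max measurable_const).min measurable_const

variable {I : Input S A} (hγ : 0 ≤ I.γ)

include hγ

theorem backupBound_nonneg (V : S → ℝ) : 0 ≤ backupBound I V :=
  add_nonneg (norm_nonneg _) (mul_nonneg hγ (norm_nonneg _))

theorem tailFun_nonneg (V : S → ℝ) (s : S) (a : A) (q ε : ℝ) (i : Fin 3) (p : S → ℝ) :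
    0 ≤ tailFun I V s a q ε i p := by
  fin_cases i
  · simp only [tailFun]; split_ifs <;> norm_num
  · simp only [tailFun]; split_ifs <;> norm_num
  · exact le_min (le_max_right _ _) (mul_nonneg zero_le_two (backupBound_nonneg hγ V))

theorem abs_tailFun_le (V : S → ℝ) (s : S) (a : A) (q ε : ℝ) (i : Fin 3) (p : S → ℝ) :
    |tailFun I V s a q ε i p| ≤ 1 + 2 * backupBound I V := by
  have hB := backupBound_nonneg hγ V
  rw [abs_of_nonneg (tailFun_nonneg hγ V s a q ε i p)]
  fin_cases i
  · simp only [tailFun]; split_ifs <;> linarith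
  · simp only [tailFun]; split_ifs <;> linarith
  · exact (min_le_right _ _).trans (by linarith)

/-- The truncation only makes the function bounded on the whole space; on the simplex both `q` and
the backup are within the backup bound, and it has no effect. -/
theorem tailFun_two_eq {V : S → ℝ} {q : ℝ} (hq : |q| ≤ backupBound I V) (s : S) (a : A) (ε : ℝ)
    {p : S → ℝ} (hp : p ∈ stdSimplex ℝ S) :
    tailFun I V s a q ε 2 p = max (q - backup I V s a p) 0 := by
  have h : |backup I V s a p| ≤ backupBound I V := abs_backup_le I hγ V s a hp
  refine min_eq_left (max_le ?_ (mul_nonneg zero_le_two (backupBound_nonneg hγ V)))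
  linarith [(abs_le.1 h).1, (abs_le.1 hq).2]

variable (hα : 0 < I.α ∧ I.α < 1)
include hα

/-- The estimator of the risk of a backup deviates from the risk by at most a multiple of `ε` and
of the deviations of the empirical means of the functions `tailFun`. -/
theorem exists_abs_riskEstimator_sub_risk_le (V : S → ℝ) (s : S) (a : A) {μ : Measure (S → ℝ)}
    [IsProbabilityMeasure μ] (hμ : ∀ᵐ p ∂μ, p ∈ stdSimplex ℝ S) {ε : ℝ} (hε : 0 < ε) {q : ℝ}
    (hqd : q = valueAtRisk I.α μ (backup I V s a))
    (hlt : I.α < μ.real {p | backup I V s a p ≤ q + ε}) :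
    ∃ c : Fin 3 → ℝ, (∀ i, 0 ≤ c i) ∧ ∀ N, 1 ≤ N → ∀ x : ℕ → S → ℝ,
      (∀ i, x i ∈ stdSimplex ℝ S) →
      |riskEstimator I.ρ I.α N (fun i => backup I V s a (x i)) -
          risk I.ρ I.α μ (backup I V s a)| ≤ (1 + I.α⁻¹) * ε +
        (∑ i, c i * |empMean (tailFun I V s a q ε i) N x - ∫ p, tailFun I V s a q ε i p ∂μ| +
          (∫ p, tailFun I V s a q ε 2 p ∂μ) / I.α ^ 2 * (N : ℝ)⁻¹) := by
  set X := backup I V s a with hX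
  set B := backupBound I V with hBd
  have hXm : Measurable X := measurable_backup I V s a
  have hB0 : 0 ≤ B := backupBound_nonneg hγ V
  have hXB : ∀ᵐ p ∂μ, |X p| ≤ B := hμ.mono fun p hp => abs_backup_le I hγ V s a hp
  have hq : |q| ≤ B := hqd ▸ abs_valueAtRisk_le hα hXm hXB
  have e1 : ∫ p, tailFun I V s a q ε 0 p ∂μ = μ.real {p | q + ε < X p} := by
    rw [← integral_indicator_one (measurableSet_lt measurable_const hXm)]
    rfl
  have e2 : ∫ p, tailFun I V s a q ε 1 p ∂μ = μ.real {p | X p < q - ε} := by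
    rw [← integral_indicator_one (measurableSet_lt hXm measurable_const)]
    rfl
  have e3 : ∫ p, tailFun I V s a q ε 2 p ∂μ = ∫ p, max (q - X p) 0 ∂μ :=
    integral_congr_ae (hμ.mono fun p hp => tailFun_two_eq hγ hq s a ε hp)
  have ha1 : μ.real {p | q + ε < X p} < 1 - I.α := by
    have : {p | q + ε < X p} = {p | X p ≤ q + ε}ᶜ := by ext p; simp
    rw [this, probReal_compl_eq_one_sub (measurableSet_le hXm measurable_const)]
    linarith
  have ha2 : μ.real {p | X p < q - ε} < I.α :=
    (measureReal_mono fun p (hp : X p < q - ε) => hp.le).trans_lt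
      (measureReal_lt_of_lt_valueAtRisk hα.1 hXB (z := q - ε) (by rw [← hqd]; linarith))
  set a₁ := μ.real {p | q + ε < X p} with ha₁
  set a₂ := μ.real {p | X p < q - ε} with ha₂
  have hαi : 0 < I.α⁻¹ := inv_pos.2 hα.1
  have hθ : 0 ≤ ∫ p, max (q - X p) 0 ∂μ := integral_nonneg fun p => le_max_right _ _
  have hd1 : 0 < 1 - I.α - a₁ := by linarith
  have hd2 : 0 < I.α - a₂ := by linarith
  -- The constants of `orderStat_dev` times the factor `1 + α⁻¹` of `condRiskEstimator_dev`, and the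
  -- coefficient of the positive part. They serve VaR too, since the factor exceeds one and the
  -- third term is nonnegative.
  refine ⟨![(1 + I.α⁻¹) * (2 * B / (1 - I.α - a₁)), (1 + I.α⁻¹) * (2 * B / (I.α - a₂)), I.α⁻¹],
    fun i => ?_, fun N hN x hx => ?_⟩
  · fin_cases i
    · show 0 ≤ (1 + I.α⁻¹) * (2 * B / (1 - I.α - a₁)); positivity
    · show 0 ≤ (1 + I.α⁻¹) * (2 * B / (I.α - a₂)); positivity
    · exact hαi.le
  · have hxB : ∀ i < N, |X (x i)| ≤ B := fun i _ => abs_backup_le I hγ V s a (hx i)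
    have h1 := orderStat_dev hα hN hxB hq hε ha1 ha2
    have h2 := condRiskEstimator_dev hα hN (fun i => X (x i)) q hθ
    have e4 : empMean (fun z => max (q - z) 0) N (fun i => X (x i)) =
        empMean (tailFun I V s a q ε 2) N x := by
      simp only [empMean]
      congr 1
      exact Finset.sum_congr rfl fun i _ => (tailFun_two_eq hγ hq s a ε (hx i)).symm
    have e5 : empMean (fun z => if q + ε < z then (1 : ℝ) else 0) N (fun i => X (x i)) =
        empMean (tailFun I V s a q ε 0) N x := rfl
    have e6 : empMean (fun z => if z < q - ε then (1 : ℝ) else 0) N (fun i => X (x i)) =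
        empMean (tailFun I V s a q ε 1) N x := rfl
    rw [e5, e6] at h1
    rw [e4] at h2
    rw [Fin.sum_univ_three, e1, e2, e3]
    simp only [Matrix.cons_val]
    set u₁ := |empMean (tailFun I V s a q ε 0) N x - a₁|
    set u₂ := |empMean (tailFun I V s a q ε 1) N x - a₂|
    set u₃ := |empMean (tailFun I V s a q ε 2) N x - ∫ p, max (q - X p) 0 ∂μ| with hu₃
    have hu : 0 ≤ u₁ ∧ 0 ≤ u₂ ∧ 0 ≤ u₃ := ⟨abs_nonneg _, abs_nonneg _, abs_nonneg _⟩
    have h4 : 0 ≤ (∫ p, max (q - X p) 0 ∂μ) / I.α ^ 2 * (N : ℝ)⁻¹ := by positivity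
    have h3 : (1 + I.α⁻¹) * |orderStat N (fun i => X (x i)) ⌈(N : ℝ) * I.α⌉₊ - q| ≤
        (1 + I.α⁻¹) * ε + ((1 + I.α⁻¹) * (2 * B / (1 - I.α - a₁)) * u₁ +
          (1 + I.α⁻¹) * (2 * B / (I.α - a₂)) * u₂) := by
      refine (mul_le_mul_of_nonneg_left h1 (by positivity)).trans_eq ?_
      ring
    cases hρ : I.ρ with
    | VaR =>
      have h5 : |orderStat N (fun i => X (x i)) ⌈(N : ℝ) * I.α⌉₊ - q| ≤
          (1 + I.α⁻¹) * |orderStat N (fun i => X (x i)) ⌈(N : ℝ) * I.α⌉₊ - q| :=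
        le_mul_of_one_le_left (abs_nonneg _) (by linarith)
      have h6 : 0 ≤ I.α⁻¹ * u₃ := mul_nonneg hαi.le hu.2.2
      show |orderStat N (fun i => X (x i)) ⌈(N : ℝ) * I.α⌉₊ - valueAtRisk I.α μ X| ≤ _
      rw [← hqd]
      linarith
    | CVaR =>
      show |riskEstimator .CVaR I.α N (fun i => X (x i)) -
        (valueAtRisk I.α μ X - I.α⁻¹ * ∫ p, max (valueAtRisk I.α μ X - X p) 0 ∂μ)| ≤ _
      rw [← hqd]
      linarith

end Deviation

/-! ### Sampling from the posteriors along a data path -/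

section Paths

variable {S A : Type*} [Fintype S] [DecidableEq S] [DecidableEq A]

omit [Fintype S] in
theorem one_le_posterior {I : Input S A} (hprior : ∀ s a s', 1 ≤ I.prior s a s')
    (d : ℕ → ℕ → S × A × S) (t : ℕ) (s : S) (a : A) (s' : S) : 1 ≤ posterior I d t s a s' := by
  induction t with
  | zero => exact hprior s a s'
  | succ t ih => exact ih.trans (le_add_of_nonneg_right (Nat.cast_nonneg _))

/-- The posteriors of the pair `(s, a)` converge to the limiting posterior: either they concentrate
at the true transition vector, or they are eventually constant and the sample sizes grow. -/
def IsRegularPath (I : Input S A) (pc : S → A → S → ℝ) (d : ℕ → ℕ → S × A × S) (s : S) (a : A) :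
    Prop :=
  ((∃ s', totalCount I d s a s' = ⊤) ∧
    Tendsto (fun t => ∑ s', posterior I d t s a s') atTop atTop ∧
    ∀ s', Tendsto (fun t => posterior I d t s a s' / ∑ j, posterior I d t s a j) atTop
      (𝓝 (pc s a s'))) ∨
  ((¬ ∃ s', totalCount I d s a s' = ⊤) ∧
    (∀ᶠ t in atTop, posterior I d t s a =
      fun s' => I.prior s a s' + ((totalCount I d s a s').toNat : ℝ)) ∧
    Tendsto (fun t => sampleSize I d t s a) atTop atTop)

variable [Nonempty S] {I : Input S A} (hprior : ∀ s a s', 1 ≤ I.prior s a s')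
  (hsize : 1 ≤ I.minSize) (hn : ∀ t, ∃ t', t ≤ t' ∧ 1 ≤ I.n t')
include hprior hsize hn

/-- Either the posterior concentrates and continuity at the true vector suffices for any sample
size, or it eventually equals the limiting one and the growing sample size makes the variance
vanish. -/
theorem tendsto_integral_abs_empMean_sub {pc : S → A → S → ℝ} {d : ℕ → ℕ → S × A × S} {s : S}
    {a : A} (hd : IsRegularPath I pc d s a) {Y : (S → ℝ) → ℝ} (hY : Measurable Y) {M : ℝ}
    (hM : ∀ p, |Y p| ≤ M)
    (hYc : (∃ s', totalCount I d s a s' = ⊤) → ContinuousAt Y (pc s a)) :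
    Tendsto (fun t => ∫ x, |empMean Y (sampleSize I d t s a) x -
        ∫ p, Y p ∂limitPosterior I pc d s a|
      ∂Measure.infinitePi (fun _ : ℕ => dirichlet (posterior I d t s a))) atTop (𝓝 0) := by
  have hN : ∀ t, 1 ≤ sampleSize I d t s a := fun t => by
    rw [sampleSize_eq_sizeSeq I hn]
    exact hsize.trans (minSize_le_sizeSeq I hn d s a _)
  have hprob : ∀ t, IsProbabilityMeasure (dirichlet (posterior I d t s a)) := fun t =>
    isProbabilityMeasure_dirichlet (one_le_posterior hprior d t s a)
  rcases hd with ⟨h, hsum, hmean⟩ | ⟨h, hev, hsz⟩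
  · rw [limitPosterior, if_pos h, integral_dirac]
    exact squeeze_zero (fun t => integral_nonneg fun x => abs_nonneg _)
      (fun t => integral_abs_empMean_sub_le _ hY hM (hN t) _)
      (tendsto_integral_dirichlet_sub (fun t => one_le_posterior hprior d t s a) hsum hmean hY hM
        (hYc h))
  · have hlim : Tendsto (fun t => (M ^ 2 + 1) / 2 * (√(sampleSize I d t s a))⁻¹) atTop (𝓝 0) := by
      have h1 : Tendsto (fun t => √(sampleSize I d t s a)) atTop atTop :=
        Real.tendsto_sqrt_atTop.comp (tendsto_natCast_atTop_atTop.comp hsz)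
      simpa using (tendsto_inv_atTop_zero.comp h1).const_mul ((M ^ 2 + 1) / 2)
    refine squeeze_zero' (Eventually.of_forall fun t => integral_nonneg fun x => abs_nonneg _) ?_ hlim
    filter_upwards [hev] with t ht
    have h1 : limitPosterior I pc d s a = dirichlet (posterior I d t s a) := by
      rw [limitPosterior, if_neg h, ht]
    rw [h1]
    exact integral_abs_empMean_sub_integral_le _ hY hM (hN t)

end Paths

/-! ### Convergence of the weighted Monte Carlo noise -/

section Sampling

variable {S A Ω : Type*} [Fintype S] [Fintype A] [DecidableEq S] [DecidableEq A] [Nonempty S]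
  [mΩ : MeasurableSpace Ω] {P : Measure Ω} [IsProbabilityMeasure P] {I : Input S A}
  {obs : ℕ → ℕ → Ω → S × A × S} {draw : Draw S A → Ω → S → ℝ}

omit [Fintype A] [IsProbabilityMeasure P] in
theorem ae_draw_mem_stdSimplex (hdraw : IsPosteriorSampling I P obs draw)
    {j : Draw S A} (hj : 1 ≤ j.1 ∧ 1 ≤ j.2.1 ∧ j.2.1 ≤ I.m j.1) :
    ∀ᵐ ω ∂P, draw j ω ∈ stdSimplex ℝ S := by
  have hm : MeasurableSet (stdSimplex ℝ S) := (isClosed_stdSimplex ℝ S).measurableSet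
  have h := hdraw {j} (fun i hi => by rwa [Finset.mem_singleton.1 hi])
    (fun _ => (stdSimplex ℝ S)ᶜ) (fun _ => hm.compl) Set.univ MeasurableSet.univ
  simp only [Finset.mem_singleton, Set.iInter_iInter_eq_left, Set.univ_inter,
    Finset.prod_singleton] at h
  have h0 : ∀ φ : S → ℝ, dirichlet φ (stdSimplex ℝ S)ᶜ = 0 := fun φ =>
    mem_ae_iff.1 (ae_mem_stdSimplex_dirichlet φ)
  simp only [h0, lintegral_zero] at h
  exact mem_ae_iff.2 h

variable (hprior : ∀ s a s', 1 ≤ I.prior s a s')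
  (hn : ∀ t, ∃ t', t ≤ t' ∧ 1 ≤ I.n t') (hm : ∀ t, ∃ t', t ≤ t' ∧ 1 ≤ I.m t')
  (hlr_sq : Summable (fun l : ℕ => I.lr (l + 1) ^ 2))
  (hobs_meas : ∀ t i, 1 ≤ t → i < I.n t → ∀ z, MeasurableSet (obs t i ⁻¹' {z}))
  (hdraw_meas : ∀ j, Measurable (draw j)) (hdraw : IsPosteriorSampling I P obs draw)
include hprior hn hlr_sq hobs_meas hdraw_meas hdraw

/-- Given the data, each deviation minus its conditional mean is a martingale difference. Here `Y`
and `y` are deterministic; their dependence on the limiting law is handled later by countability. -/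
theorem ae_exists_tendsto_sum_empMean (s : S) (a : A) {Y : (S → ℝ) → ℝ} (hY : Measurable Y) {M : ℝ}
    (hM : ∀ p, |Y p| ≤ M) (y : ℝ) :
    ∀ᵐ ω ∂P, ∃ L, Tendsto (fun K => ∑ k ∈ Finset.range K, I.lr (k + 1) *
      (|empMean Y (sampleSize I (fun t i => obs t i ω) (stageOf hm k) s a)
          (fun i => draw (stageOf hm k, locOf hm k + 1, s, a, i) ω) - y| -
        ∫ x, |empMean Y (sampleSize I (fun t i => obs t i ω) (stageOf hm k) s a) x - y|
          ∂Measure.infinitePi (fun _ : ℕ =>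
            dirichlet (posterior I (fun t i => obs t i ω) (stageOf hm k) s a)))) atTop (𝓝 L) := by
  -- All that an update of the pair needs from the data: the counts behind the posterior and the
  -- sample size. The values are countable.
  let κ : ℕ → Ω → (S → ℕ) × ℕ := fun k ω =>
    (fun s' => Nat.count (fun j => obsAt I hn obs j ω = (s, a, s')) (cumul I.n (stageOf hm k + 1)),
      sampleSize I (fun t i => obs t i ω) (stageOf hm k) s a)
  let μ : (S → ℕ) × ℕ → Measure (S → ℝ) := fun c => dirichlet fun s' => I.prior s a s' + c.1 s'
  have hμ : ∀ c, IsProbabilityMeasure (μ c) := fun c => isProbabilityMeasure_dirichlet fun s' =>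
    (hprior s a s').trans (le_add_of_nonneg_right (Nat.cast_nonneg _))
  have hpost : ∀ k ω, dirichlet (posterior I (fun t i => obs t i ω) (stageOf hm k) s a) =
      μ (κ k ω) := fun k ω =>
    congrArg dirichlet (funext fun s' => posterior_eq_add_count I hn _ _ s a s')
  have hκ : ∀ k, Measurable[allData I obs] (κ k) := fun k => by
    have h1 : ∀ s', Measurable[allData I obs] fun ω => Nat.count
        (fun j => obsAt I hn obs j ω = (s, a, s')) (cumul I.n (stageOf hm k + 1)) := fun s' =>
      (measurable_count I hn obs (fun z => z = (s, a, s')) _).mono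
        (obsSigma_le_allData I hn obs _) le_rfl
    have h2 : Measurable[allData I obs]
        fun ω => sampleSize I (fun t i => obs t i ω) (stageOf hm k) s a := by
      simp only [sampleSize_eq_sizeSeq I hn]
      exact (measurable_sizeSeq I hn obs s a _).mono (obsSigma_le_allData I hn obs _) le_rfl
    let _ := allData I obs
    exact (measurable_pi_lambda _ h1).prodMk h2
  let ι : ℕ × ℕ → Draw S A := fun j => (stageOf hm j.1, locOf hm j.1 + 1, s, a, j.2)
  have hι : Function.Injective ι := by
    rintro ⟨k, i⟩ ⟨k', i'⟩ h
    simp only [ι, Prod.mk.injEq, true_and, Nat.add_right_cancel_iff] at h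
    obtain ⟨h1, h2, rfl⟩ := h
    exact Prod.ext (stageOf_locOf_injective hm (Prod.ext h1 h2)) rfl
  have hlaw : ∀ (F : Finset (ℕ × ℕ)) (B : ℕ × ℕ → Set (S → ℝ)), (∀ j, MeasurableSet (B j)) →
      ∀ E, MeasurableSet[allData I obs] E →
        P (E ∩ ⋂ j ∈ F, (fun k i => draw (ι (k, i))) j.1 j.2 ⁻¹' B j) =
          ∫⁻ ω in E, ∏ j ∈ F, μ (κ j.1 ω) (B j) ∂P := by
    intro F B hB E hE
    have h := hdraw (F.map ⟨ι, hι⟩) (fun j hj => by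
        obtain ⟨l, -, rfl⟩ := Finset.mem_map.1 hj
        exact ⟨one_le_stageOf hm l.1, Nat.le_add_left _ _, locOf_lt hm l.1⟩)
      (Function.extend ι B fun _ => Set.univ) (fun j => by
        by_cases hj : ∃ l, ι l = j
        · obtain ⟨l, rfl⟩ := hj
          rw [hι.extend_apply]
          exact hB l
        · rw [Function.extend_apply' _ _ _ hj]
          exact MeasurableSet.univ) E hE
    simp only [Finset.mem_map, Function.Embedding.coeFn_mk, Set.iInter_exists, Set.biInter_and',
      Set.iInter_iInter_eq_right, hι.extend_apply, Finset.prod_map] at h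
    refine Eq.trans ?_ (h.trans ?_)
    · rfl
    · refine lintegral_congr fun ω => Finset.prod_congr rfl fun l _ => ?_
      rw [← hpost]
  have hM0 : 0 ≤ M := (abs_nonneg _).trans (hM 0)
  have hmain := ae_exists_tendsto_sum_centered (allData_le I obs hobs_meas)
    (x := fun k i => draw (ι (k, i))) (fun k i => hdraw_meas _) hκ hlaw
    (h := fun _ c x => |empMean Y c.2 x - y|) (M := M + |y|)
    (fun _ c => ((measurable_empMean hY c.2).sub_const y).norm) (fun _ c x => by
      rw [abs_abs]
      exact (abs_sub _ _).trans (add_le_add (abs_empMean_le hM hM0 _ _) le_rfl))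
    hlr_sq
  simpa only [hpost] using hmain

end Sampling

section Limit

variable {S A : Type*} [Fintype S] [DecidableEq S] [DecidableEq A] {I : Input S A}

/-! ### The limiting posterior -/

/-- The possible limiting posteriors of the pair `(s, a)`. -/
noncomputable def limitLaw (I : Input S A) (pc : S → A → S → ℝ) (s : S) (a : A) :
    Option (S → ℕ) → Measure (S → ℝ)
  | none => Measure.dirac (pc s a)
  | some c => dirichlet fun s' => I.prior s a s' + c s'

omit [DecidableEq S] [DecidableEq A] in
-- Although the limiting posterior is random, it ranges over a countable family, so exceptional null
-- sets can be united over its values.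
theorem exists_limitPosterior_eq (pc : S → A → S → ℝ) (d : ℕ → ℕ → S × A × S) (s : S) (a : A) :
    ∃ o, limitPosterior I pc d s a = limitLaw I pc s a o := by
  unfold limitPosterior
  split_ifs
  · exact ⟨none, rfl⟩
  · exact ⟨some fun s' => (totalCount I d s a s').toNat, rfl⟩

variable [Nonempty S] (hprior : ∀ s a s', 1 ≤ I.prior s a s') {pc : S → A → S → ℝ}
  (hpc : ∀ s a, pc s a ∈ stdSimplex ℝ S)

include hprior in
omit [DecidableEq S] [DecidableEq A] in
theorem isProbabilityMeasure_limitPosterior (d : ℕ → ℕ → S × A × S) (s : S) (a : A) :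
    IsProbabilityMeasure (limitPosterior I pc d s a) := by
  unfold limitPosterior
  split_ifs
  · infer_instance
  · exact isProbabilityMeasure_dirichlet fun s' =>
      (hprior s a s').trans (le_add_of_nonneg_right (Nat.cast_nonneg _))

include hpc in
omit [DecidableEq S] [DecidableEq A] in
theorem ae_mem_stdSimplex_limitPosterior (d : ℕ → ℕ → S × A × S) (s : S) (a : A) :
    ∀ᵐ p ∂limitPosterior I pc d s a, p ∈ stdSimplex ℝ S := by
  unfold limitPosterior
  split_ifs
  · rw [ae_dirac_eq]
    exact hpc s a
  · exact ae_mem_stdSimplex_dirichlet _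

variable [Fintype A] (hγ : 0 ≤ I.γ) (hα : 0 < I.α ∧ I.α < 1)

include hprior hγ hα in
omit [DecidableEq S] [DecidableEq A] in
theorem lt_measureReal_limitPosterior (d : ℕ → ℕ → S × A × S) (V : S → ℝ) (s : S) (a : A) {ε : ℝ}
    (hε : 0 < ε) :
    I.α < (limitPosterior I pc d s a).real {p | backup I V s a p ≤
      valueAtRisk I.α (limitPosterior I pc d s a) (backup I V s a) + ε} := by
  have hX := measurable_backup I V s a
  unfold limitPosterior
  split_ifs
  · rw [valueAtRisk_dirac hα hX, measureReal_def,
      Measure.dirac_apply' _ (measurableSet_le hX measurable_const), Set.indicator_of_mem]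
    · simpa using hα.2
    · exact (le_add_of_nonneg_right hε.le : backup I V s a (pc s a) ≤ _)
  · exact lt_measureReal_valueAtRisk_add hα (fun s' =>
      (hprior s a s').trans (le_add_of_nonneg_right (Nat.cast_nonneg _)))
      (continuous_backup I V s a) (fun p hp => abs_backup_le I hγ V s a hp) hε

omit [Fintype A] [Nonempty S] [DecidableEq S] [DecidableEq A] in
-- When `q` is the backup at `p₀`, the margin `ε` keeps both jumps away from `p₀`, and the two
-- indicators vanish nearby.
theorem continuousAt_tailFun [Fintype A] (V : S → ℝ) (s : S) (a : A) {p₀ : S → ℝ} {ε : ℝ}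
    (hε : 0 < ε) (i : Fin 3) : ContinuousAt (tailFun I V s a (backup I V s a p₀) ε i) p₀ := by
  have hX : Continuous (backup I V s a) := continuous_backup I V s a
  fin_cases i
  · refine continuousAt_const.congr (f := fun _ => (0 : ℝ)) ?_
    filter_upwards [hX.continuousAt.eventually_lt_const
      (show backup I V s a p₀ < backup I V s a p₀ + ε by linarith)] with p hp
    exact (if_neg hp.not_gt).symm
  · refine continuousAt_const.congr (f := fun _ => (0 : ℝ)) ?_
    filter_upwards [hX.continuousAt.eventually_const_lt
      (show backup I V s a p₀ - ε < backup I V s a p₀ by linarith)] with p hp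
    exact (if_neg hp.not_gt).symm
  · exact (((continuous_const.sub hX).max continuous_const).min continuous_const).continuousAt

/-! ### Regularity of almost all data paths -/

omit [Fintype A] [Nonempty S] in
-- With an infinite count the visits diverge and the posterior means converge. Otherwise, as there
-- are finitely many successors, the pair is visited finitely often: its counts freeze and its
-- sample size grows.
theorem isRegularPath_of_tendsto (hn : ∀ t, ∃ t', t ≤ t' ∧ 1 ≤ I.n t') {d : ℕ → ℕ → S × A × S}
    {s : S} {a : A} (hΦ : 1 ≤ ∑ s', I.prior s a s')
    (hL : ∀ s', ∃ L, Tendsto (fun K => ∑ k ∈ Finset.range K,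
      ((∑ s', I.prior s a s') + visits (obsSeq I hn d) s a k + 1)⁻¹ *
        innov pc s a s' (obsSeq I hn d k)) atTop (𝓝 L)) : IsRegularPath I pc d s a := by
  have hpost : ∀ t s', posterior I d t s a s' = I.prior s a s' +
      Nat.count (fun k => obsSeq I hn d k = (s, a, s')) (cumul I.n (t + 1)) := fun t s' =>
    posterior_eq_add_count I hn d t s a s'
  have hsum : ∀ t, ∑ s', posterior I d t s a s' =
      (∑ s', I.prior s a s') + visits (obsSeq I hn d) s a (cumul I.n (t + 1)) := fun t => by
    simp only [hpost, Finset.sum_add_distrib]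
    rw [← Nat.cast_sum, sum_count_eq (obsSeq I hn d) s a]
    rfl
  by_cases h : ∃ s', totalCount I d s a s' = ⊤
  · have hv : Tendsto (visits (obsSeq I hn d) s a) atTop atTop := by
      obtain ⟨s', hs'⟩ := h
      rw [totalCount_eq_encard I hn] at hs'
      refine tendsto_atTop_mono (fun k => ?_) (tendsto_count hs')
      exact Nat.count_mono_left fun j _ hj => by rw [hj]; exact ⟨rfl, rfl⟩
    refine Or.inl ⟨h, ?_, fun s' => ?_⟩
    · simp only [hsum]
      exact tendsto_atTop_add_const_left _ _
        (tendsto_natCast_atTop_atTop.comp (hv.comp (tendsto_cumul hn)))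
    · simp only [hsum]
      simp only [hpost]
      exact (tendsto_mean_of_tendsto_sum_innov hΦ (hL s') hv).comp (tendsto_cumul hn)
  · refine Or.inr ⟨h, ?_, ?_⟩
    · push Not at h
      have h1 : ∀ᶠ t in atTop, ∀ s', Nat.count (fun k => obsSeq I hn d k = (s, a, s'))
          (cumul I.n (t + 1)) = (totalCount I d s a s').toNat := by
        refine eventually_all.2 fun s' => ?_
        rw [totalCount_eq_encard I hn]
        exact (tendsto_cumul hn).eventually (eventually_count_eq
          (by rw [← totalCount_eq_encard I hn]; exact h s'))
      filter_upwards [h1] with t ht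
      funext s'
      rw [hpost, ht s']
    · push Not at h
      have hfin : {k | (obsSeq I hn d k).1 = s ∧ (obsSeq I hn d k).2.1 = a}.Finite := by
        refine (Set.finite_iUnion (f := fun s' => {k | obsSeq I hn d k = (s, a, s')}) fun s' =>
          Set.encard_ne_top_iff.1 (by rw [← totalCount_eq_encard I hn]; exact h s')).subset ?_
        intro k hk
        have hk : (obsSeq I hn d k).1 = s ∧ (obsSeq I hn d k).2.1 = a := hk
        exact Set.mem_iUnion.2 ⟨(obsSeq I hn d k).2.2, Prod.ext hk.1 (Prod.ext hk.2 rfl)⟩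
      obtain ⟨b, hb⟩ := hfin.bddAbove
      have h2 := tendsto_sizeSeq I hn d s a (by
        filter_upwards [eventually_gt_atTop b] with k hk hk'
        exact absurd (hb hk') (not_le.2 hk))
      simp only [sampleSize_eq_sizeSeq I hn]
      exact h2.comp (tendsto_cumul hn)

include hprior hpc in
omit [Fintype A] in
theorem ae_isRegularPath [Finite A] {Ω : Type*} [MeasurableSpace Ω] {P : Measure Ω}
    [IsProbabilityMeasure P]
    {obs : ℕ → ℕ → Ω → S × A × S} (hn : ∀ t, ∃ t', t ≤ t' ∧ 1 ≤ I.n t')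
    (hobs_meas : ∀ t i, 1 ≤ t → i < I.n t → ∀ z, MeasurableSet (obs t i ⁻¹' {z}))
    (hobs : IsTransitionData I P pc obs) :
    ∀ᵐ ω ∂P, ∀ s a, IsRegularPath I pc (fun t i => obs t i ω) s a := by
  have hΦ : ∀ s a, 1 ≤ ∑ s', I.prior s a s' := fun s a => by
    obtain ⟨s₀⟩ := ‹Nonempty S›
    exact (hprior s a s₀).trans (Finset.single_le_sum
      (fun i _ => zero_le_one.trans (hprior s a i)) (Finset.mem_univ s₀))
  have h : ∀ᵐ ω ∂P, ∀ s a s', ∃ L, Tendsto (fun K => ∑ k ∈ Finset.range K,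
      ((∑ s', I.prior s a s') + visits (fun j => obsAt I hn obs j ω) s a k + 1)⁻¹ *
        innov pc s a s' (obsAt I hn obs k ω)) atTop (𝓝 L) :=
    ae_all_iff.2 fun s => ae_all_iff.2 fun a => ae_all_iff.2 fun s' =>
      ae_exists_tendsto_sum_innov I hn obs hpc hobs_meas hobs s a s' (hΦ s a)
  filter_upwards [h] with ω hω s a
  exact isRegularPath_of_tendsto hn (hΦ s a) (hω s a)

/-! ### Negligible deviation of the estimators -/

include hprior hpc hγ hα in
-- Each deviation of an empirical mean is its conditional mean, which tends to zero, plus a centred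
-- part whose weighted series converges by `hL`.
theorem exists_negligible_dev (hsize : 1 ≤ I.minSize)
    (hn : ∀ t, ∃ t', t ≤ t' ∧ 1 ≤ I.n t') (hm : ∀ t, ∃ t', t ≤ t' ∧ 1 ≤ I.m t')
    {d : ℕ → ℕ → S × A × S} {x : ℕ → ℕ → S → ℝ} (hx : ∀ k i, x k i ∈ stdSimplex ℝ S) {lam : ℕ → ℝ}
    {s : S} {a : A} (hd : IsRegularPath I pc d s a) (V : S → ℝ) {ε : ℝ} (hε : 0 < ε) {q : ℝ}
    (hq : q = valueAtRisk I.α (limitPosterior I pc d s a) (backup I V s a))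
    (hL : ∀ l, ∃ L, Tendsto (fun K => ∑ k ∈ Finset.range K, lam k *
      (|empMean (tailFun I V s a q ε l) (sampleSize I d (stageOf hm k) s a) (x k) -
          ∫ p, tailFun I V s a q ε l p ∂limitPosterior I pc d s a| -
        ∫ x, |empMean (tailFun I V s a q ε l) (sampleSize I d (stageOf hm k) s a) x -
            ∫ p, tailFun I V s a q ε l p ∂limitPosterior I pc d s a|
          ∂Measure.infinitePi (fun _ : ℕ => dirichlet (posterior I d (stageOf hm k) s a))))
      atTop (𝓝 L)) :
    ∃ η : ℕ → ℝ, (∀ k, 0 ≤ η k) ∧ Negligible lam η ∧ ∀ k,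
      |riskEstimator I.ρ I.α (sampleSize I d (stageOf hm k) s a)
          (fun i => backup I V s a (x k i)) -
        risk I.ρ I.α (limitPosterior I pc d s a) (backup I V s a)| ≤ (1 + I.α⁻¹) * ε + η k := by
  have hprob := isProbabilityMeasure_limitPosterior (pc := pc) hprior d s a
  obtain ⟨c, hc0, hc⟩ := exists_abs_riskEstimator_sub_risk_le hγ hα V s a
    (ae_mem_stdSimplex_limitPosterior hpc d s a) hε hq
    (hq ▸ lt_measureReal_limitPosterior hprior hγ hα d V s a hε)
  have hN : ∀ t, 1 ≤ sampleSize I d t s a := fun t => by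
    rw [sampleSize_eq_sizeSeq I hn]
    exact hsize.trans (minSize_le_sizeSeq I hn d s a _)
  have hdirac : (∃ s', totalCount I d s a s' = ⊤) → q = backup I V s a (pc s a) := fun h => by
    rw [hq, limitPosterior, if_pos h, valueAtRisk_dirac hα (measurable_backup I V s a)]
  refine ⟨_, fun k => ?_, ?_, fun k => hc _ (hN (stageOf hm k)) (x k) (hx k)⟩
  · have h1 : 0 ≤ ∫ p, tailFun I V s a q ε 2 p ∂limitPosterior I pc d s a :=
      integral_nonneg fun p => tailFun_nonneg hγ V s a q ε 2 p
    have h2 := Finset.sum_nonneg fun i (_ : i ∈ Finset.univ) => mul_nonneg (hc0 i)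
      (abs_nonneg (empMean (tailFun I V s a q ε i) (sampleSize I d (stageOf hm k) s a) (x k) -
        ∫ p, tailFun I V s a q ε i p ∂limitPosterior I pc d s a))
    have h3 : 0 < I.α ^ 2 := pow_pos hα.1 2
    exact add_nonneg h2 (by positivity)
  · refine (Negligible.sum _ fun l _ => Negligible.const_mul ⟨_, ?_, hL l⟩ (c l)).add
      (Negligible.of_tendsto ?_)
    · exact (tendsto_integral_abs_empMean_sub hprior hsize hn hd (measurable_tailFun I V s a q ε l)
        (abs_tailFun_le hγ V s a q ε l) fun h => by
          rw [hdirac h]; exact continuousAt_tailFun V s a hε l).comp (tendsto_stageOf hm)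
    -- The rounding term of CVaR: its coefficient vanishes for a Dirac limit, and otherwise the
    -- sample size tends to infinity.
    · rcases hd with ⟨h, -, -⟩ | ⟨-, -, hsz⟩
      · have h0 : ∫ p, tailFun I V s a q ε 2 p ∂limitPosterior I pc d s a = 0 := by
          rw [limitPosterior, if_pos h, integral_dirac, hdirac h]
          simp [tailFun, backupBound_nonneg hγ V]
        simp [h0]
      · have h1 := tendsto_inv_atTop_zero.comp (tendsto_natCast_atTop_atTop (R := ℝ) |>.comp
          (hsz.comp (tendsto_stageOf hm)))
        simpa using h1.const_mul
          ((∫ p, tailFun I V s a q ε 2 p ∂limitPosterior I pc d s a) / I.α ^ 2)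

end Limit

/-! ### Convergence of the iterates -/

section Iterates

variable {S A : Type*} [Fintype S] [Fintype A] [DecidableEq S] [DecidableEq A] [Nonempty A]
  {I : Input S A} (hγ : 0 ≤ I.γ ∧ I.γ < 1) (hα : 0 < I.α ∧ I.α < 1)
  (hsize : 1 ≤ I.minSize) (hn : ∀ t, ∃ t', t ≤ t' ∧ 1 ≤ I.n t')
  (hm : ∀ t, ∃ t', t ≤ t' ∧ 1 ≤ I.m t')
  (hlr0 : ∀ k, 0 ≤ I.lr (k + 1)) (hlr : Tendsto (fun k => I.lr (k + 1)) atTop (𝓝 0))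
  {d : ℕ → ℕ → S × A × S} {x : Draw S A → S → ℝ}
  (hx : ∀ k s a i, x (stageOf hm k, locOf hm k + 1, s, a, i) ∈ stdSimplex ℝ S)

omit [DecidableEq S] in
-- Compactness provides finitely many deterministic value functions that can stand in for the random
-- ones of bounded iterates.
theorem exists_finset_denseSeq (R : ℝ) {δ : ℝ} (hδ : 0 < δ) :
    ∃ J : Finset ℕ, ∀ V : S → ℝ, dist V 0 ≤ R →
      ∃ j ∈ J, dist V (TopologicalSpace.denseSeq (S → ℝ) j) < δ := by
  obtain ⟨J, hJ⟩ := (isCompact_closedBall (0 : S → ℝ) R).elim_finite_subcover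
    (fun j => Metric.ball (TopologicalSpace.denseSeq (S → ℝ) j) δ) (fun _ => Metric.isOpen_ball)
    fun V _ => by
      obtain ⟨_, h, j, rfl⟩ := Metric.dense_iff.1 (TopologicalSpace.denseRange_denseSeq (S → ℝ)) V δ hδ
      exact Set.mem_iUnion.2 ⟨j, by rwa [Metric.mem_ball, dist_comm]⟩
  refine ⟨J, fun V hV => ?_⟩
  simpa using hJ (Metric.mem_closedBall.2 hV)

include hsize hn in
omit [Fintype S] [Fintype A] [Nonempty A] in
theorem one_le_sampleSize (d : ℕ → ℕ → S × A × S) (t : ℕ) (s : S) (a : A) :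
    1 ≤ sampleSize I d t s a := by
  rw [sampleSize_eq_sizeSeq I hn]
  exact hsize.trans (minSize_le_sizeSeq I hn d s a _)

include hγ hα hsize hn hlr0 hlr hx in
/-- The iterates are eventually bounded. -/
theorem exists_eventually_norm_qSeq_le :
    ∃ R, ∀ᶠ k in atTop, ‖qSeq I hm d x k‖ ≤ R := by
  obtain ⟨K, hK⟩ := eventually_atTop.1 (hlr.eventually (ge_mem_nhds one_pos))
  -- Any radius of at least `‖r‖ / (1 - γ)` satisfies `‖r‖ + γ R ≤ R`, so the ball is invariant once
  -- the learning rates are at most one.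
  set R := max ‖qSeq I hm d x K‖ (‖I.r‖ / (1 - I.γ)) with hR
  have hγ' : 0 < 1 - I.γ := by linarith [hγ.2]
  have hR0 : 0 ≤ R := (norm_nonneg _).trans (le_max_left _ _)
  have hrR : ‖I.r‖ + I.γ * R ≤ R := by
    have : ‖I.r‖ ≤ R * (1 - I.γ) := (div_le_iff₀ hγ').1 (le_max_right _ _)
    linarith
  refine ⟨R, eventually_atTop.2 ⟨K, fun k hk => ?_⟩⟩
  induction k, hk using Nat.le_induction with
  | base => exact le_max_left _ _
  | succ k hk ih =>
    rw [pi_norm_le_iff_of_nonneg hR0]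
    intro s
    rw [pi_norm_le_iff_of_nonneg hR0]
    intro a
    rw [qSeq_succ, Real.norm_eq_abs]
    have h1 : |qSeq I hm d x k s a| ≤ R :=
      ((norm_le_pi_norm (qSeq I hm d x k s) a).trans (norm_le_pi_norm _ s)).trans ih
    have h2 := abs_riskEstimator_le I.ρ hα (one_le_sampleSize hsize hn d (stageOf hm k) s a)
      (x := fun i => backup I (maxQ (qSeq I hm d x k)) s a
          (x (stageOf hm k, locOf hm k + 1, s, a, i))) (B := R) fun i _ =>
        (abs_backup_le I hγ.1 _ s a (hx k s a i)).trans (le_trans (add_le_add le_rfl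
          (mul_le_mul_of_nonneg_left ((norm_maxQ_le _).trans ih) hγ.1)) hrR)
    have h3 := hlr0 k
    have h4 := hK k hk
    refine (abs_add_le _ _).trans ?_
    rw [abs_mul, abs_mul, abs_of_nonneg h3, abs_of_nonneg (sub_nonneg.2 h4)]
    have h5 := mul_le_mul_of_nonneg_left h1 (sub_nonneg.2 h4)
    have h6 := mul_le_mul_of_nonneg_left h2 h3
    linarith

include hγ hα hsize hn hlr0 hlr hx in
/-- The iterates converge if the deviations of the estimators are negligible. -/
theorem tendsto_norm_qSeq_sub
    (hsum : Tendsto (fun K => ∑ k ∈ Finset.range K, I.lr (k + 1)) atTop atTop)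
    (Φ : S → A → Measure (S → ℝ)) [∀ s a, IsProbabilityMeasure (Φ s a)]
    (hΦ : ∀ s a, ∀ᵐ p ∂Φ s a, p ∈ stdSimplex ℝ S)
    (hdev : ∀ s a j (ε : ℝ), 0 < ε → ∃ η : ℕ → ℝ, (∀ k, 0 ≤ η k) ∧
      Negligible (fun k => I.lr (k + 1)) η ∧ ∀ k,
        |riskEstimator I.ρ I.α (sampleSize I d (stageOf hm k) s a)
          (fun i => backup I (TopologicalSpace.denseSeq (S → ℝ) j) s a
            (x (stageOf hm k, locOf hm k + 1, s, a, i))) -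
          risk I.ρ I.α (Φ s a) (backup I (TopologicalSpace.denseSeq (S → ℝ) j) s a)| ≤ ε + η k) :
    Tendsto (fun k => ‖qSeq I hm d x k - optimalQ I Φ‖) atTop (𝓝 0) := by
  set Q := optimalQ I Φ with hQd
  have hQ : bellman I Φ Q = Q := (bellman_eq_self_iff I hγ hα Φ hΦ Q).2 rfl
  have hγ' : 0 < 1 - I.γ := by linarith [hγ.2]
  obtain ⟨R, hR⟩ := exists_eventually_norm_qSeq_le hγ hα hsize hn hm hlr0 hlr (d := d) hx
  -- The three `ε` pay for replacing the iterate by a net point in the estimator, for the deviation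
  -- at the net point, and for replacing it again in the exact risk.
  have key : ∀ ε : ℝ, 0 < ε → ∀ᶠ k in atTop, ‖qSeq I hm d x k - Q‖ ≤ 3 * ε / (1 - I.γ) + ε := by
    intro ε hε
    obtain ⟨J, hJ⟩ := exists_finset_denseSeq (S := S) R hε
    choose η hη0 hηn hη using fun s a j => hdev s a j ε hε
    -- The net point changes with `k`; summing the nonnegative perturbations over all pairs and net
    -- points gives one bound valid for every choice.
    have hneg : Negligible (fun k => I.lr (k + 1))
        fun k => ∑ i : (S × A), ∑ j ∈ J, η i.1 i.2 j k :=
      Negligible.sum _ fun i _ => Negligible.sum _ fun j _ => hηn i.1 i.2 j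
    refine eventually_le_of_recursion hγ' hlr0 hlr hsum hneg ?_ hε
    filter_upwards [hR, hlr.eventually (ge_mem_nhds one_pos)] with k hk h1
    obtain ⟨j, hj, hVj⟩ := hJ (maxQ (qSeq I hm d x k))
      (by rw [dist_zero_right]; exact (norm_maxQ_le _).trans hk)
    set V := TopologicalSpace.denseSeq (S → ℝ) j with hV
    set e := ‖qSeq I hm d x k - Q‖ with he
    set E := ∑ i : (S × A), ∑ j ∈ J, η i.1 i.2 j k with hE
    have hVj' : ‖maxQ (qSeq I hm d x k) - V‖ ≤ ε := by rw [← dist_eq_norm]; exact hVj.le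
    have hVQ : ‖V - maxQ Q‖ ≤ ε + e := by
      calc ‖V - maxQ Q‖ = ‖(V - maxQ (qSeq I hm d x k)) + (maxQ (qSeq I hm d x k) - maxQ Q)‖ := by
            rw [sub_add_sub_cancel]
        _ ≤ ‖V - maxQ (qSeq I hm d x k)‖ + ‖maxQ (qSeq I hm d x k) - maxQ Q‖ := norm_add_le _ _
        _ ≤ ε + e := add_le_add (by rwa [norm_sub_rev]) (norm_maxQ_sub_le _ _)
    have hηE : ∀ s a, η s a j k ≤ E := fun s a =>
      (Finset.single_le_sum (f := fun j => η s a j k) (fun j _ => hη0 s a j k) hj).trans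
        (Finset.single_le_sum (f := fun i : S × A => ∑ j ∈ J, η i.1 i.2 j k)
          (fun i _ => Finset.sum_nonneg fun j _ => hη0 i.1 i.2 j k) (Finset.mem_univ (s, a)))
    have hE0 : 0 ≤ E := Finset.sum_nonneg fun i _ => Finset.sum_nonneg fun j _ => hη0 i.1 i.2 j k
    have he0 : 0 ≤ e := norm_nonneg _
    have hl0 := hlr0 k
    have hbound : 0 ≤ (1 - (1 - I.γ) * I.lr (k + 1)) * e + I.lr (k + 1) * (3 * ε + E) := by
      have : 0 ≤ 1 - (1 - I.γ) * I.lr (k + 1) := by nlinarith [hγ.1]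
      positivity
    rw [pi_norm_le_iff_of_nonneg hbound]
    intro s
    rw [pi_norm_le_iff_of_nonneg hbound]
    intro a
    set T := riskEstimator I.ρ I.α (sampleSize I d (stageOf hm k) s a)
      (fun i => backup I (maxQ (qSeq I hm d x k)) s a
        (x (stageOf hm k, locOf hm k + 1, s, a, i))) with hT
    set T' := riskEstimator I.ρ I.α (sampleSize I d (stageOf hm k) s a)
      (fun i => backup I V s a (x (stageOf hm k, locOf hm k + 1, s, a, i))) with hT'
    have t1 : |T - T'| ≤ ε :=
      abs_riskEstimator_sub_le I.ρ hα (one_le_sampleSize hsize hn d (stageOf hm k) s a) fun i _ =>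
        (abs_backup_sub_le I hγ.1 _ _ s a (hx k s a i)).trans
          ((mul_le_mul_of_nonneg_left hVj' hγ.1).trans (mul_le_of_le_one_left hε.le hγ.2.le))
    have t2 : |T' - risk I.ρ I.α (Φ s a) (backup I V s a)| ≤ ε + E :=
      (hη s a j k).trans (add_le_add le_rfl (hηE s a))
    have t3 : |risk I.ρ I.α (Φ s a) (backup I V s a) - Q s a| ≤ ε + I.γ * e := by
      have h2 := abs_risk_backup_sub_le I hγ hα Φ hΦ V (maxQ Q) s a
      have h3 : Q s a = risk I.ρ I.α (Φ s a) (backup I (maxQ Q) s a) :=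
        (congrFun (congrFun hQ s) a).symm
      rw [h3]
      refine h2.trans ((mul_le_mul_of_nonneg_left hVQ hγ.1).trans ?_)
      rw [mul_add]
      exact add_le_add (mul_le_of_le_one_left hε.le hγ.2.le) le_rfl
    have t4 : |qSeq I hm d x k s a - Q s a| ≤ e :=
      (norm_le_pi_norm ((qSeq I hm d x k - Q) s) a).trans (norm_le_pi_norm (qSeq I hm d x k - Q) s)
    have t5 : |T - Q s a| ≤ 3 * ε + E + I.γ * e := by
      have := (abs_sub_le T T' (Q s a)).trans (add_le_add t1
        ((abs_sub_le T' (risk I.ρ I.α (Φ s a) (backup I V s a)) (Q s a)).trans (add_le_add t2 t3)))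
      linarith
    have t6 : qSeq I hm d x (k + 1) s a - Q s a =
        (1 - I.lr (k + 1)) * (qSeq I hm d x k s a - Q s a) + I.lr (k + 1) * (T - Q s a) := by
      rw [qSeq_succ]
      ring
    show ‖qSeq I hm d x (k + 1) s a - Q s a‖ ≤ _
    rw [t6, Real.norm_eq_abs]
    refine (abs_add_le _ _).trans ?_
    rw [abs_mul, abs_mul, abs_of_nonneg hl0, abs_of_nonneg (sub_nonneg.2 h1)]
    have t7 := mul_le_mul_of_nonneg_left t4 (sub_nonneg.2 h1)
    have t8 := mul_le_mul_of_nonneg_left t5 hl0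
    linarith
  refine tendsto_order.2 ⟨fun b hb => Eventually.of_forall fun k => hb.trans_le (norm_nonneg _),
    fun b hb => ?_⟩
  have hc : 0 < 3 / (1 - I.γ) + 1 := by positivity
  filter_upwards [key (b / 2 / (3 / (1 - I.γ) + 1)) (by positivity)] with k hk
  have h2 : 3 * (b / 2 / (3 / (1 - I.γ) + 1)) / (1 - I.γ) + b / 2 / (3 / (1 - I.γ) + 1) = b / 2 := by
    field_simp
  linarith

end Iterates

end BRQL

/-! ### Almost sure convergence of the algorithm -/

theorem mainTheorem1 {S A : Type*} [Fintype S] [Fintype A] [DecidableEq S] [DecidableEq A]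
    [Nonempty S] [Nonempty A]
    {Ω : Type*} [MeasurableSpace Ω] (P : Measure Ω) [IsProbabilityMeasure P]
    (I : BRQL.Input S A)
    (hγ : 0 ≤ I.γ ∧ I.γ < 1) (hα : 0 < I.α ∧ I.α < 1)
    (hprior : ∀ s a s', 1 ≤ I.prior s a s') (hsize : 1 ≤ I.minSize)
    (hn : ∀ t, ∃ t', t ≤ t' ∧ 1 ≤ I.n t') (hm : ∀ t, ∃ t', t ≤ t' ∧ 1 ≤ I.m t')
    (hlr_nonneg : ∀ l, 1 ≤ l → 0 ≤ I.lr l)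
    (hlr_sum : Tendsto (fun L : ℕ => ∑ l ∈ Finset.Icc 1 L, I.lr l) atTop atTop)
    (hlr_sq : Summable (fun l : ℕ => I.lr (l + 1) ^ 2))
    (pc : S → A → S → ℝ) (hpc : ∀ s a, pc s a ∈ stdSimplex ℝ S)
    (obs : ℕ → ℕ → Ω → S × A × S)
    (hobs_meas : ∀ t i, 1 ≤ t → i < I.n t → ∀ z, MeasurableSet (obs t i ⁻¹' {z}))
    (hobs : BRQL.IsTransitionData I P pc obs)
    (draw : BRQL.Draw S A → Ω → S → ℝ) (hdraw_meas : ∀ j, Measurable (draw j))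
    (hdraw : BRQL.IsPosteriorSampling I P obs draw) :
    ∀ᵐ ω ∂P,
      (∀ Q : S → A → ℝ,
        BRQL.bellman I (BRQL.limitPosterior I pc (fun t i => obs t i ω)) Q = Q ↔
          Q = BRQL.dataOptimalQ I pc (fun t i => obs t i ω)) ∧
      Tendsto
        (fun t : ℕ => ‖BRQL.qStage I (fun t i => obs t i ω) (fun j => draw j ω) t -
          BRQL.dataOptimalQ I pc (fun t i => obs t i ω)‖)
        atTop (𝓝 0) := by
  have hpost := fun ω s a =>
    BRQL.isProbabilityMeasure_limitPosterior (pc := pc) hprior (fun t i => obs t i ω) s a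
  have hsupp := fun ω s a =>
    BRQL.ae_mem_stdSimplex_limitPosterior (I := I) hpc (fun t i => obs t i ω) s a
  have hlr0 : ∀ k, 0 ≤ I.lr (k + 1) := fun k => hlr_nonneg _ (Nat.le_add_left _ _)
  have hlr : Tendsto (fun k => I.lr (k + 1)) atTop (𝓝 0) := by
    have h := (Real.continuous_sqrt.tendsto 0).comp hlr_sq.tendsto_atTop_zero
    rw [Real.sqrt_zero] at h
    exact h.congr fun k => Real.sqrt_sq (hlr0 k)
  have hsum : Tendsto (fun K => ∑ k ∈ Finset.range K, I.lr (k + 1)) atTop atTop :=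
    hlr_sum.congr fun K => by
      rw [Finset.range_eq_Ico, Finset.sum_Ico_add' I.lr 0 K 1]
      rfl
  have hdraws : ∀ᵐ ω ∂P, ∀ k s a i,
      draw (BRQL.stageOf hm k, BRQL.locOf hm k + 1, s, a, i) ω ∈ stdSimplex ℝ S :=
    ae_all_iff.2 fun k => ae_all_iff.2 fun s => ae_all_iff.2 fun a => ae_all_iff.2 fun i =>
      BRQL.ae_draw_mem_stdSimplex hdraw
        ⟨BRQL.one_le_stageOf hm k, Nat.le_add_left _ _, BRQL.locOf_lt hm k⟩
  -- One null set for countably many cases: pairs, possible limiting laws, dense value functions,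
  -- tolerances `1 / (n + 1)` and tail functions.
  have hnoise := ae_all_iff.2 fun s => ae_all_iff.2 fun a => ae_all_iff.2 fun o : Option (S → ℕ) =>
    ae_all_iff.2 fun j : ℕ => ae_all_iff.2 fun n : ℕ => ae_all_iff.2 fun l : Fin 3 =>
      BRQL.ae_exists_tendsto_sum_empMean hprior hn hm hlr_sq hobs_meas hdraw_meas hdraw s a
        (BRQL.measurable_tailFun I (TopologicalSpace.denseSeq (S → ℝ) j) s a
          (BRQL.valueAtRisk I.α (BRQL.limitLaw I pc s a o)
            (BRQL.backup I (TopologicalSpace.denseSeq (S → ℝ) j) s a)) (1 / ((n : ℝ) + 1)) l)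
        (BRQL.abs_tailFun_le hγ.1 (TopologicalSpace.denseSeq (S → ℝ) j) s a
          (BRQL.valueAtRisk I.α (BRQL.limitLaw I pc s a o)
            (BRQL.backup I (TopologicalSpace.denseSeq (S → ℝ) j) s a)) (1 / ((n : ℝ) + 1)) l)
        (∫ p, BRQL.tailFun I (TopologicalSpace.denseSeq (S → ℝ) j) s a
          (BRQL.valueAtRisk I.α (BRQL.limitLaw I pc s a o)
            (BRQL.backup I (TopologicalSpace.denseSeq (S → ℝ) j) s a)) (1 / ((n : ℝ) + 1)) l p
          ∂BRQL.limitLaw I pc s a o)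
  filter_upwards [BRQL.ae_isRegularPath hprior hpc hn hobs_meas hobs, hdraws, hnoise]
    with ω hreg hx hL
  have := hpost ω
  refine ⟨fun Q => BRQL.bellman_eq_self_iff I hγ hα _ (hsupp ω) Q, ?_⟩
  have hconv := BRQL.tendsto_norm_qSeq_sub hγ hα hsize hn hm hlr0 hlr
    (d := fun t i => obs t i ω) (x := fun j => draw j ω) hx hsum
    (BRQL.limitPosterior I pc (fun t i => obs t i ω)) (hsupp ω) fun s a j ε hε => by
      have hc : 0 < 1 + I.α⁻¹ := by have := inv_pos.2 hα.1; linarith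
      -- The tolerance is chosen to absorb the factor `1 + α⁻¹` of the deviation bound.
      obtain ⟨n, hn'⟩ := exists_nat_one_div_lt (div_pos hε hc)
      obtain ⟨o, ho⟩ := BRQL.exists_limitPosterior_eq (I := I) pc (fun t i => obs t i ω) s a
      obtain ⟨η, h0, h1, h2⟩ := BRQL.exists_negligible_dev hprior hpc hγ.1 hα hsize hn hm
        (lam := fun k => I.lr (k + 1))
        (fun k i => hx k s a i) (hreg s a) (TopologicalSpace.denseSeq (S → ℝ) j)
        (Nat.one_div_pos_of_nat (n := n)) rfl (by simpa only [ho] using hL s a o j n)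
      refine ⟨η, h0, h1, fun k => (h2 k).trans (add_le_add ?_ le_rfl)⟩
      rw [mul_comm]
      exact ((lt_div_iff₀ hc).1 hn').le
  refine (hconv.comp (BRQL.tendsto_cumul hm)).congr fun t => ?_
  simp only [Function.comp_apply, BRQL.qStage_eq_qSeq I hm]
  rfl
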